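/- **Setting.** The *Extended 1 Or 3* cellular automaton acts on configurations $\xi_t\in\{0,1,2\}^{\mathbb Z}$ by $\xi_{t+1}(x)=f(\xi_t(x-2),\dots,\xi_t(x+2))$. Write $\delta(a)=\mathbf 1[a=1]$, $\ell=\delta(a)+\delta(b)+\delta(c) \bmod 2$, $r=\delta(c)+\delta(d)+\delta(e)\bmod 2$, and let $N$ be the number of non-zero entries among $\ell,r,b,c,d$. Then $f(a,b,c,d,e)=1$ if $\delta(b)+\delta(c)+\delta(d)$ is odd; otherwise $f(a,b,c,d,e)=2$ if $N\in\{1,3\}$, and $f(a,b,c,d,e)=0$ if not. Write $\xi(x,t)=\xi_t(x)$. Let $\lambda^\circ$ be the *1 Or 3* automaton $\lambda_{t+1}(x)=\lambda_t(x-1)+\lambda_t(x)+\lambda_t(x+1) \bmod 2$ started from a single $1$ at the origin, let $\Lambda=\{(x,t):t\ge 0,\ \lambda^\circ_t(x)=1\}$, and let $\Lambda(r)\subset\mathbb Z^2$ be the set of points at $\ell^1$-distance at most $r$ from $\Lambda$. An *ether* is an element of $\{0,2\}^{\mathbb Z^2}$ that is periodic in both coordinates; two ethers are *equivalent* if they are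 translates of each other in $\mathbb Z^2$. An initial configuration $\xi_0$ of finite support (or the resulting $\xi$) is a *replicator with ether $\eta$* if, for some finite $r$, on each bounded (nearest-neighbour) connected component of $\mathbb Z^2\setminus\Lambda(r)$ the configuration $\xi$ agrees with some ether equivalent to $\eta$. It is a *replicator* if it is a replicator with some ether. A *uniformly random binary seed* on $[0,L]$ has independent uniform values in $\{0,1\}$ on $[0,L]\cap\mathbb Z$, and $0$ elsewhere. The *signature* of an ether $\eta$ is the lexicographically first among the shortest strings $B$ for which some time slice $\eta(\cdot,t)$ is a translate of the periodic configuration $B^\infty$. The *reflection* of $\eta$ is $\bar\eta(x,t)=\eta(-x,t)$; $\eta$ is *symmetric* if $\bar\eta$ is equivalent to $\eta$. Below, $[k]$ stands for $k$ consecutive $0$s, and the density is that of the $2$s in space-time. **Theorem (Replication and ether probabilities for *Extended 1 Or 3*).** Let $\xi$ be the *Extended 1 Or 3* automaton started from a uniformly random binary seed on $[0,L]$. Then $$\liminf_{L\to\infty}\mathbb P(\xi\text{ is a replicator})\ge 0.826 .$$ Moreover, for each row of the following table, the ether $\eta$ generated under the *Extended 1 Or 3* rule from the initial condition $B^\infty$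 (extended periodically to all times $t\in\mathbb Z$) has signature $B$ and the listed periods and density, and $$\liminf_{L\to\infty}\mathbb P(\xi\text{ is a replicator with ether }\eta)\ \ge\ p ,$$ except that for the row with $B=[9]2000202$ the number $p$ is instead a lower bound for the sum of this $\liminf$ and the corresponding one for the reflection $\bar\eta$. The ether of that row is not symmetric; the twelve others are. $$\begin{array}{|c|c|c|c|c|}\hline \text{signature }B&\text{temporal period}&\text{spatial period}&\text{density of }2\text{s}&\text{lower bound }p\\ \hline 0&1&1&0&0.6061\\ 02&1&2&1/2&0.0471\\ 0002&2&4&1/2&0.0333\\ [7]2&4&8&3/8&0.0664\\ [5]202&4&8&3/8&0.0189\\ [15]2&8&16&5/16&0.0193\\ [13]202&8&16&11/32&0.0079\\ [11]20002&8&16&5/16&0.0024\\ [9]2000202&8&16&3/8&0.0085\\ [9]2020202&8&16&3/8&0.0006\\ [7]200020202&8&16&13/32&0.0045\\ [7]202020202&8&16&7/16&0.0105\\ [5]2[5]20202&8&16&7/16&0.0006\\ \hline \end{array}$$ -/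

import Mathlib

namespace ExtendedOneOrThree

/-! ### The cellular automata -/

/-- The states `0`, `1`, `2`. -/
abbrev State := Fin 3

/-- The first level `δ(a) = 𝟙[a = 1]`. -/
def delta (a : State) : ℕ := if a = 1 then 1 else 0

/-- The indicator that a state is `1` or `2`. -/
def occ (a : State) : ℕ := if a = 0 then 0 else 1

/-- The update rule of *Extended 1 Or 3*. Here `l` and `r` are the first-level states of the left
and right neighbours at the next time step, and `N` counts the entries `1` and `2` among
`l, r, b, c, d`. -/
def rule (a b c d e : State) : State :=
  let l := (delta a + delta b + delta c) % 2
  let r := (delta c + delta d + delta e) % 2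
  let N := l + r + occ b + occ c + occ d
  if (delta b + delta c + delta d) % 2 = 1 then 1
  else if N = 1 ∨ N = 3 then 2
  else 0

/-- One time step of *Extended 1 Or 3*. -/
def step (ξ : ℤ → State) : ℤ → State :=
  fun x => rule (ξ (x - 2)) (ξ (x - 1)) (ξ x) (ξ (x + 1)) (ξ (x + 2))

/-- `evolve ξ₀ t x` is the state of the cell `x` at time `t`, from the initial state `ξ₀`. -/
def evolve (ξ₀ : ℤ → State) (t : ℕ) : ℤ → State := step^[t] ξ₀

/-- One time step of *1 Or 3*, the sum modulo `2` of a cell and its two neighbours. -/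
def addStep (lam : ℤ → ZMod 2) : ℤ → ZMod 2 :=
  fun x => lam (x - 1) + lam x + lam (x + 1)

/-- *1 Or 3* started from a single `1` at the origin, at time `t` and cell `x`. -/
def addSingle (t : ℕ) : ℤ → ZMod 2 := addStep^[t] (fun x => if x = 0 then 1 else 0)

/-! ### The web and its complement.  Space-time points are written `(x, t)`. -/

/-- The support `Λ` of *1 Or 3* started from a single `1`. -/
def web : Set (ℤ × ℤ) := {p | 0 ≤ p.2 ∧ addSingle p.2.toNat p.1 = 1}

/-- The `ℓ¹`-distance on `ℤ²`. -/
def dist1 (p q : ℤ × ℤ) : ℤ := |p.1 - q.1| + |p.2 - q.2|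

/-- `Λ(r)`: the points at `ℓ¹`-distance at most `r` from `Λ`. -/
def thickWeb (r : ℕ) : Set (ℤ × ℤ) := {p | ∃ q ∈ web, dist1 p q ≤ r}

/-- The nearest-neighbour graph on `ℤ²`. -/
def lattice : SimpleGraph (ℤ × ℤ) where
  Adj p q := dist1 p q = 1
  symm := ⟨fun p q h => by
    simpa only [dist1, abs_sub_comm q.1 p.1, abs_sub_comm q.2 p.2] using h⟩
  loopless := ⟨fun p h => by simp [dist1] at h⟩

/-- `K` is a connected component of the subset `S` of `ℤ²`. -/
def IsComponentOf (K S : Set (ℤ × ℤ)) : Prop :=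
  ∃ C : (lattice.induce S).ConnectedComponent, K = Subtype.val '' C.supp

/-! ### Ethers.  The value of `η` at cell `x` and time `t` is written `η x t`. -/

/-- An ether: an element of `{0,2}^(ℤ²)` that is periodic in both coordinates. -/
def IsEther (η : ℤ → ℤ → State) : Prop :=
  (∀ x t, η x t ≠ 1) ∧
  (∃ p : ℕ, 0 < p ∧ ∀ x t, η (x + p) t = η x t) ∧
  (∃ q : ℕ, 0 < q ∧ ∀ x t, η x (t + q) = η x t)

/-- Two ethers are equivalent if one is a space-time translate of the other. -/
def Equivalent (η η' : ℤ → ℤ → State) : Prop :=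
  ∃ a s : ℤ, ∀ x t, η' x t = η (x + a) (t + s)

/-- The reflection of an ether around the time axis. -/
def reflect (η : ℤ → ℤ → State) : ℤ → ℤ → State := fun x t => η (-x) t

/-- An ether is symmetric if its reflection is equivalent to it. -/
def IsSymmetric (η : ℤ → ℤ → State) : Prop := Equivalent η (reflect η)

/-- `K ⊆ ℤ × [0,∞)` and, on `K`, the configuration started from `ξ₀` agrees with some translate
of `η`. -/
def FilledWith (ξ₀ : ℤ → State) (K : Set (ℤ × ℤ)) (η : ℤ → ℤ → State) : Prop :=
  ∃ η', Equivalent η η' ∧ ∀ p ∈ K, 0 ≤ p.2 ∧ evolve ξ₀ p.2.toNat p.1 = η' p.1 p.2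

/-- The seed `ξ₀` is a replicator of thickness `r` and ether `η`: every bounded component of the
complement of `Λ(r)` is filled with `η`. (A subset of `ℤ²` is bounded iff it is finite.) -/
def IsReplicatorOfThickness (ξ₀ : ℤ → State) (r : ℕ) (η : ℤ → ℤ → State) : Prop :=
  ∀ K : Set (ℤ × ℤ), IsComponentOf K (thickWeb r)ᶜ → K.Finite → FilledWith ξ₀ K η

/-- The seed `ξ₀` is a replicator with ether `η`, of some thickness. -/
def IsReplicatorWith (η : ℤ → ℤ → State) (ξ₀ : ℤ → State) : Prop :=
  IsEther η ∧ ∃ r : ℕ, IsReplicatorOfThickness ξ₀ r η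

/-- The seed `ξ₀` is a replicator, of some thickness and with some ether. -/
def IsReplicator (ξ₀ : ℤ → State) : Prop := ∃ η, IsReplicatorWith η ξ₀

/-! ### Uniformly random binary seeds -/

/-- The binary seed on `[0, L]` given by a choice of bits; it is `0` outside `[0, L]`. -/
def binarySeed (L : ℕ) (ω : Set.Icc (0 : ℤ) L → Bool) : ℤ → State :=
  fun x => if h : 0 ≤ x ∧ x ≤ L then (if ω ⟨x, h⟩ then 1 else 0) else 0

/-- The probability that a uniformly random binary seed on `[0, L]` has the property `E`: the
proportion of bit choices for which it holds, the bits being independent and uniform. -/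
noncomputable def seedProb (L : ℕ) (E : (ℤ → State) → Prop) : ℝ :=
  (Nat.card {ω : Set.Icc (0 : ℤ) L → Bool // E (binarySeed L ω)} : ℝ) /
    Nat.card (Set.Icc (0 : ℤ) L → Bool)

/-- The `liminf`, as `L → ∞`, of the probability of `E` for uniformly random binary seeds
on `[0, L]`. -/
noncomputable def liminfProb (E : (ℤ → State) → Prop) : ℝ :=
  Filter.liminf (fun L : ℕ => seedProb L E) Filter.atTop

/-! ### Signatures, periods and densities -/

/-- The periodic configuration `B^∞`, with a copy of the string `B` starting at the origin. -/
def periodicWord (B : List State) : ℤ → State :=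
  fun x => B.getD (x % (B.length : ℤ)).toNat 0

/-- Some time slice of `η` is a spatial translate of `B^∞`. -/
def HasSlice (η : ℤ → ℤ → State) (B : List State) : Prop :=
  B ≠ [] ∧ ∃ t a : ℤ, ∀ x, η x t = periodicWord B (x + a)

/-- `B` is the signature of `η`: the first, in the lexicographic order, among the shortest strings
`B` such that some time slice of `η` is a translate of `B^∞`. -/
def IsSignature (η : ℤ → ℤ → State) (B : List State) : Prop :=
  HasSlice η B ∧
  ∀ B', HasSlice η B' → B.length < B'.length ∨ (B.length = B'.length ∧ B ≤ B')

/-- `η` is the ether of *Extended 1 Or 3* that is generated from the initial condition `B^∞`.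
Such an `η` is unique, since it is periodic in time. -/
def IsGeneratedBy (η : ℤ → ℤ → State) (B : List State) : Prop :=
  IsEther η ∧
  (∀ t : ℤ, (fun x => η x (t + 1)) = step (fun x => η x t)) ∧
  (∀ x, η x 0 = periodicWord B x)

/-- The temporal period of `η` is `T`. -/
def HasTemporalPeriod (η : ℤ → ℤ → State) (T : ℕ) : Prop :=
  IsLeast {q : ℕ | 0 < q ∧ ∀ x t, η x (t + q) = η x t} T

/-- The spatial period of `η` is `S`. -/
def HasSpatialPeriod (η : ℤ → ℤ → State) (S : ℕ) : Prop :=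
  IsLeast {p : ℕ | 0 < p ∧ ∀ x t, η (x + p) t = η x t} S

/-- The proportion of `2`s of `η` in the space-time box `[0, S) × [0, T)`. -/
def densityOfTwos (η : ℤ → ℤ → State) (S T : ℕ) : ℚ :=
  (((Finset.range S ×ˢ Finset.range T).filter
    (fun p : ℕ × ℕ => η (p.1 : ℤ) (p.2 : ℤ) = 2)).card : ℚ) / ((S : ℚ) * (T : ℚ))

/-! ### The table -/

/-- A row of the table of ethers. -/
structure Row where
  signature : List State
  temporalPeriod : ℕ
  spatialPeriod : ℕ
  density : ℚ
  /-- Whether the ether is symmetric. -/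
  symmetric : Bool
  /-- The lower bound for the asymptotic probability (for an ether that is not symmetric: for that
  of the ether and that of its reflection, combined). -/
  bound : ℚ

/-- A string `[k]` of `k` zeros. -/
def zeros (k : ℕ) : List State := List.replicate k 0

/-- The thirteen ethers, with their lower bounds. -/
def table : List Row :=
  [ ⟨[0], 1, 1, 0, true, 0.6061⟩,
    ⟨[0, 2], 1, 2, 1 / 2, true, 0.0471⟩,
    ⟨[0, 0, 0, 2], 2, 4, 1 / 2, true, 0.0333⟩,
    ⟨zeros 7 ++ [2], 4, 8, 3 / 8, true, 0.0664⟩,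
    ⟨zeros 5 ++ [2, 0, 2], 4, 8, 3 / 8, true, 0.0189⟩,
    ⟨zeros 15 ++ [2], 8, 16, 5 / 16, true, 0.0193⟩,
    ⟨zeros 13 ++ [2, 0, 2], 8, 16, 11 / 32, true, 0.0079⟩,
    ⟨zeros 11 ++ [2, 0, 0, 0, 2], 8, 16, 5 / 16, true, 0.0024⟩,
    ⟨zeros 9 ++ [2, 0, 0, 0, 2, 0, 2], 8, 16, 3 / 8, false, 0.0085⟩,
    ⟨zeros 9 ++ [2, 0, 2, 0, 2, 0, 2], 8, 16, 3 / 8, true, 0.0006⟩,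
    ⟨zeros 7 ++ [2, 0, 0, 0, 2, 0, 2, 0, 2], 8, 16, 13 / 32, true, 0.0045⟩,
    ⟨zeros 7 ++ [2, 0, 2, 0, 2, 0, 2, 0, 2], 8, 16, 7 / 16, true, 0.0105⟩,
    ⟨zeros 5 ++ [2] ++ zeros 5 ++ [2, 0, 2, 0, 2], 8, 16, 7 / 16, true, 0.0006⟩ ]

end ExtendedOneOrThree

namespace ExtendedOneOrThree

/-! ### Linear algebra of *1 Or 3* -/

/-! The cells in state 1 evolve by the additive automaton, whatever the 2s do, so the first level of
`ξ` is a superposition of translates of the web, one for each 1 of the seed. By self-similarity of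
the web (`exists_row_pat`), a point of a bounded component of the complement of the thick web has
below it a row of the web that on a wide interval reads `pat 32`. On that row the first level of `ξ`
is therefore a translate of `voidRow L`, which depends only on the seed and is annihilated by
`addStep^[32]`. Suppose that all configurations with this first level, whatever their 2s, reach a
translate of `η` within 32 + 16 steps (`GoodFor η 32`). Then `η` fills a box above the point, boxes
of neighbouring points overlap in a full period, and so one translate of `η` fills the component
(`isReplicatorWith_of_goodFor`).

Each row has four preimages, so the kernel of `addStep^[32]` has `4 ^ 32` elements. For given seed
bits on `[64, L]`, the first 64 bits can be solved for so as to produce any prescribed row of this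
kernel (`voidRow_seedFor`). The probability of a replicator with a given ether is thus at least the
proportion of good rows in the kernel (`seedProb_ge`), and it remains to count good rows.

A state consists of its first level and its occupied cells `s`. Above a known pair of rows `g ↦ f`,
the new occupied cells are affine in `s`, except in the middle of a `101` of `f` above a `000` of
`g`, where a product of three cells enters (`occ_cell`). The state at the time when the first level
dies is read off by functionals of the earlier states, which are pulled back along the tree of
ancestors of the zero row. A functional that pulls back to zero is constant: the initial state is
forgotten. If all have vanished, every further ancestor leads to the same ether (`cert_leaf`). If
one survives, the ancestors for which it becomes constant are counted by a leaner recursion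
(`locCount_le`, `cert_single`). Otherwise the search branches into preimages, or gives up when too
many functionals survive. Only 16 levels are considered; goodness is inherited by ancestors, and a
geometric series transfers the count to 32 levels (`weight_mul_cnt_le`, `three_mul_goodCount_le`).

Once the first level is dead, the occupied cells have period 48 and evolve by `addStep`. Sixteen
steps later they form a row of period 16, and on a ring of 16 cells the eighth power of `addStep` is
the identity; a table tells which ether it is (`goodFor_classOf`). The kernel evaluates the search
(`root_search_eq`), with the counts for all ethers packed into one number, and `sound_search`
justifies it. The program tests its unproved guesses and counts 0 if a test fails, so that it always
yields a lower bound. -/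

theorem two_eq_zero_zmod : (2 : ZMod 2) = 0 := rfl

theorem addStep_add (f g : ℤ → ZMod 2) : addStep (f + g) = addStep f + addStep g := by
  funext x; simp only [addStep, Pi.add_apply]; ring

theorem addStep_zero : addStep 0 = 0 := by
  funext x; simp [addStep]

theorem addStep_iterate_add (n : ℕ) (f g : ℤ → ZMod 2) :
    addStep^[n] (f + g) = addStep^[n] f + addStep^[n] g := by
  induction n generalizing f g with
  | zero => rfl
  | succ n ih => simp only [Function.iterate_succ_apply, addStep_add, ih]

theorem addStep_iterate_zero (n : ℕ) : addStep^[n] 0 = 0 :=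
  Function.iterate_fixed addStep_zero n

/-- Translation of a row. -/
def shift {α : Type*} (c : ℤ) (f : ℤ → α) : ℤ → α := fun x => f (x + c)

theorem shift_apply {α : Type*} (c : ℤ) (f : ℤ → α) (x : ℤ) : shift c f x = f (x + c) := rfl

theorem shift_shift {α : Type*} (c d : ℤ) (f : ℤ → α) : shift c (shift d f) = shift (c + d) f := by
  funext x; simp only [shift]; congr 1; ring

theorem shift_zero {α : Type*} (f : ℤ → α) : shift 0 f = f := by
  funext x; simp [shift]

theorem addStep_shift (c : ℤ) (f : ℤ → ZMod 2) : addStep (shift c f) = shift c (addStep f) := by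
  funext x; simp only [addStep, shift]
  rw [show x - 1 + c = x + c - 1 by ring, show x + 1 + c = x + c + 1 by ring]

theorem addStep_iterate_shift (n : ℕ) (c : ℤ) (f : ℤ → ZMod 2) :
    addStep^[n] (shift c f) = shift c (addStep^[n] f) := by
  induction n generalizing f with
  | zero => rfl
  | succ n ih => simp only [Function.iterate_succ_apply, addStep_shift, ih]

/-- Frobenius: in characteristic 2, the power `2 ^ i` of `X⁻¹ + 1 + X` has just the three terms with
exponents `-2 ^ i`, `0`, `2 ^ i`. -/
theorem addStep_iterate_two_pow (i : ℕ) (f : ℤ → ZMod 2) (x : ℤ) :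
    addStep^[2 ^ i] f x = f (x - 2 ^ i) + f x + f (x + 2 ^ i) := by
  induction i generalizing f x with
  | zero => simp [addStep]
  | succ i ih =>
    rw [pow_succ, mul_two, Function.iterate_add_apply, ih, ih, ih, ih]
    rw [show x - 2 ^ i - 2 ^ i = x - 2 ^ (i + 1) by ring,
      show x - 2 ^ i + 2 ^ i = x by ring, show x + 2 ^ i - 2 ^ i = x by ring,
      show x + 2 ^ i + 2 ^ i = x + 2 ^ (i + 1) by ring]
    linear_combination (f (x - 2 ^ i) + f x + f (x + 2 ^ i)) * two_eq_zero_zmod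

/-- With `Y` the translation by `2 ^ i`, what is annihilated by `1 + Y + Y ^ 2` is annihilated by `1
+ Y ^ 3`. -/
theorem periodic_of_addStep_iterate_eq_zero {i : ℕ} {f : ℤ → ZMod 2} (h : addStep^[2 ^ i] f = 0)
    (x : ℤ) : f (x + 3 * 2 ^ i) = f x := by
  have h1 := congrFun h (x + 2 ^ i)
  have h2 := congrFun h (x + 2 ^ i + 2 ^ i)
  rw [addStep_iterate_two_pow, Pi.zero_apply] at h1 h2
  rw [show x + 2 ^ i - 2 ^ i = x by ring] at h1
  rw [show x + 2 ^ i + 2 ^ i - 2 ^ i = x + 2 ^ i by ring,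
    show x + 2 ^ i + 2 ^ i + 2 ^ i = x + 3 * 2 ^ i by ring] at h2
  linear_combination h2 - h1 + (f x - f (x + 3 * 2 ^ i) + f (x + 3 * 2 ^ i) ) * two_eq_zero_zmod -
    f x * two_eq_zero_zmod

theorem addStep_iterate_eq_zero_of_le {m n : ℕ} (hmn : m ≤ n) {f : ℤ → ZMod 2}
    (h : addStep^[m] f = 0) : addStep^[n] f = 0 := by
  obtain ⟨k, rfl⟩ := Nat.exists_eq_add_of_le' hmn
  rw [Function.iterate_add_apply, h, addStep_iterate_zero]

theorem eq_zero_of_addStep_eq_zero {d : ℤ → ZMod 2} (h : addStep d = 0) {q : ℤ}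
    (h0 : d q = 0) (h1 : d (q + 1) = 0) : d = 0 := by
  have hs : ∀ x, d (x - 1) + d x + d (x + 1) = 0 := fun x => congrFun h x
  have hf : ∀ n : ℕ, d (q + n) = 0 ∧ d (q + n + 1) = 0 := by
    intro n
    induction n with
    | zero => simpa using ⟨h0, h1⟩
    | succ n ih =>
      refine ⟨by push_cast; rw [← add_assoc]; exact ih.2, ?_⟩
      have := hs (q + n + 1)
      rw [show q + n + 1 - 1 = q + (n : ℤ) by ring, ih.1, ih.2] at this
      push_cast; rw [← add_assoc]; simpa using this
  have hb : ∀ n : ℕ, d (q - n) = 0 ∧ d (q - n + 1) = 0 := by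
    intro n
    induction n with
    | zero => simpa using ⟨h0, h1⟩
    | succ n ih =>
      have := hs (q - n)
      rw [ih.1, ih.2] at this
      constructor
      · push_cast; rw [show q - ((n : ℤ) + 1) = q - n - 1 by ring]; simpa using this
      · push_cast; rw [show q - ((n : ℤ) + 1) + 1 = q - n by ring]; exact ih.1
  funext x
  rcases le_total q x with hx | hx
  · have := (hf (x - q).toNat).1
    rwa [Int.toNat_of_nonneg (by omega), show q + (x - q) = x by ring] at this
  · have := (hb (q - x).toNat).1
    rwa [Int.toNat_of_nonneg (by omega), show q - (q - x) = x by ring] at this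

/-- The right half of a row whose image is `f`. -/
def preRight (f : ℤ → ZMod 2) (q : ℤ) (b0 b1 : ZMod 2) : ℕ → ZMod 2
  | 0 => b0
  | 1 => b1
  | n + 2 => f (q + 1 + n) + preRight f q b0 b1 (n + 1) + preRight f q b0 b1 n

/-- The left half of a row whose image is `f`. -/
def preLeft (f : ℤ → ZMod 2) (q : ℤ) (b0 b1 : ZMod 2) : ℕ → ZMod 2
  | 0 => b1
  | 1 => b0
  | n + 2 => f (q - n) + preLeft f q b0 b1 (n + 1) + preLeft f q b0 b1 n

/-- The row with image `f` and the values `b0`, `b1` at `q`, `q + 1`. -/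
def pre (f : ℤ → ZMod 2) (q : ℤ) (b0 b1 : ZMod 2) : ℤ → ZMod 2 := fun x =>
  if q ≤ x then preRight f q b0 b1 (x - q).toNat else preLeft f q b0 b1 (q + 1 - x).toNat

theorem pre_right (f : ℤ → ZMod 2) (q : ℤ) (b0 b1 : ZMod 2) (n : ℕ) :
    pre f q b0 b1 (q + n) = preRight f q b0 b1 n := by
  simp [pre]

theorem pre_left (f : ℤ → ZMod 2) (q : ℤ) (b0 b1 : ZMod 2) (n : ℕ) :
    pre f q b0 b1 (q + 1 - n) = preLeft f q b0 b1 n := by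
  match n with
  | 0 => simp [pre, preRight, preLeft]
  | 1 => simp [pre, preRight, preLeft]
  | n + 2 =>
    rw [pre, if_neg (by push_cast; omega)]
    congr 1; push_cast; omega

theorem pre_apply_self (f : ℤ → ZMod 2) (q : ℤ) (b0 b1 : ZMod 2) : pre f q b0 b1 q = b0 := by
  simpa [preRight] using pre_right f q b0 b1 0

theorem pre_apply_succ (f : ℤ → ZMod 2) (q : ℤ) (b0 b1 : ZMod 2) :
    pre f q b0 b1 (q + 1) = b1 := by
  simpa [preRight] using pre_right f q b0 b1 1

theorem addStep_pre (f : ℤ → ZMod 2) (q : ℤ) (b0 b1 : ZMod 2) : addStep (pre f q b0 b1) = f := by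
  funext x
  simp only [addStep]
  rcases lt_or_ge q x with hx | hx
  · obtain ⟨n, rfl⟩ : ∃ n : ℕ, x = q + 1 + n := ⟨(x - q - 1).toNat, by omega⟩
    have e0 := pre_right f q b0 b1 n
    have e1 := pre_right f q b0 b1 (n + 1)
    have e2 := pre_right f q b0 b1 (n + 2)
    push_cast at e1 e2
    rw [show q + 1 + (n : ℤ) - 1 = q + n by ring, show q + 1 + (n : ℤ) = q + (n + 1) by ring,
      show q + ((n : ℤ) + 1) + 1 = q + (n + 2) by ring, e0, e1, e2, preRight,
      show q + ((n : ℤ) + 1) = q + 1 + n by ring]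
    linear_combination (preRight f q b0 b1 n + preRight f q b0 b1 (n + 1)) * two_eq_zero_zmod
  · obtain ⟨n, rfl⟩ : ∃ n : ℕ, x = q - n := ⟨(q - x).toNat, by omega⟩
    have e0 := pre_left f q b0 b1 n
    have e1 := pre_left f q b0 b1 (n + 1)
    have e2 := pre_left f q b0 b1 (n + 2)
    push_cast at e1 e2
    rw [show q - (n : ℤ) + 1 = q + 1 - n by ring, show q - (n : ℤ) = q + 1 - (n + 1) by ring,
      show q + 1 - ((n : ℤ) + 1) - 1 = q + 1 - (n + 2) by ring, e0, e1, e2, preLeft,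
      show q + 1 - ((n : ℤ) + 1) = q - n by ring]
    linear_combination (preLeft f q b0 b1 n + preLeft f q b0 b1 (n + 1)) * two_eq_zero_zmod

theorem eq_of_addStep_eq {g h : ℤ → ZMod 2} (e : addStep g = addStep h) {q : ℤ}
    (h0 : g q = h q) (h1 : g (q + 1) = h (q + 1)) : g = h := by
  have hz : g + h = 0 := by
    refine eq_zero_of_addStep_eq_zero (q := q) ?_ ?_ ?_
    · rw [addStep_add, e]; funext x; simp [CharTwo.add_self_eq_zero]
    · simp [h0, CharTwo.add_self_eq_zero]
    · simp [h1, CharTwo.add_self_eq_zero]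
  funext x
  have := congrFun hz x
  simp only [Pi.add_apply, Pi.zero_apply] at this
  exact CharTwo.add_eq_zero.mp this

theorem eq_pre {f g : ℤ → ZMod 2} (h : addStep g = f) (q : ℤ) :
    g = pre f q (g q) (g (q + 1)) :=
  eq_of_addStep_eq (h.trans (addStep_pre _ _ _ _).symm) (pre_apply_self _ _ _ _).symm
    (pre_apply_succ _ _ _ _).symm

/-! ### Counting ancestors -/

/-- The ancestors of `f`, `k` steps back, that satisfy `P`. -/
abbrev Anc (P : (ℤ → ZMod 2) → Prop) (k : ℕ) (f : ℤ → ZMod 2) :=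
  {g : ℤ → ZMod 2 // addStep^[k] g = f ∧ P g}

/-- The number of ancestors of `f`, `k` steps back, that satisfy `P`. -/
noncomputable def cnt (P : (ℤ → ZMod 2) → Prop) (k : ℕ) (f : ℤ → ZMod 2) : ℕ := Nat.card (Anc P k f)

/-- Sorting the ancestors by the values at `q`, `q + 1` of their last descendant before `f`. -/
def ancSuccEquiv (P : (ℤ → ZMod 2) → Prop) (k : ℕ) (f : ℤ → ZMod 2) (q : ℤ) :
    Anc P (k + 1) f ≃ Σ b : ZMod 2 × ZMod 2, Anc P k (pre f q b.1 b.2) where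
  toFun g := ⟨(addStep^[k] g.1 q, addStep^[k] g.1 (q + 1)), g.1,
    eq_pre ((Function.iterate_succ_apply' addStep k g.1).symm.trans g.2.1) q, g.2.2⟩
  invFun g := ⟨g.2.1, by rw [Function.iterate_succ_apply', g.2.2.1, addStep_pre], g.2.2.2⟩
  left_inv g := rfl
  right_inv := by
    rintro ⟨⟨b0, b1⟩, g, hg, hP⟩
    have e0 : addStep^[k] g q = b0 := by rw [hg, pre_apply_self]
    have e1 : addStep^[k] g (q + 1) = b1 := by rw [hg, pre_apply_succ]
    subst e0 e1
    rfl

instance finite_anc (P : (ℤ → ZMod 2) → Prop) (k : ℕ) (f : ℤ → ZMod 2) : Finite (Anc P k f) := by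
  induction k generalizing f with
  | zero =>
    have : Subsingleton (Anc P 0 f) := ⟨fun a b => Subtype.ext (a.2.1.trans b.2.1.symm)⟩
    infer_instance
  | succ k ih => exact Finite.of_equiv _ (ancSuccEquiv P k f 0).symm

theorem cnt_succ (P : (ℤ → ZMod 2) → Prop) (k : ℕ) (f : ℤ → ZMod 2) (q : ℤ) :
    cnt P (k + 1) f = ∑ b : ZMod 2 × ZMod 2, cnt P k (pre f q b.1 b.2) := by
  rw [cnt, Nat.card_congr (ancSuccEquiv P k f q), Nat.card_sigma]; rfl

theorem cnt_succ' (P : (ℤ → ZMod 2) → Prop) (k : ℕ) (f : ℤ → ZMod 2) (q : ℤ) :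
    cnt P (k + 1) f = cnt P k (pre f q 0 0) + cnt P k (pre f q 1 0) + cnt P k (pre f q 0 1) +
      cnt P k (pre f q 1 1) := by
  rw [cnt_succ P k f q, Fintype.sum_prod_type]
  change ∑ a : Fin 2, ∑ b : Fin 2, cnt P k (pre f q a b) = _
  rw [Fin.sum_univ_two, Fin.sum_univ_two, Fin.sum_univ_two]
  change cnt P k (pre f q 0 0) + cnt P k (pre f q 0 1) +
    (cnt P k (pre f q 1 0) + cnt P k (pre f q 1 1)) = _
  ring

theorem cnt_zero_of (P : (ℤ → ZMod 2) → Prop) {f : ℤ → ZMod 2} (h : P f) : cnt P 0 f = 1 := by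
  rw [cnt, Nat.card_eq_one_iff_exists]
  exact ⟨⟨f, rfl, h⟩, fun g => Subtype.ext g.2.1⟩

theorem cnt_zero_of_not (P : (ℤ → ZMod 2) → Prop) {f : ℤ → ZMod 2} (h : ¬ P f) : cnt P 0 f = 0 := by
  rw [cnt, Nat.card_eq_zero]
  exact Or.inl ⟨fun g => h (g.2.1 ▸ g.2.2)⟩

theorem cnt_mono {P P' : (ℤ → ZMod 2) → Prop} {k : ℕ} {f : ℤ → ZMod 2}
    (h : ∀ g, addStep^[k] g = f → P g → P' g) : cnt P k f ≤ cnt P' k f :=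
  Nat.card_le_card_of_injective (fun g : Anc P k f => (⟨g.1, g.2.1, h g.1 g.2.1 g.2.2⟩ : Anc P' k f))
    fun _ _ hab => Subtype.ext (congrArg (fun z : Anc P' k f => z.1) hab)

theorem cnt_of_forall {P : (ℤ → ZMod 2) → Prop} {k : ℕ} {f : ℤ → ZMod 2}
    (h : ∀ g, addStep^[k] g = f → P g) : cnt P k f = 4 ^ k := by
  induction k generalizing f with
  | zero => exact cnt_zero_of P (h f rfl)
  | succ k ih =>
    have : ∀ b0 b1, cnt P k (pre f 0 b0 b1) = 4 ^ k := fun b0 b1 => ih fun g hg => h g (by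
      rw [Function.iterate_succ_apply', hg, addStep_pre])
    rw [cnt_succ' P k f 0, this, this, this, this]; ring

/-- If all ancestors of the rows in `X` satisfy `P`, then `P` has many ancestors. -/
theorem cnt_mul_le {X P : (ℤ → ZMod 2) → Prop} {k l : ℕ} {f : ℤ → ZMod 2}
    (h : ∀ u, addStep^[k] u = f → X u → ∀ g, addStep^[l] g = u → P g) :
    cnt X k f * 4 ^ l ≤ cnt P (k + l) f := by
  induction k generalizing f with
  | zero =>
    by_cases hX : X f
    · rw [cnt_zero_of X hX, one_mul, zero_add, cnt_of_forall (h f rfl hX)]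
    · rw [cnt_zero_of_not X hX, zero_mul]; exact Nat.zero_le _
  | succ k ih =>
    have h' : ∀ b0 b1, cnt X k (pre f 0 b0 b1) * 4 ^ l ≤ cnt P (k + l) (pre f 0 b0 b1) :=
      fun b0 b1 => ih fun u hu => h u (by rw [Function.iterate_succ_apply', hu, addStep_pre])
    rw [show k + 1 + l = (k + l) + 1 by ring, cnt_succ' X k f 0, cnt_succ' P (k + l) f 0]
    linarith [h' 0 0, h' 0 1, h' 1 0, h' 1 1]

theorem cnt_or {P P' : (ℤ → ZMod 2) → Prop} {k : ℕ} {f : ℤ → ZMod 2}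
    (h : ∀ g, addStep^[k] g = f → P g → ¬ P' g) :
    cnt (fun g => P g ∨ P' g) k f = cnt P k f + cnt P' k f := by
  induction k generalizing f with
  | zero =>
    by_cases hP : P f <;> by_cases hP' : P' f
    · exact absurd hP' (h f rfl hP)
    · rw [cnt_zero_of _ hP, cnt_zero_of_not _ hP', cnt_zero_of _ (Or.inl hP)]
    · rw [cnt_zero_of _ hP', cnt_zero_of_not _ hP, cnt_zero_of _ (Or.inr hP')]
    · rw [cnt_zero_of_not _ hP, cnt_zero_of_not _ hP', cnt_zero_of_not _ (by tauto)]
  | succ k ih =>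
    have h' : ∀ b0 b1, _ := fun b0 b1 => ih (f := pre f 0 b0 b1) fun u hu => h u (by
      rw [Function.iterate_succ_apply', hu, addStep_pre])
    rw [cnt_succ' _ k f 0, cnt_succ' P k f 0, cnt_succ' P' k f 0, h', h', h', h']
    ring

theorem cnt_shift {P : (ℤ → ZMod 2) → Prop} (hP : ∀ c g, P g → P (shift c g)) (c : ℤ) (k : ℕ)
    (f : ℤ → ZMod 2) : cnt P k (shift c f) = cnt P k f := by
  refine Nat.card_congr
    { toFun := fun g => ⟨shift (-c) g.1, ?_, hP _ _ g.2.2⟩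
      invFun := fun g => ⟨shift c g.1, ?_, hP _ _ g.2.2⟩
      left_inv := fun g => Subtype.ext (by simp [shift_shift, shift_zero])
      right_inv := fun g => Subtype.ext (by simp [shift_shift, shift_zero]) }
  · rw [addStep_iterate_shift, g.2.1, shift_shift, neg_add_cancel, shift_zero]
  · rw [addStep_iterate_shift, g.2.1]

theorem pre_zero_zero (q : ℤ) : pre 0 q 0 0 = 0 :=
  eq_zero_of_addStep_eq_zero (addStep_pre _ _ _ _) (pre_apply_self _ _ _ _) (pre_apply_succ _ _ _ _)

/-- The preimages of the zero row are itself and the three translates of `…110110…`, which have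
equally many ancestors with a translation-invariant property. -/
theorem cnt_succ_zero {P : (ℤ → ZMod 2) → Prop} (hP : ∀ c g, P g → P (shift c g)) (k : ℕ) (q : ℤ) :
    cnt P (k + 1) 0 = cnt P k 0 + 3 * cnt P k (pre 0 q 1 0) := by
  have hpre : ∀ x, pre 0 q 1 0 (x - 1) + pre 0 q 1 0 x + pre 0 q 1 0 (x + 1) = 0 :=
    fun x => congrFun (addStep_pre 0 q 1 0) x
  have e0 : pre 0 q 1 0 q = 1 := pre_apply_self _ _ _ _
  have e1 : pre 0 q 1 0 (q + 1) = 0 := pre_apply_succ _ _ _ _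
  have e2 : pre 0 q 1 0 (q + 2) = 1 := by
    have := hpre (q + 1)
    rw [show q + 1 - 1 = q by ring, show q + 1 + 1 = q + 2 by ring, e0, e1] at this
    linear_combination this - two_eq_zero_zmod
  have e3 : pre 0 q 1 0 (q + 3) = 1 := by
    have := hpre (q + 2)
    rw [show q + 2 - 1 = q + 1 by ring, show q + 2 + 1 = q + 3 by ring, e2, e1] at this
    linear_combination this - two_eq_zero_zmod
  have h01 : pre 0 q 0 1 = shift 1 (pre 0 q 1 0) := by
    refine eq_of_addStep_eq (q := q) ?_ ?_ ?_
    · rw [addStep_shift, addStep_pre, addStep_pre]; rfl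
    · rw [pre_apply_self, shift_apply, e1]
    · rw [pre_apply_succ, shift_apply, show q + 1 + 1 = q + 2 by ring, e2]
  have h11 : pre 0 q 1 1 = shift 2 (pre 0 q 1 0) := by
    refine eq_of_addStep_eq (q := q) ?_ ?_ ?_
    · rw [addStep_shift, addStep_pre, addStep_pre]; rfl
    · rw [pre_apply_self, shift_apply, e2]
    · rw [pre_apply_succ, shift_apply, show q + 1 + 2 = q + 3 by ring, e3]
  rw [cnt_succ' P k 0 q, h01, h11, cnt_shift hP, cnt_shift hP, pre_zero_zero]
  ring

/-! ### *Extended 1 Or 3* in terms of its first level and its occupied cells -/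

/-- The first level of a state, as a bit. -/
def bit1 (a : State) : ZMod 2 := if a = 1 then 1 else 0

/-- The indicator that a state is not `0`, as a bit. -/
def bit12 (a : State) : ZMod 2 := if a = 0 then 0 else 1

/-- The first level of a configuration, as a row of bits. -/
def level (ξ : ℤ → State) : ℤ → ZMod 2 := fun x => bit1 (ξ x)

/-- The indicator of the non-zero cells. -/
def occupied (ξ : ℤ → State) : ℤ → ZMod 2 := fun x => bit12 (ξ x)

/-- The occupied cells one step after `s`, where `f` is the new first level. -/
def occStep (f s : ℤ → ZMod 2) : ℤ → ZMod 2 := fun x =>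
  if f x = 1 then 1 else f (x - 1) + f (x + 1) + s (x - 1) + s x + s (x + 1) +
    f (x - 1) * f (x + 1) * s (x - 1) * s x * s (x + 1)

/-- The occupied cells after `n` steps, from the first level `g` and the occupied cells `s`. -/
def occAfter : ℕ → (ℤ → ZMod 2) → (ℤ → ZMod 2) → ℤ → ZMod 2
  | 0, _, s => s
  | n + 1, g, s => occStep (addStep^[n + 1] g) (occAfter n g s)

/-- All `1`s of `f` are `1`s of `s`. -/
def Dominates (s f : ℤ → ZMod 2) : Prop := ∀ x, f x = 1 → s x = 1

theorem bit1_rule : ∀ a b c d e : State,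
    bit1 (rule a b c d e) = bit1 b + bit1 c + bit1 d := by
  decide +kernel

theorem bit12_rule : ∀ a b c d e : State, bit12 (rule a b c d e) =
    if bit1 b + bit1 c + bit1 d = 1 then 1 else
      (bit1 a + bit1 b + bit1 c) + (bit1 c + bit1 d + bit1 e) + bit12 b + bit12 c + bit12 d +
        (bit1 a + bit1 b + bit1 c) * (bit1 c + bit1 d + bit1 e) * bit12 b * bit12 c * bit12 d := by
  decide +kernel

theorem level_step (ξ : ℤ → State) : level (step ξ) = addStep (level ξ) :=
  funext fun _ => bit1_rule _ _ _ _ _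

theorem occupied_step (ξ : ℤ → State) :
    occupied (step ξ) = occStep (addStep (level ξ)) (occupied ξ) := by
  funext x
  refine (bit12_rule _ _ _ _ _).trans ?_
  simp only [level, addStep, occStep, occupied]
  rw [show x - 1 - 1 = x - 2 by ring, show x - 1 + 1 = x by ring, show x + 1 - 1 = x by ring,
    show x + 1 + 1 = x + 2 by ring]
  rfl

theorem evolve_succ (ξ : ℤ → State) (n : ℕ) : evolve ξ (n + 1) = step (evolve ξ n) :=
  Function.iterate_succ_apply' step n ξ

theorem evolve_succ' (ξ : ℤ → State) (n : ℕ) : evolve ξ (n + 1) = evolve (step ξ) n := rfl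

theorem evolve_add (ξ : ℤ → State) (m n : ℕ) : evolve ξ (m + n) = evolve (evolve ξ m) n := by
  rw [add_comm]; exact Function.iterate_add_apply step n m ξ

theorem level_evolve (ξ : ℤ → State) (n : ℕ) : level (evolve ξ n) = addStep^[n] (level ξ) := by
  induction n with
  | zero => rfl
  | succ n ih => rw [evolve_succ, level_step, ih, Function.iterate_succ_apply']

theorem occupied_evolve (ξ : ℤ → State) (n : ℕ) :
    occupied (evolve ξ n) = occAfter n (level ξ) (occupied ξ) := by
  induction n with
  | zero => rfl
  | succ n ih =>
    rw [evolve_succ, occupied_step, ih, level_evolve, occAfter, Function.iterate_succ_apply']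

theorem dominates_occupied (ξ : ℤ → State) : Dominates (occupied ξ) (level ξ) := by
  intro x
  simp only [level, occupied]
  generalize ξ x = a
  revert a; decide +kernel

theorem dominates_self (f : ℤ → ZMod 2) : Dominates f f := fun _ h => h

theorem Dominates.shift {s f : ℤ → ZMod 2} (h : Dominates s f) (c : ℤ) :
    Dominates (shift c s) (shift c f) := fun x hx => h (x + c) hx

theorem dominates_occStep (f s : ℤ → ZMod 2) : Dominates (occStep f s) f :=
  fun x hx => by rw [occStep, if_pos hx]

theorem dominates_occAfter {g s : ℤ → ZMod 2} (h : Dominates s g) (n : ℕ) :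
    Dominates (occAfter n g s) (addStep^[n] g) := by
  cases n with
  | zero => exact h
  | succ n => exact dominates_occStep _ _

theorem occStep_shift (c : ℤ) (f s : ℤ → ZMod 2) :
    occStep (shift c f) (shift c s) = shift c (occStep f s) := by
  funext x
  simp only [occStep, shift]
  rw [show x - 1 + c = x + c - 1 by ring, show x + 1 + c = x + c + 1 by ring]
  rfl

theorem occAfter_shift (n : ℕ) (c : ℤ) (g s : ℤ → ZMod 2) :
    occAfter n (shift c g) (shift c s) = shift c (occAfter n g s) := by
  induction n with
  | zero => rfl
  | succ n ih => rw [occAfter, ih, addStep_iterate_shift, occStep_shift]; rfl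

theorem occAfter_succ' (n : ℕ) (g s : ℤ → ZMod 2) :
    occAfter (n + 1) g s = occAfter n (addStep g) (occStep (addStep g) s) := by
  induction n with
  | zero => rfl
  | succ n ih => rw [occAfter, ih, occAfter, ← Function.iterate_succ_apply]

theorem occStep_zero (s : ℤ → ZMod 2) : occStep 0 s = addStep s := by
  funext x; simp [occStep, addStep]

theorem occAfter_zero (n : ℕ) (s : ℤ → ZMod 2) : occAfter n 0 s = addStep^[n] s := by
  induction n with
  | zero => rfl
  | succ n ih => rw [occAfter, ih, addStep_iterate_zero, occStep_zero, Function.iterate_succ_apply']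

theorem eq_of_level_of_occupied {ξ ξ' : ℤ → State} {x x' : ℤ} (h : level ξ x = level ξ' x')
    (h' : occupied ξ x = occupied ξ' x') : ξ x = ξ' x' := by
  revert h h'
  simp only [level, occupied]
  generalize ξ x = a; generalize ξ' x' = b
  revert a b; decide +kernel

/-- The outer two cells enter only through their first level, which itself spreads at speed 1. This
is why the interval of agreement in `agree_evolve` loses one cell per step at each end, although the
rule has range 2. -/
theorem rule_congr {a a' b c d e e' : State} (h : a = 1 ↔ a' = 1) (h' : e = 1 ↔ e' = 1) :
    rule a b c d e = rule a' b c d e' := by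
  have e1 : delta a = delta a' := by simp only [delta, h]
  have e2 : delta e = delta e' := by simp only [delta, h']
  simp only [rule, e1, e2]

theorem level_eq_iff {ξ ξ' : ℤ → State} {x x' : ℤ} :
    level ξ x = level ξ' x' ↔ (ξ x = 1 ↔ ξ' x' = 1) := by
  simp only [level]
  generalize ξ x = a; generalize ξ' x' = b
  revert a b; decide +kernel

theorem agree_step {ξ ξ' : ℤ → State} {a b : ℤ} (h : ∀ x, a ≤ x → x ≤ b → ξ x = ξ' x)
    (hd : ∀ x, a - 1 ≤ x → x ≤ b + 1 → level ξ x = level ξ' x) :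
    (∀ x, a + 1 ≤ x → x ≤ b - 1 → step ξ x = step ξ' x) ∧
      ∀ x, a ≤ x → x ≤ b → level (step ξ) x = level (step ξ') x := by
  constructor
  · intro x h1 h2
    simp only [step]
    rw [h (x - 1) (by omega) (by omega), h x (by omega) (by omega), h (x + 1) (by omega) (by omega)]
    exact rule_congr (level_eq_iff.1 (hd _ (by omega) (by omega)))
      (level_eq_iff.1 (hd _ (by omega) (by omega)))
  · intro x h1 h2
    rw [level_step, level_step, addStep, addStep, hd _ (by omega) (by omega),
      hd _ (by omega) (by omega), hd _ (by omega) (by omega)]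

theorem agree_evolve {ξ ξ' : ℤ → State} {a b : ℤ} (h : ∀ x, a ≤ x → x ≤ b → ξ x = ξ' x) (n : ℕ) :
    (∀ x, a + 1 + n ≤ x → x ≤ b - 1 - n → evolve ξ n x = evolve ξ' n x) ∧
      ∀ x, a + n ≤ x → x ≤ b - n → level (evolve ξ n) x = level (evolve ξ' n) x := by
  induction n with
  | zero =>
    refine ⟨fun x h1 h2 => h x (by push_cast at h1; omega) (by push_cast at h2; omega),
      fun x h1 h2 => level_eq_iff.2 ?_⟩
    rw [show evolve ξ 0 x = evolve ξ' 0 x from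
      h x (by push_cast at h1; omega) (by push_cast at h2; omega)]
  | succ n ih =>
    obtain ⟨i1, i2⟩ := ih
    rw [evolve_succ, evolve_succ]
    have := agree_step i1 fun x h1 h2 => i2 x (by omega) (by omega)
    refine ⟨fun x h1 h2 => this.1 x ?_ ?_, fun x h1 h2 => this.2 x ?_ ?_⟩ <;>
    · push_cast at h1 h2; omega

theorem step_shift (c : ℤ) (ξ : ℤ → State) : step (shift c ξ) = shift c (step ξ) := by
  funext x
  simp only [step, shift]
  rw [show x - 2 + c = x + c - 2 by ring, show x - 1 + c = x + c - 1 by ring,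
    show x + 1 + c = x + c + 1 by ring, show x + 2 + c = x + c + 2 by ring]

theorem evolve_shift (c : ℤ) (ξ : ℤ → State) (n : ℕ) :
    evolve (shift c ξ) n = shift c (evolve ξ n) := by
  induction n with
  | zero => rfl
  | succ n ih => rw [evolve_succ, evolve_succ, ih, step_shift]

/-- `η` is a space-time history of *Extended 1 Or 3*. -/
def IsHistory (η : ℤ → ℤ → State) : Prop :=
  ∀ t : ℤ, (fun x => η x (t + 1)) = step (fun x => η x t)

theorem IsHistory.evolve {η : ℤ → ℤ → State} (h : IsHistory η) (a s : ℤ) (n : ℕ) :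
    evolve (fun x => η (x + a) s) n = fun x => η (x + a) (s + n) := by
  induction n with
  | zero => simp [ExtendedOneOrThree.evolve]
  | succ n ih =>
    rw [evolve_succ, ih]
    have := step_shift a (fun x => η x (s + n))
    rw [← h] at this
    push_cast; rw [← add_assoc]
    exact this

/-- Every configuration with first level `f` reaches a translate of `η` within `m + 16` steps. -/
def GoodFor (η : ℤ → ℤ → State) (m : ℕ) (f : ℤ → ZMod 2) : Prop :=
  ∀ ξ, level ξ = f → ∃ a s : ℤ, ∀ x, evolve ξ (m + 16) x = η (x + a) s

theorem GoodFor.of_addStep {η : ℤ → ℤ → State} {m : ℕ} {f g : ℤ → ZMod 2}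
    (h : GoodFor η m f) (hg : addStep g = f) : GoodFor η (m + 1) g := by
  intro ξ hξ
  rw [show m + 1 + 16 = (m + 16) + 1 by ring, evolve_succ']
  exact h (step ξ) (by rw [level_step, hξ, hg])

theorem GoodFor.of_iterate {η : ℤ → ℤ → State} {m k : ℕ} {f g : ℤ → ZMod 2}
    (h : GoodFor η m f) (hg : addStep^[k] g = f) : GoodFor η (m + k) g := by
  induction k generalizing g with
  | zero => exact (show g = f from hg).symm ▸ h
  | succ k ih => exact GoodFor.of_addStep (ih (by rwa [Function.iterate_succ_apply] at hg)) rfl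

theorem GoodFor.mono {η : ℤ → ℤ → State} (hη : IsHistory η) {m n : ℕ} (hmn : m ≤ n)
    {f : ℤ → ZMod 2} (h : GoodFor η m f) : GoodFor η n f := by
  obtain ⟨k, rfl⟩ := Nat.exists_eq_add_of_le hmn
  intro ξ hξ
  obtain ⟨a, s, hs⟩ := h ξ hξ
  refine ⟨a, s + k, fun x => ?_⟩
  rw [show m + k + 16 = (m + 16) + k by ring, evolve_add, show evolve ξ (m + 16) = _ from funext hs,
    hη.evolve]

theorem GoodFor.shift {η : ℤ → ℤ → State} {m : ℕ} {f : ℤ → ZMod 2} (h : GoodFor η m f) (c : ℤ) :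
    GoodFor η m (shift c f) := by
  intro ξ hξ
  obtain ⟨a, s, hs⟩ := h (ExtendedOneOrThree.shift (-c) ξ) (by
    have : level (ExtendedOneOrThree.shift (-c) ξ) = ExtendedOneOrThree.shift (-c) (level ξ) := rfl
    rw [this, hξ, shift_shift, neg_add_cancel, shift_zero])
  refine ⟨a + c, s, fun x => ?_⟩
  have := hs (x + c)
  rw [evolve_shift, shift_apply, show x + c + -c = x by ring] at this
  rw [this]; congr 1; ring

/-! ### The web -/

theorem addSingle_succ (n : ℕ) (x : ℤ) :
    addSingle (n + 1) x = addSingle n (x - 1) + addSingle n x + addSingle n (x + 1) := by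
  rw [addSingle, Function.iterate_succ_apply']; rfl

theorem addSingle_eq_zero {n : ℕ} {x : ℤ} (h : (n : ℤ) < |x|) : addSingle n x = 0 := by
  induction n generalizing x with
  | zero =>
    have : x ≠ 0 := by rintro rfl; simp at h
    simp [addSingle, this]
  | succ n ih =>
    rw [addSingle_succ]
    push_cast at h
    rw [lt_abs] at h
    have h1 : (n : ℤ) < |x - 1| := by rw [lt_abs]; omega
    have h2 : (n : ℤ) < |x| := by rw [lt_abs]; omega
    have h3 : (n : ℤ) < |x + 1| := by rw [lt_abs]; omega
    rw [ih h1, ih h2, ih h3]; rfl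

theorem addSingle_neg (n : ℕ) (x : ℤ) : addSingle n (-x) = addSingle n x := by
  induction n generalizing x with
  | zero => simp [addSingle]
  | succ n ih =>
    rw [addSingle_succ, addSingle_succ, show -x - 1 = -(x + 1) by ring,
      show -x + 1 = -(x - 1) by ring, ih, ih, ih]
    ring

theorem addSingle_self (n : ℕ) : addSingle n n = 1 := by
  induction n with
  | zero => simp [addSingle]
  | succ n ih =>
    rw [addSingle_succ]
    push_cast
    rw [show (n : ℤ) + 1 - 1 = n by ring, ih, addSingle_eq_zero, addSingle_eq_zero]
    · rfl
    all_goals rw [lt_abs]; omega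

theorem addSingle_add_two (n : ℕ) (x : ℤ) :
    addSingle (n + 2) x = addSingle n (x - 2) + addSingle n x + addSingle n (x + 2) := by
  rw [addSingle, show n + 2 = 2 ^ 1 + n by ring, Function.iterate_add_apply,
    addStep_iterate_two_pow]
  rfl

/-- Frobenius again: squaring a polynomial over the field of two elements doubles its exponents.
This is the self-similarity of the web. -/
theorem addSingle_double (n : ℕ) (z : ℤ) :
    addSingle (2 * n) (2 * z) = addSingle n z ∧ addSingle (2 * n) (2 * z + 1) = 0 := by
  induction n generalizing z with
  | zero =>
    have : 2 * z + 1 ≠ 0 := by omega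
    simp [addSingle, this]
  | succ n ih =>
    rw [show 2 * (n + 1) = 2 * n + 2 by ring, addSingle_add_two, addSingle_add_two, addSingle_succ,
      show 2 * z - 2 = 2 * (z - 1) by ring, show 2 * z + 2 = 2 * (z + 1) by ring,
      show 2 * z + 1 - 2 = 2 * (z - 1) + 1 by ring, show 2 * z + 1 + 2 = 2 * (z + 1) + 1 by ring]
    simp [ih]

theorem addSingle_double_succ (n : ℕ) (z : ℤ) : addSingle (2 * n + 1) (2 * z) = addSingle n z := by
  rw [addSingle_succ, show 2 * z - 1 = 2 * (z - 1) + 1 by ring, (addSingle_double n _).1,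
    (addSingle_double n _).2, (addSingle_double n _).2]
  simp

/-- The row with `1`s at `c` and `c + N` modulo `3 * N`. -/
def pat (N c y : ℤ) : ZMod 2 :=
  if (y - c) % (3 * N) = 0 ∨ (y - c) % (3 * N) = N then 1 else 0

theorem pat_congr {N c y N' c' y' : ℤ}
    (h : ((y - c) % (3 * N) = 0 ∨ (y - c) % (3 * N) = N) ↔
      ((y' - c') % (3 * N') = 0 ∨ (y' - c') % (3 * N') = N')) : pat N c y = pat N' c' y' := by
  simp only [pat, h]

theorem pat_sub (N c y : ℤ) : pat N c y = pat N 0 (y - c) := by simp [pat]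

theorem pat_double {N : ℤ} (c z : ℤ) : pat (2 * N) (2 * c) (2 * z) = pat N c z := by
  apply pat_congr
  rw [show 2 * z - 2 * c = 2 * (z - c) by ring, show 3 * (2 * N) = 2 * (3 * N) by ring,
    Int.mul_emod_mul_of_pos _ _ (by norm_num)]
  omega

theorem pat_double_odd {N : ℤ} (c z : ℤ) : pat (2 * N) (2 * c) (2 * z + 1) = 0 := by
  rw [pat, if_neg]
  have : ((2 * z + 1 - 2 * c) % (3 * (2 * N))) % 2 = (2 * z + 1 - 2 * c) % 2 :=
    Int.emod_emod_of_dvd _ ⟨3 * N, by ring⟩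
  omega

/-- Modulo 3 the number 2 is its own inverse, so the classes `c`, `c + 1` of `2 * z` become `2 * c`,
`2 * c + 2` for `z`; these are consecutive, the first being `2 * c + 2`. -/
theorem pat_one_half (c z : ℤ) : pat 1 c (2 * z) = pat 1 (2 * c + 2) z :=
  pat_congr (by omega)

theorem pat_one_sum (c y : ℤ) : pat 1 c (y - 1) + pat 1 c y + pat 1 c (y + 1) = 0 := by
  have h : (y - c) % 3 = 0 ∨ (y - c) % 3 = 1 ∨ (y - c) % 3 = 2 := by omega
  rcases h with h | h | h
  · have h1 : (y - 1 - c) % 3 = 2 := by omega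
    have h2 : (y + 1 - c) % 3 = 1 := by omega
    simp [pat, h, h1, h2]; rfl
  · have h1 : (y - 1 - c) % 3 = 0 := by omega
    have h2 : (y + 1 - c) % 3 = 2 := by omega
    simp [pat, h, h1, h2]; rfl
  · have h1 : (y - 1 - c) % 3 = 1 := by omega
    have h2 : (y + 1 - c) % 3 = 0 := by omega
    simp [pat, h, h1, h2]; rfl

theorem eq_on_of_sum_eq_zero {f g : ℤ → ZMod 2} {u v : ℤ}
    (hf : ∀ y, u < y → y < v → f (y - 1) + f y + f (y + 1) = 0)
    (hg : ∀ y, u < y → y < v → g (y - 1) + g y + g (y + 1) = 0)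
    (h0 : f u = g u) (h1 : f (u + 1) = g (u + 1)) (y : ℤ) (hu : u ≤ y) (hv : y ≤ v) :
    f y = g y := by
  have key : ∀ n : ℕ, (u + n ≤ v → f (u + n) = g (u + n)) ∧
      (u + n + 1 ≤ v → f (u + n + 1) = g (u + n + 1)) := by
    intro n
    induction n with
    | zero => simpa using ⟨fun _ => h0, fun _ => h1⟩
    | succ n ih =>
      refine ⟨fun h => ?_, fun h => ?_⟩
      · push_cast at h ⊢; rw [← add_assoc]; exact ih.2 (by omega)
      · push_cast at h ⊢; rw [← add_assoc]
        have e1 := hf (u + n + 1) (by omega) (by omega)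
        have e2 := hg (u + n + 1) (by omega) (by omega)
        rw [show u + n + 1 - 1 = u + (n : ℤ) by ring] at e1 e2
        rw [ih.1 (by omega), ih.2 (by omega)] at e1
        linear_combination e1 - e2
  have := (key (y - u).toNat).1
  rw [Int.toNat_of_nonneg (by omega), show u + (y - u) = y by ring] at this
  exact this hv

theorem zmod_two_cases (a : ZMod 2) : a = 0 ∨ a = 1 := by revert a; decide

/-- A piece of a row with zero image obeys a recursion of order 2, whose nonzero solutions are the
three translates of `…110110…`. -/
theorem exists_pat_one {n : ℕ} {u v : ℤ}
    (h0 : ∀ y, u < y → y < v → addSingle (n + 1) y = 0)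
    (h1 : ∃ y, u ≤ y ∧ y ≤ v ∧ addSingle n y ≠ 0) :
    ∃ c, ∀ y, u ≤ y → y ≤ v → addSingle n y = pat 1 c y := by
  have hf : ∀ y, u < y → y < v → addSingle n (y - 1) + addSingle n y + addSingle n (y + 1) = 0 :=
    fun y a b => by rw [← addSingle_succ]; exact h0 y a b
  have fin : ∀ c, addSingle n u = pat 1 c u → addSingle n (u + 1) = pat 1 c (u + 1) →
      ∃ c, ∀ y, u ≤ y → y ≤ v → addSingle n y = pat 1 c y := fun c e0 e1 =>
    ⟨c, eq_on_of_sum_eq_zero hf (fun y _ _ => pat_one_sum c y) e0 e1⟩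
  rcases zmod_two_cases (addSingle n u) with a0 | a0 <;>
    rcases zmod_two_cases (addSingle n (u + 1)) with a1 | a1
  · obtain ⟨y, hy1, hy2, hy⟩ := h1
    exact absurd (eq_on_of_sum_eq_zero (g := fun _ => 0) hf (fun y _ _ => by simp) a0 a1 y hy1 hy2)
      hy
  · refine fin (u + 1) ?_ ?_
    · rw [a0, pat, if_neg (by omega)]
    · rw [a1, pat, if_pos (by omega)]
  · refine fin (u - 1) ?_ ?_
    · rw [a0, pat, if_pos (by omega)]
    · rw [a1, pat, if_neg (by omega)]
  · refine fin u ?_ ?_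
    · rw [a0, pat, if_pos (by omega)]
    · rw [a1, pat, if_pos (by omega)]

/-- Even rows of the web vanish at the odd cells, but any four consecutive cells of `…110110…`
contain `11`. -/
theorem odd_of_pat_one {n : ℕ} {u v c : ℤ} (huv : u + 3 ≤ v)
    (h : ∀ y, u ≤ y → y ≤ v → addSingle n y = pat 1 c y) : ∃ m, n = 2 * m + 1 := by
  rcases Nat.even_or_odd' n with ⟨m, rfl | hm⟩
  · exfalso
    obtain ⟨y, hy1, hy2, hy⟩ : ∃ y, u ≤ y ∧ y + 1 ≤ v ∧ (y - c) % 3 = 0 := by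
      have : (u - c) % 3 = 0 ∨ (u - c) % 3 = 1 ∨ (u - c) % 3 = 2 := by omega
      rcases this with h | h | h
      · exact ⟨u, by omega, by omega, h⟩
      · exact ⟨u + 2, by omega, by omega, by omega⟩
      · exact ⟨u + 1, by omega, by omega, by omega⟩
    have e0 : addSingle (2 * m) y = 1 := by
      rw [h y (by omega) (by omega), pat, if_pos (by omega)]
    have e1 : addSingle (2 * m) (y + 1) = 1 := by
      rw [h (y + 1) (by omega) (by omega), pat, if_pos (by omega)]
    rcases Int.even_or_odd' y with ⟨z, rfl | rfl⟩
    · rw [(addSingle_double m z).2] at e1; exact absurd e1 (by decide)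
    · rw [(addSingle_double m z).2] at e0; exact absurd e0 (by decide)
  · exact ⟨m, hm⟩

/-- Halving: the row is an odd row `2 * n' + 1`, and its even cells show the row `n'`, which reads
`…110110…` on an interval of half the length. The row found below `n'` by induction is then doubled.
The initial length pays for the `i` halvings. -/
theorem exists_pat_two_pow (i : ℕ) {n : ℕ} {u v c : ℤ} (huv : u + 5 * 2 ^ i ≤ v + 2)
    (h : ∀ y, u ≤ y → y ≤ v → addSingle n y = pat 1 c y) :
    ∃ m c', n + 1 = m + 2 ^ i ∧ ∀ y, u ≤ y → y ≤ v → addSingle m y = pat (2 ^ i) c' y := by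
  induction i generalizing n u v c with
  | zero => exact ⟨n, c, rfl, by simpa using h⟩
  | succ i ih =>
    have hpos : (1 : ℤ) ≤ 2 ^ i := one_le_pow₀ (by norm_num)
    rw [pow_succ] at huv
    obtain ⟨n', rfl⟩ := odd_of_pat_one (by omega) h
    obtain ⟨m, c', hm, hc⟩ := ih (n := n') (u := (u + 1) / 2) (v := v / 2) (c := 2 * c + 2)
      (by omega) fun z h1 h2 => by
        rw [← addSingle_double_succ, h (2 * z) (by omega) (by omega), pat_one_half]
    refine ⟨2 * m, 2 * c', by rw [pow_succ]; omega, fun y h1 h2 => ?_⟩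
    rw [pow_succ, mul_comm ((2 : ℤ) ^ i) 2]
    rcases Int.even_or_odd' y with ⟨z, rfl | rfl⟩
    · rw [(addSingle_double m z).1, pat_double, hc z (by omega) (by omega)]
    · rw [(addSingle_double m z).2, pat_double_odd]

/-- Below a point far from the web, the web has a row that is a long piece of `pat 32`. -/
theorem exists_row_pat {x t : ℤ} {k₀ r₁ : ℕ} (hk : 80 ≤ k₀) (hx : |x| ≤ t)
    (h : (x, t) ∉ thickWeb (2 * k₀ + r₁)) :
    ∃ (m k : ℕ) (c : ℤ), (m : ℤ) + k + 31 = t ∧ k₀ ≤ k ∧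
      ∀ y, x - k - r₁ ≤ y → y ≤ x + k + r₁ → addSingle m y = pat 32 c y := by
  classical
  have ht : 0 ≤ t := (abs_nonneg x).trans hx
  -- The window widens by one cell at each end per step back in time. At the least `k` for which the
  -- web meets it, the window of the next row is empty, so this row has zero image there. That `k`
  -- is at least `k₀` follows from the distance to the web, which is at most `k + (k + r₁)`.
  let P : ℕ → Prop := fun k => ∃ n : ℕ, (n : ℤ) + k = t ∧
    ∃ y, x - k - r₁ ≤ y ∧ y ≤ x + k + r₁ ∧ addSingle n y ≠ 0
  have hP : ∃ k, P k := by
    rw [abs_le] at hx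
    exact ⟨t.toNat, 0, by omega, 0, by omega, by omega, by simp [addSingle]⟩
  obtain ⟨n, hn, y₀, hy1, hy2, hy3⟩ := Nat.find_spec hP
  have hmin := fun k => Nat.find_min (m := k) hP
  generalize Nat.find hP = k at hn hy1 hy2 hmin
  have hkk : k₀ ≤ k := by
    by_contra hlt
    apply h
    refine ⟨(y₀, n), ⟨by simp, ?_⟩, ?_⟩
    · rcases zmod_two_cases (addSingle n y₀) with h0 | h0
      · exact absurd h0 hy3
      · simpa using h0
    · simp only [dist1]
      have h1 : |x - y₀| ≤ k + r₁ := abs_le.2 ⟨by omega, by omega⟩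
      have h2 : |t - (n : ℤ)| ≤ k := abs_le.2 ⟨by omega, by omega⟩
      push_cast; omega
  obtain ⟨c, hc⟩ := exists_pat_one (n := n) (u := x - k - r₁) (v := x + k + r₁)
    (fun y h1 h2 => by
      by_contra hne
      exact hmin (k - 1) (by omega) ⟨n + 1, by push_cast; omega, y, by omega, by omega, hne⟩)
    ⟨y₀, hy1, hy2, hy3⟩
  obtain ⟨m, c', hm, hc'⟩ := exists_pat_two_pow 5 (by norm_num; omega) hc
  exact ⟨m, k, c', by norm_num at hm; omega, hkk, hc'⟩

/-! ### Superposition -/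

theorem addStep_iterate_eq_sum {f : ℤ → ZMod 2} {L : ℤ} (hf : ∀ x, ¬ (0 ≤ x ∧ x ≤ L) → f x = 0)
    (n : ℕ) (x : ℤ) :
    addStep^[n] f x = ∑ y ∈ Finset.Icc 0 L, f y * addSingle n (x - y) := by
  induction n generalizing x with
  | zero =>
    simp only [Function.iterate_zero, id, addSingle]
    by_cases hx : 0 ≤ x ∧ x ≤ L
    · rw [Finset.sum_eq_single_of_mem x (Finset.mem_Icc.2 hx)]
      · simp
      · intro y _ hy
        rw [if_neg (by omega), mul_zero]
    · rw [hf x hx, Finset.sum_eq_zero]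
      intro y hy
      rw [Finset.mem_Icc] at hy
      rw [if_neg (by rintro h; exact hx (by rw [show x = y by omega]; exact hy)), mul_zero]
  | succ n ih =>
    rw [Function.iterate_succ_apply', addStep, ih, ih, ih, ← Finset.sum_add_distrib,
      ← Finset.sum_add_distrib]
    refine Finset.sum_congr rfl fun y _ => ?_
    rw [addSingle_succ, show x - 1 - y = x - y - 1 by ring, show x + 1 - y = x - y + 1 by ring]
    ring

/-- The first level that is generated by the seed `f` on `[0, L]` in the voids of the web. -/
noncomputable def voidRow (L : ℤ) (f : ℤ → ZMod 2) : ℤ → ZMod 2 :=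
  fun x => ∑ y ∈ Finset.Icc 0 L, f y * pat 32 0 (x - y)

/-! ### Voids -/

/-- On a box above `p`, the history of `ξ₀` is the translate of `η` by `(a, s)`. -/
def AgreesNear (ξ₀ : ℤ → State) (η : ℤ → ℤ → State) (a s : ℤ) (p : ℤ × ℤ) : Prop :=
  ∀ (x : ℤ) (h : ℕ), |x - p.1| ≤ 40 → h ≤ 40 →
    evolve ξ₀ (p.2 + h).toNat x = η (x + a) (p.2 + h + s)

theorem agreesNear_of_notMem_thickWeb {η : ℤ → ℤ → State} (hη : IsHistory η) {L : ℕ}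
    {ξ₀ : ℤ → State} (hL : ∀ x : ℤ, ¬ (0 ≤ x ∧ x ≤ L) → level ξ₀ x = 0)
    (hgood : GoodFor η 32 (voidRow L (level ξ₀))) {p : ℤ × ℤ} (hp : |p.1| ≤ p.2)
    (hw : p ∉ thickWeb (2 * 80 + (L + 120))) : ∃ a s, AgreesNear ξ₀ η a s p := by
  obtain ⟨x, t⟩ := p
  obtain ⟨m, k, c, hm, hk, hpat⟩ := exists_row_pat le_rfl hp hw
  push_cast at hpat
  have hrow : ∀ y, x - k - 120 ≤ y → y ≤ x + k + (L + 120) →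
      level (evolve ξ₀ m) y = voidRow L (level ξ₀) (y - c) := by
    intro y h1 h2
    rw [level_evolve, addStep_iterate_eq_sum hL, voidRow]
    refine Finset.sum_congr rfl fun z hz => ?_
    rw [Finset.mem_Icc] at hz
    rw [hpat _ (by omega) (by omega), pat_sub, show y - z - c = y - c - z by ring]
  -- The goodness hypothesis speaks of configurations whose whole first level is known, so the
  -- window is extended by the periodic row. Finite speed transfers the conclusion back: 120 covers
  -- the half-width 40 of the box, one cell for each of the up to `31 + 40` steps beyond `k`, and
  -- one more.
  let ξ' : ℤ → State := fun y => if x - k - 120 ≤ y ∧ y ≤ x + k + (L + 120) then evolve ξ₀ m y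
    else if voidRow L (level ξ₀) (y - c) = 1 then 1 else 0
  have hlev : level ξ' = shift (-c) (voidRow L (level ξ₀)) := by
    funext y
    simp only [shift, level, ξ']
    split_ifs with h1 h2
    · exact hrow y h1.1 h1.2
    · rw [← sub_eq_add_neg, h2]; rfl
    · rcases zmod_two_cases (voidRow L (level ξ₀) (y - c)) with h3 | h3
      · rw [← sub_eq_add_neg, h3]; rfl
      · exact absurd h3 h2
  obtain ⟨a, s, has⟩ := hgood.shift (-c) ξ' hlev
  have hagree := fun n => (agree_evolve (ξ := evolve ξ₀ m) (ξ' := ξ') (a := x - k - 120)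
    (b := x + k + (L + 120)) (fun y h1 h2 => by simp only [ξ', if_pos (And.intro h1 h2)]) n).1
  -- The slice `s` of `η` is reached at time `m + 48 = t - k + 17`.
  refine ⟨a, s - t + k - 17, fun y h hy hh => ?_⟩
  simp only at hy ⊢
  rw [abs_le] at hy
  rw [show (t + h).toNat = m + (k + 31 + h) by omega, evolve_add,
    hagree (k + 31 + h) y (by push_cast; omega) (by push_cast; omega),
    show k + 31 + h = (32 + 16) + (k - 17 + h) by omega, evolve_add,
    show evolve ξ' (32 + 16) = _ from funext has, hη.evolve]
  change η (y + a) (s + (k - 17 + h : ℕ)) = _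
  congr 1
  rw [show ((k - 17 + h : ℕ) : ℤ) = k - 17 + h by omega]
  ring

theorem eq_of_agreesNear {η : ℤ → ℤ → State} (h16 : ∀ x t, η (x + 16) t = η x t)
    (h8 : ∀ x t, η x (t + 8) = η x t) {ξ₀ : ℤ → State} {a s a' s' : ℤ} {p p' : ℤ × ℤ}
    (h : AgreesNear ξ₀ η a s p) (h' : AgreesNear ξ₀ η a' s' p') (hp : dist1 p p' = 1) (x t : ℤ) :
    η (x + a) (t + s) = η (x + a') (t + s') := by
  have e16 : ∀ x t k, η (x + k * 16) t = η x t := fun x t k =>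
    Function.Periodic.int_mul (f := fun x => η x t) (c := 16) (fun x => h16 x t) k x
  have e8 : ∀ x t k, η x (t + k * 8) = η x t := fun x t k =>
    Function.Periodic.int_mul (f := fun t => η x t) (c := 8) (fun t => h8 x t) k t
  have hp1 : |p.1 - p'.1| ≤ 1 := by
    simp only [dist1] at hp; have := abs_nonneg (p.2 - p'.2); omega
  have hp2 : |p.2 - p'.2| ≤ 1 := by
    simp only [dist1] at hp; have := abs_nonneg (p.1 - p'.1); omega
  rw [abs_le] at hp1 hp2
  obtain ⟨x₀, k, rfl, hx0⟩ : ∃ x₀ k, x = x₀ + k * 16 ∧ p.1 ≤ x₀ ∧ x₀ ≤ p.1 + 15 :=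
    ⟨p.1 + (x - p.1) % 16, (x - p.1) / 16, by omega, by omega, by omega⟩
  -- The period rectangle starts one row above `p`, so as to lie in the box of `p'` even if `p'` is
  -- the upper neighbour.
  obtain ⟨t₀, l, rfl, ht0⟩ : ∃ t₀ l, t = t₀ + l * 8 ∧ p.2 + 1 ≤ t₀ ∧ t₀ ≤ p.2 + 8 :=
    ⟨p.2 + 1 + (t - p.2 - 1) % 8, (t - p.2 - 1) / 8, by omega, by omega, by omega⟩
  rw [add_right_comm x₀ _ a, add_right_comm x₀ _ a', add_right_comm t₀ _ s,
    add_right_comm t₀ _ s', e16, e16, e8, e8]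
  have q := h x₀ (t₀ - p.2).toNat (abs_le.2 ⟨by omega, by omega⟩) (by omega)
  have q' := h' x₀ (t₀ - p'.2).toNat (abs_le.2 ⟨by omega, by omega⟩) (by omega)
  rw [Int.toNat_of_nonneg (by omega), show p.2 + (t₀ - p.2) = t₀ by ring] at q
  rw [Int.toNat_of_nonneg (by omega), show p'.2 + (t₀ - p'.2) = t₀ by ring] at q'
  exact q.symm.trans q'

/-! ### Finite components lie inside the light cone. -/

theorem abs_le_of_mem_web {q : ℤ × ℤ} (h : q ∈ web) : |q.1| ≤ q.2 := by
  obtain ⟨h0, h1⟩ := h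
  by_contra hlt
  rw [addSingle_eq_zero (by rw [Int.toNat_of_nonneg h0]; omega)] at h1
  exact absurd h1 (by decide)

theorem mem_web_right {t : ℤ} (h : 0 ≤ t) : (t, t) ∈ web := by
  refine ⟨h, ?_⟩
  have := addSingle_self t.toNat
  rwa [Int.toNat_of_nonneg h] at this

theorem mem_web_left {t : ℤ} (h : 0 ≤ t) : (-t, t) ∈ web :=
  ⟨h, by rw [addSingle_neg]; exact (mem_web_right h).2⟩

/-- A point of a finite component lies on no ray that stays in the ambient set. -/
theorem not_exists_ray {S K : Set (ℤ × ℤ)} (hK : IsComponentOf K S) (hfin : K.Finite)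
    (ray : ℕ → ℤ × ℤ) (h0 : ray 0 ∈ K) (hS : ∀ n, ray n ∈ S)
    (hadj : ∀ n, dist1 (ray n) (ray (n + 1)) = 1) (hinj : Function.Injective ray) : False := by
  obtain ⟨C, rfl⟩ := hK
  have hmem : ∀ n, (⟨ray n, hS n⟩ : S) ∈ C.supp := by
    intro n
    induction n with
    | zero =>
      obtain ⟨z, hz, hz0⟩ := h0
      rwa [show (⟨ray 0, hS 0⟩ : S) = z from Subtype.ext hz0.symm]
    | succ n ih =>
      rw [SimpleGraph.ConnectedComponent.mem_supp_iff] at ih ⊢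
      rw [← ih]
      refine (SimpleGraph.ConnectedComponent.sound (SimpleGraph.Adj.reachable ?_)).symm
      exact hadj n
  exact Set.infinite_of_injective_forall_mem hinj
    (fun n => (⟨_, hmem n, rfl⟩ : ray n ∈ Subtype.val '' C.supp)) hfin

theorem subset_of_isComponentOf {S K : Set (ℤ × ℤ)} (hK : IsComponentOf K S) : K ⊆ S := by
  obtain ⟨C, rfl⟩ := hK
  rintro _ ⟨z, -, rfl⟩
  exact z.2

theorem dist1_vertical (x t : ℤ) (n : ℕ) : dist1 (x, t - n) (x, t - (n + 1 : ℕ)) = 1 := by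
  simp only [dist1]
  rw [show x - x = 0 by ring, show t - n - (t - ((n + 1 : ℕ) : ℤ)) = 1 by push_cast; ring]
  rfl

/-- The finite components lie in the light cone of the origin. -/
theorem abs_le_of_mem_finite_component {r : ℕ} {K : Set (ℤ × ℤ)}
    (hK : IsComponentOf K (thickWeb r)ᶜ) (hfin : K.Finite) {p : ℤ × ℤ} (hp : p ∈ K) :
    |p.1| ≤ p.2 := by
  obtain ⟨x, t⟩ := p
  have hS := subset_of_isComponentOf hK hp
  simp only
  rcases lt_or_ge t 0 with ht | ht
  · exfalso
    refine not_exists_ray hK hfin (fun n => (x, t - n)) (by simpa using hp) (fun n => ?_)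
      (dist1_vertical x t) (fun m n h => by simpa using h)
    rintro ⟨q, hq, hd⟩
    refine hS ⟨q, hq, le_trans ?_ hd⟩
    have := hq.1
    simp only [dist1]
    rw [abs_of_neg (show t - q.2 < 0 by omega), abs_of_neg (show t - n - q.2 < 0 by omega)]
    omega
  by_contra hlt
  rw [abs_le, not_and_or] at hlt
  rcases hlt with hlt | hlt
  -- The edge of the light cone belongs to the web, so a point outside the cone but off the thick
  -- web is more than `r` to the left of it. The leftward ray then stays clear of the web, which the
  -- cone contains.
  · have hx : (r : ℤ) < -t - x := by
      by_contra hr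
      refine hS ⟨(-t, t), mem_web_left ht, ?_⟩
      simp only [dist1]
      rw [abs_of_neg (by omega), show t - t = 0 by ring, abs_zero]; omega
    refine not_exists_ray hK hfin (fun n => (x - n, t)) (by simpa using hp) (fun n => ?_)
      (fun n => ?_) (fun m n h => by simpa using h)
    · rintro ⟨q, hq, hd⟩
      have := abs_le.1 (abs_le_of_mem_web hq)
      have h1 := neg_abs_le (x - n - q.1)
      have h2 := neg_abs_le (t - q.2)
      simp only [dist1] at hd
      omega
    · simp only [dist1]
      rw [show t - t = 0 by ring, show x - n - (x - ((n + 1 : ℕ) : ℤ)) = 1 by push_cast; ring]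
      rfl
  · have hx : (r : ℤ) < x - t := by
      by_contra hr
      refine hS ⟨(t, t), mem_web_right ht, ?_⟩
      simp only [dist1]
      rw [abs_of_nonneg (by omega), show t - t = 0 by ring, abs_zero]; omega
    refine not_exists_ray hK hfin (fun n => (x + n, t)) (by simpa using hp) (fun n => ?_)
      (fun n => ?_) (fun m n h => by simpa using h)
    · rintro ⟨q, hq, hd⟩
      have := abs_le.1 (abs_le_of_mem_web hq)
      have h1 := le_abs_self (x + n - q.1)
      have h2 := neg_abs_le (t - q.2)
      simp only [dist1] at hd
      omega
    · simp only [dist1]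
      rw [show t - t = 0 by ring, show x + n - (x + ((n + 1 : ℕ) : ℤ)) = -1 by push_cast; ring]
      rfl

theorem isReplicatorWith_of_goodFor {η : ℤ → ℤ → State} (hη : IsHistory η) (hE : IsEther η)
    (h16 : ∀ x t, η (x + 16) t = η x t) (h8 : ∀ x t, η x (t + 8) = η x t) {L : ℕ}
    {ξ₀ : ℤ → State} (hL : ∀ x : ℤ, ¬ (0 ≤ x ∧ x ≤ L) → level ξ₀ x = 0)
    (hgood : GoodFor η 32 (voidRow L (level ξ₀))) : IsReplicatorWith η ξ₀ := by
  refine ⟨hE, 2 * 80 + (L + 120), fun K hK hfin => ?_⟩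
  have hnear : ∀ p ∈ K, ∃ a s, AgreesNear ξ₀ η a s p := fun p hp =>
    agreesNear_of_notMem_thickWeb hη hL hgood (abs_le_of_mem_finite_component hK hfin hp)
      (subset_of_isComponentOf hK hp)
  have hpos : ∀ p ∈ K, 0 ≤ p.2 := fun p hp =>
    (abs_nonneg _).trans (abs_le_of_mem_finite_component hK hfin hp)
  obtain ⟨C, hC⟩ := hK
  obtain ⟨z₀, hz₀⟩ := C.nonempty_supp
  have hmem : ∀ z, z ∈ C.supp → z.1 ∈ K := fun z hz => hC ▸ ⟨z, hz, rfl⟩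
  obtain ⟨a, s, has⟩ := hnear z₀.1 (hmem z₀ hz₀)
  -- The translation vectors at different points may differ by periods of `η`; it is the translated
  -- ether that is constant along paths.
  have key : ∀ z, z ∈ C.supp → ∃ a' s', AgreesNear ξ₀ η a' s' z.1 ∧
      ∀ x t, η (x + a) (t + s) = η (x + a') (t + s') := by
    intro z hz
    have hreach : (lattice.induce (thickWeb (2 * 80 + (L + 120)))ᶜ).Reachable z₀ z := by
      rw [SimpleGraph.ConnectedComponent.mem_supp_iff] at hz hz₀
      exact SimpleGraph.ConnectedComponent.exact (hz₀.trans hz.symm)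
    rw [SimpleGraph.reachable_iff_reflTransGen] at hreach
    induction hreach with
    | refl => exact ⟨a, s, has, fun _ _ => rfl⟩
    | @tail y w hy hyw ih =>
      have hyC : y ∈ C.supp := by
        rw [SimpleGraph.ConnectedComponent.mem_supp_iff] at hz ⊢
        rw [← hz]
        exact SimpleGraph.ConnectedComponent.sound (SimpleGraph.Adj.reachable hyw)
      obtain ⟨a', s', h1, h2⟩ := ih hyC
      obtain ⟨a'', s'', h3⟩ := hnear w.1 (hmem w hz)
      exact ⟨a'', s'', h3, fun x t => (h2 x t).trans (eq_of_agreesNear h16 h8 h1 h3 hyw x t)⟩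
  refine ⟨fun x t => η (x + a) (t + s), ⟨a, s, fun _ _ => rfl⟩, fun p hp => ⟨hpos p hp, ?_⟩⟩
  have hp' := hp
  rw [hC] at hp'
  obtain ⟨z, hz, rfl⟩ := hp'
  obtain ⟨a', s', h1, h2⟩ := key z hz
  have := h1 z.1.1 0 (by simp) (by norm_num)
  simp only [Nat.cast_zero, add_zero] at this
  exact this.trans (h2 _ _).symm

/-! ### The rows generated by uniformly random seeds are uniformly random -/

theorem pat_sum (x : ℤ) : pat 32 0 (x - 32) + pat 32 0 x + pat 32 0 (x + 32) = 0 := by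
  have h : x % 96 = 0 ∨ x % 96 = 32 ∨ x % 96 = 64 ∨ (x % 96 ≠ 0 ∧ x % 96 ≠ 32 ∧ x % 96 ≠ 64) := by
    tauto
  rcases h with h | h | h | h
  · rw [pat, if_neg (by omega), pat, if_pos (by omega), pat, if_pos (by omega)]; rfl
  · rw [pat, if_pos (by omega), pat, if_pos (by omega), pat, if_neg (by omega)]; rfl
  · rw [pat, if_pos (by omega), pat, if_neg (by omega), pat, if_pos (by omega)]; rfl
  · rw [pat, if_neg (by omega), pat, if_neg (by omega), pat, if_neg (by omega)]; rfl

theorem addStep_iterate_32 (f : ℤ → ZMod 2) (x : ℤ) :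
    addStep^[32] f x = f (x - 32) + f x + f (x + 32) := by
  rw [show (32 : ℕ) = 2 ^ 5 by norm_num, addStep_iterate_two_pow]
  norm_num

theorem addStep_iterate_voidRow (L : ℤ) (f : ℤ → ZMod 2) : addStep^[32] (voidRow L f) = 0 := by
  funext x
  rw [addStep_iterate_32]
  simp only [voidRow, ← Finset.sum_add_distrib]
  refine Finset.sum_eq_zero fun y _ => ?_
  rw [← mul_add, ← mul_add, show x - 32 - y = x - y - 32 by ring,
    show x + 32 - y = x - y + 32 by ring, pat_sum, mul_zero]

theorem voidRow_add (L : ℤ) (f g : ℤ → ZMod 2) :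
    voidRow L (f + g) = voidRow L f + voidRow L g := by
  funext x
  simp only [voidRow, Pi.add_apply, ← Finset.sum_add_distrib, add_mul]

/-- Such rows have period 96, and their third block of 32 cells is the sum of the first two. -/
theorem eq_of_addStep_iterate_32 {f g : ℤ → ZMod 2} (hf : addStep^[32] f = 0)
    (hg : addStep^[32] g = 0) (h : ∀ x, 0 ≤ x → x < 64 → f x = g x) : f = g := by
  have per : ∀ {f : ℤ → ZMod 2}, addStep^[32] f = 0 → ∀ x, f (x + 96) = f x := by
    intro f hf x
    rw [show (32 : ℕ) = 2 ^ 5 by norm_num] at hf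
    simpa using periodic_of_addStep_iterate_eq_zero hf x
  have pf := per hf
  have pg := per hg
  have red : ∀ (f : ℤ → ZMod 2), (∀ x, f (x + 96) = f x) → ∀ x, f x = f (x % 96) := by
    intro f hf x
    conv_lhs => rw [← Int.emod_add_mul_ediv x 96, mul_comm]
    exact Function.Periodic.int_mul (f := f) (c := 96) hf _ _
  funext x
  rw [red f pf, red g pg]
  have h0 := Int.emod_nonneg x (show (96 : ℤ) ≠ 0 by norm_num)
  have h1 := Int.emod_lt_of_pos x (show (0 : ℤ) < 96 by norm_num)
  generalize x % 96 = y at h0 h1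
  rcases lt_or_ge y 64 with hy | hy
  · exact h y h0 hy
  · have e1 := congrFun hf (y - 32)
    have e2 := congrFun hg (y - 32)
    rw [addStep_iterate_32, Pi.zero_apply, sub_add_cancel] at e1 e2
    rw [h (y - 32 - 32) (by omega) (by omega), h (y - 32) (by omega) (by omega)] at e1
    linear_combination e1 - e2

/-- The bits on `[0, 64)` of the seed that generates `h`. -/
def headBits (h : ℤ → ZMod 2) : ℤ → ZMod 2 := fun x =>
  if 0 ≤ x ∧ x < 64 then (if x < 32 then h x else h x + h (x - 32)) else 0

/-- A triangular system: for `x` and `y` in `[0, 64)`, the coefficient `pat 32 0 (x - y)` is nonzero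
only for `y = x` and `y = x - 32`. -/
theorem voidRow_headBits {L : ℤ} (hL : 63 ≤ L) {h : ℤ → ZMod 2} (hh : addStep^[32] h = 0) :
    voidRow L (headBits h) = h := by
  refine eq_of_addStep_iterate_32 (addStep_iterate_voidRow _ _) hh fun x h0 h1 => ?_
  have hterm : ∀ y, headBits h y * pat 32 0 (x - y) =
      (if y = x then headBits h y else 0) + (if y = x - 32 then headBits h y else 0) := by
    intro y
    by_cases hy : 0 ≤ y ∧ y < 64
    · rcases eq_or_ne y x with rfl | hxy
      · rw [if_pos rfl, if_neg (by omega), pat, if_pos (by omega), mul_one, add_zero]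
      · rw [if_neg hxy, zero_add]
        by_cases hxy' : y = x - 32
        · rw [if_pos hxy', pat, if_pos (by omega), mul_one]
        · rw [if_neg hxy', pat, if_neg (by omega), mul_zero]
    · have : headBits h y = 0 := by rw [headBits, if_neg hy]
      simp [this]
  simp only [voidRow, hterm, Finset.sum_add_distrib, Finset.sum_ite_eq', Finset.mem_Icc]
  rw [if_pos (by omega)]
  simp only [headBits, if_pos (And.intro h0 h1)]
  by_cases hx : x < 32
  · rw [if_pos hx, if_neg (by omega), add_zero]
  · rw [if_neg hx, if_pos (by omega), if_pos (by omega), if_pos (by omega)]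
    linear_combination h (x - 32) * two_eq_zero_zmod

theorem level_binarySeed (L : ℕ) (ω : Set.Icc (0 : ℤ) L → Bool) (x : ℤ) :
    level (binarySeed L ω) x = if h : 0 ≤ x ∧ x ≤ L then (if ω ⟨x, h⟩ then 1 else 0) else 0 := by
  simp only [level, binarySeed]
  split_ifs <;> rfl

theorem level_binarySeed_outside (L : ℕ) (ω : Set.Icc (0 : ℤ) L → Bool) (x : ℤ)
    (h : ¬ (0 ≤ x ∧ x ≤ L)) : level (binarySeed L ω) x = 0 := by
  rw [level_binarySeed, dif_neg h]

/-- The seed with the bits `ρ` on `[64, L]` that generates the row `g`. -/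
noncomputable def seedFor (L : ℕ) (g : ℤ → ZMod 2)
    (ρ : {x : Set.Icc (0 : ℤ) L // ¬ x.1 < 64} → Bool) : Set.Icc (0 : ℤ) L → Bool :=
  fun x => if hx : x.1 < 64 then
    decide (headBits (g + voidRow L (fun y => if h : (0 ≤ y ∧ y ≤ L) ∧ ¬ y < 64 then
      (if ρ ⟨⟨y, h.1⟩, h.2⟩ then 1 else 0) else 0)) x.1 = 1)
  else ρ ⟨x, hx⟩

theorem voidRow_seedFor {L : ℕ} (hL : 63 ≤ L) {g : ℤ → ZMod 2} (hg : addStep^[32] g = 0)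
    (ρ : {x : Set.Icc (0 : ℤ) L // ¬ x.1 < 64} → Bool) :
    voidRow L (level (binarySeed L (seedFor L g ρ))) = g := by
  set R : ℤ → ZMod 2 := fun y => if h : (0 ≤ y ∧ y ≤ L) ∧ ¬ y < 64 then
      (if ρ ⟨⟨y, h.1⟩, h.2⟩ then 1 else 0) else 0 with hR
  have hsplit : level (binarySeed L (seedFor L g ρ)) = headBits (g + voidRow L R) + R := by
    funext x
    rw [level_binarySeed, Pi.add_apply]
    by_cases hx : 0 ≤ x ∧ x ≤ L
    · rw [dif_pos hx, seedFor]
      by_cases h64 : x < 64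
      · have : R x = 0 := by rw [hR]; exact dif_neg (fun h => h.2 h64)
        rw [dif_pos h64, this, add_zero, ← hR]
        rcases zmod_two_cases (headBits (g + voidRow L R) x) with h | h <;> simp [h]
      · have h1 : R x = if ρ ⟨⟨x, hx⟩, h64⟩ then 1 else 0 := by rw [hR]; exact dif_pos ⟨hx, h64⟩
        rw [dif_neg h64, h1, headBits, if_neg (show ¬ (0 ≤ x ∧ x < 64) from fun h => h64 h.2), zero_add]
    · have h1 : R x = 0 := by rw [hR]; exact dif_neg (fun h => hx h.1)
      rw [dif_neg hx, h1, headBits, if_neg (by omega), add_zero]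
  rw [hsplit, voidRow_add, voidRow_headBits (by omega), add_assoc]
  · funext x; simp [CharTwo.add_self_eq_zero]
  · rw [addStep_iterate_add, hg, addStep_iterate_voidRow, add_zero]

theorem card_head {L : ℕ} (hL : 63 ≤ L) :
    Nat.card {x : Set.Icc (0 : ℤ) L // x.1 < 64} = 64 := by
  rw [Nat.card_eq_of_equiv_fin]
  exact
    { toFun := fun x => ⟨x.1.1.toNat, by have := x.1.2.1; have := x.2; omega⟩
      invFun := fun i => ⟨⟨i.1, by omega, by omega⟩, by have := i.2; simp only; omega⟩
      left_inv := fun x => by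
        apply Subtype.ext; apply Subtype.ext
        exact Int.toNat_of_nonneg x.1.2.1
      right_inv := fun i => by simp }

theorem card_seeds {L : ℕ} (hL : 63 ≤ L) : Nat.card (Set.Icc (0 : ℤ) L → Bool) =
    4 ^ 32 * Nat.card ({x : Set.Icc (0 : ℤ) L // ¬ x.1 < 64} → Bool) := by
  rw [Nat.card_congr (Equiv.piEquivPiSubtypeProd (fun x : Set.Icc (0 : ℤ) L => x.1 < 64)
    (fun _ => Bool)), Nat.card_prod]
  congr 1
  rw [Nat.card_fun, card_head hL]
  simp

/-- A row of the kernel and the bits on `[64, L]` can be prescribed independently, and both are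
recovered from the seed. For a lower bound only this injectivity matters. -/
theorem seedProb_ge {L : ℕ} (hL : 63 ≤ L) {X : (ℤ → ZMod 2) → Prop} {E : (ℤ → State) → Prop}
    (h : ∀ ω, X (voidRow L (level (binarySeed L ω))) → E (binarySeed L ω)) :
    (cnt X 32 0 : ℝ) / 4 ^ 32 ≤ seedProb L E := by
  have hle : cnt X 32 0 * Nat.card ({x : Set.Icc (0 : ℤ) L // ¬ x.1 < 64} → Bool) ≤
      Nat.card {ω : Set.Icc (0 : ℤ) L → Bool // E (binarySeed L ω)} := by
    rw [cnt, ← Nat.card_prod]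
    refine Nat.card_le_card_of_injective (fun z => ⟨seedFor L z.1.1 z.2, h _ ?_⟩) ?_
    · rw [voidRow_seedFor hL z.1.2.1]; exact z.1.2.2
    · rintro ⟨g, ρ⟩ ⟨g', ρ'⟩ e
      have e' : seedFor L g.1 ρ = seedFor L g'.1 ρ' := congrArg Subtype.val e
      have h1 : g.1 = g'.1 := by
        rw [← voidRow_seedFor hL g.2.1 ρ, e', voidRow_seedFor hL g'.2.1 ρ']
      have h2 : ρ = ρ' := by
        funext x
        have := congrFun e' x.1
        rwa [seedFor, seedFor, dif_neg x.2, dif_neg x.2] at this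
      exact Prod.ext (Subtype.ext h1) h2
  have hpos : 0 < Nat.card ({x : Set.Icc (0 : ℤ) L // ¬ x.1 < 64} → Bool) := Nat.card_pos
  rw [seedProb, card_seeds hL, div_le_div_iff₀ (by positivity) (by positivity)]
  have := mul_le_mul_of_nonneg_right (Nat.cast_le (α := ℝ).2 hle) (show (0 : ℝ) ≤ 4 ^ 32 by positivity)
  rw [Nat.cast_mul] at this ⊢
  rw [Nat.cast_pow, Nat.cast_ofNat]
  linarith

theorem seedProb_le_one (L : ℕ) (E : (ℤ → State) → Prop) : seedProb L E ≤ 1 := by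
  rw [seedProb]
  refine div_le_one_of_le₀ ?_ (Nat.cast_nonneg _)
  exact_mod_cast Nat.card_le_card_of_injective _ Subtype.val_injective

theorem liminfProb_ge {X : (ℤ → ZMod 2) → Prop} {E : (ℤ → State) → Prop}
    (h : ∀ (L : ℕ) ω, X (voidRow L (level (binarySeed L ω))) → E (binarySeed L ω)) :
    (cnt X 32 0 : ℝ) / 4 ^ 32 ≤ liminfProb E := by
  refine Filter.le_liminf_of_le ?_ ?_
  · exact (Filter.isBoundedUnder_of ⟨1, fun L => seedProb_le_one L E⟩ :
      Filter.IsBoundedUnder (· ≤ ·) Filter.atTop fun L : ℕ => seedProb L E).isCoboundedUnder_ge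
  · filter_upwards [Filter.eventually_ge_atTop 63] with L hL using seedProb_ge hL (h L)

/-! ### The search for ancestors that forget their initial state

Rows are coded by binary numbers. The functions below are evaluated by the kernel, and are therefore
written in terms of recursors and of the accelerated operations on `ℕ`. -/

/-- Application after evaluation of the argument. -/
noncomputable def force (n : ℕ) (f : ℕ → ℕ) : ℕ := Nat.rec (f 0) (fun m _ => f (Nat.succ m)) n

noncomputable def sel (b : Bool) (x y : ℕ) : ℕ := Bool.rec y x b

noncomputable def ifZero (c x y : ℕ) : ℕ := sel (Nat.beq c 0) x y

def diff (a b : ℕ) : ℕ := Nat.xor a (Nat.land a b)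

def mask (w : ℕ) : ℕ := Nat.sub (Nat.pow 2 w) 1

def xorShift (k h : ℕ) : ℕ := Nat.xor h (Nat.shiftLeft h k)

/-- One code of a row that is mapped to a row with code `F`. -/
def unstep (F : ℕ) : ℕ :=
  xorShift 48 (xorShift 24 (xorShift 12 (xorShift 6 (xorShift 3
    (Nat.shiftLeft (xorShift 1 F) 2)))))

/-- The code of the row `…110110…`, shifted by `b`. -/
def kernelCode (b : ℕ) : ℕ := Nat.shiftRight 0xDB6DB6DB6DB6DB6DB6DB6DB6DB6DB6D b

/-- `unstep` divides by `1 + X + X ^ 2`, written as `(1 + X ^ 3) / (1 + X)`, with the inverse of `1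
+ X ^ 3` truncated to `(1 + X ^ 3) ^ 31`. This is not proved; the result is tested wherever it is
used. -/
def isPre (F w G : ℕ) : Bool :=
  Nat.beq (Nat.land (Nat.xor G (Nat.xor (Nat.shiftRight G 1) (Nat.shiftRight G 2))) (mask w))
    (Nat.land F (mask w))

/-- The cells above a triple of `G` that is not `000`. -/
def tripleNz (G : ℕ) : ℕ := Nat.lor G (Nat.lor (Nat.shiftRight G 1) (Nat.shiftRight G 2))

/-- The middle cells of `101` in `F`. -/
def gaps (F : ℕ) : ℕ := diff (Nat.land (Nat.shiftLeft F 1) (Nat.shiftRight F 1)) F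

/-- The transpose of the sum over three neighbours. The code of the earlier row begins one cell
further to the left, whence the shifts by 0, 1, 2. -/
def spread (a : ℕ) : ℕ := Nat.xor a (Nat.xor (Nat.shiftLeft a 1) (Nat.shiftLeft a 2))

def flanks (F : ℕ) : ℕ := Nat.xor (Nat.shiftLeft F 1) (Nat.shiftRight F 1)

/-- The parities of the numbers of binary digits `1` of the numbers below `256`. -/
def parityTable : ℕ :=
  0x6996966996696996966969966996966996696996699696696996966996696996

/-- The parity of the number of binary digits `1` of `x < 2 ^ 128`. -/
def parity (x : ℕ) : ℕ :=
  let a := Nat.xor x (Nat.shiftRight x 64)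
  let a := Nat.xor a (Nat.shiftRight a 32)
  let a := Nat.xor a (Nat.shiftRight a 16)
  Nat.land 1 (Nat.shiftRight parityTable
    (Nat.land 255 (Nat.xor a (Nat.shiftRight a 8))))

def lowBit (s : ℕ) : ℕ := diff s (Nat.sub s 1)

/-- These tests make it unnecessary to prove that the shift computed in `norm` is the intended one.
A failure yields 0, a valid lower bound. -/
noncomputable def normCheck (C Q w C' Q' w' sh x : ℕ) : ℕ :=
  sel (Nat.beq (Nat.shiftLeft C' sh) C) (sel (Nat.beq (Nat.shiftLeft Q' sh) Q)
    (sel (Nat.ble (Nat.add w' sh) w) (ifZero (Nat.land C' 1) (ifZero (Nat.land Q' 3) x 0) 0) 0) 0) 0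

/-- Translation of a functional, and restriction of the row to the cells that matter. -/
noncomputable def norm (C Q F w : ℕ) (k : ℕ → ℕ → ℕ → ℕ → ℕ) : ℕ :=
  force (Nat.sub (Nat.log2 (lowBit (Nat.lor C (Nat.lor Q (Nat.shiftRight Q 1))))) 1) fun sh =>
  force (Nat.shiftRight C sh) fun C' => force (Nat.shiftRight Q sh) fun Q' =>
  force (Nat.add 2 (Nat.log2 (Nat.lor C' (Nat.shiftLeft Q' 1)))) fun w' =>
  force (Nat.land (Nat.shiftRight F sh) (mask w')) fun F' =>
  normCheck C Q w C' Q' w' sh (k C' Q' F' w')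

/-- Products below a nonzero triple of `G` vanish (`triple_occStep`). A product below a zero triple
would leave the class of functionals, and then the branch is dropped. -/
noncomputable def locBranch (rec : ℕ → ℕ → ℕ → ℕ → ℕ → ℕ) (C Q F w sg G : ℕ) : ℕ :=
  let o := tripleNz G
  ifZero (diff Q o)
    (let a := diff C (Nat.lor F (Nat.land (gaps F) o))
     rec (diff (spread a) G) (Nat.shiftLeft (Nat.land a (diff (gaps F) o)) 1) G (Nat.add w 2)
       (Nat.xor sg (parity (Nat.xor (Nat.land C F) (Nat.land a (flanks F))))))
    0

/-- A lower bound for the number of ancestors, `k` steps back, for which the functional `(C, Q)` of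
the row with code `F` is constant with value `sg`. -/
noncomputable def locCount (k : ℕ) : ℕ → ℕ → ℕ → ℕ → ℕ → ℕ :=
  Nat.rec (fun _ _ _ _ _ => 0) (fun k ih C Q F w sg =>
    let G₀ := Nat.land (unstep F) (mask (Nat.add w 2))
    sel (isPre F w G₀)
      (let br := locBranch (fun C' Q' G w' sg' =>
          ifZero (Nat.lor C' Q') (ifZero sg' (Nat.pow 4 k) 0)
            (norm C' Q' G w' fun C Q F w => ifZero sg' (ih C Q F w 0) (ih C Q F w 1))) C Q F w sg
       let go := fun b => br (Nat.land (Nat.xor G₀ b) (mask (Nat.add w 2)))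
       Nat.add (Nat.add (go 0) (go (kernelCode 0)))
         (Nat.add (go (kernelCode 1)) (go (kernelCode 2)))) 0) k

/-- Whether two functionals are equal up to a translation by `48`. -/
noncomputable def ifSame (c q c' q' x y : ℕ) : ℕ :=
  sel (Nat.beq c c') (sel (Nat.beq q q') x y)
  (sel (Nat.beq c (Nat.shiftLeft c' 48)) (sel (Nat.beq q (Nat.shiftLeft q' 48)) x y)
  (sel (Nat.beq c' (Nat.shiftLeft c 48)) (sel (Nat.beq q' (Nat.shiftLeft q 48)) x y) y))

noncomputable def ifMem (c q : ℕ) (L : List (ℕ × ℕ)) (x y : ℕ) : ℕ :=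
  List.rec y (fun e _ ih => ifSame c q e.1 e.2 x ih) L

noncomputable def insertK (c q : ℕ) (L : List (ℕ × ℕ)) (k : List (ℕ × ℕ) → ℕ) : ℕ :=
  ifZero (Nat.lor c q) (k L) (ifMem c q L (k L) (k ((c, q) :: L)))

noncomputable def pullK (A N G C : ℕ) (acc : List (ℕ × ℕ)) (k : List (ℕ × ℕ) → ℕ) : ℕ :=
  let a := diff C A
  insertK (diff (spread a) G) (Nat.shiftLeft (Nat.land a N) 1) acc k

/-- The digits of `b` are treated one by one from the top. Exhausted `fuel` gives 0, again a valid
lower bound. -/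
noncomputable def pullBitsK (A N G fuel : ℕ) :
    ℕ → List (ℕ × ℕ) → (List (ℕ × ℕ) → ℕ) → ℕ :=
  Nat.rec (fun _ _ _ => 0) (fun _ ih b acc k =>
    ifZero b (k acc)
      (let c := Nat.pow 2 (Nat.log2 b)
      pullK A N G c acc fun acc => ih (Nat.xor b c) acc k)) fuel

/-- A product that need not vanish is replaced by its three cells as separate functionals, which
determine it. -/
noncomputable def pullAllK (A N o G : ℕ) (L : List (ℕ × ℕ)) :
    List (ℕ × ℕ) → (List (ℕ × ℕ) → ℕ) → ℕ :=
  List.rec (fun acc k => k acc) (fun e _ ih acc k =>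
    pullK A N G e.1 acc fun acc =>
    let b := diff e.2 o
    ifZero b (ih acc k)
      (pullBitsK A N G 200 (Nat.lor b (Nat.lor (Nat.shiftLeft b 1) (Nat.shiftRight b 1))) acc
        fun acc => ih acc k)) L

/-- One step of the occupied cells. -/
def fwdStep (l s : ℕ) : ℕ :=
  let l0 := Nat.shiftLeft l 1
  let l2 := Nat.shiftRight l 1
  let s1 := Nat.shiftRight s 1
  let s2 := Nat.shiftRight s 2
  Nat.lor l (Nat.xor (Nat.xor (Nat.xor l0 l2) (Nat.xor s (Nat.xor s1 s2)))
    (Nat.land (Nat.land l0 l2) (Nat.land s (Nat.land s1 s2))))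

noncomputable def fwd (rows : List ℕ) : ℕ → ℕ :=
  List.rec (fun s => fwdStep 0 s) (fun l _ ih s => ih (fwdStep l s)) rows

/-- *1 Or 3* on the ring of length `16`. -/
def ringStep (v : ℕ) : ℕ :=
  Nat.land 0xffff (Nat.xor v (Nat.xor (Nat.lor (Nat.shiftLeft v 1) (Nat.shiftRight v 15))
    (Nat.lor (Nat.shiftRight v 1) (Nat.shiftLeft v 15))))

/-- The image of the row with the digits of `i` at the odd cells. -/
def ringWord (i : ℕ) : ℕ :=
  ringStep (Nat.lor (Nat.shiftLeft (Nat.land i 0x55) 1) (Nat.shiftLeft (Nat.land i 0xaa) 8))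

/-- Four binary digits for each word `ringWord i`, namely the index of an ether that has this word
as a slice up to rotation; `ringWord_eq_rotate` verifies them. -/
def classTable : ℕ := 0x1bb3b668b6683dd4bccb6b8a65da87c8bccb6d5a68ba8c783bb2daa5daa54dd3b66dc8dcc5b7baad6dbab995899da856658a599bd998abd68aa57d87cb578665b66dcb57cd8cbaad685ad998599badb66bda899db995a5868aa5c5b778d786653884baa8baa82553dc7da5d6ab865775d7cda8b6ad5657754883d665d6653550

def tableClass (i : ℕ) : ℕ := Nat.land 15 (Nat.shiftRight classTable (Nat.mul 4 i))

/-- Inverse to `ringWord`: a row supported on the odd cells is left unchanged there by `ringStep`,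
so the digits of the index can be read off. -/
def classIndex (u : ℕ) : ℕ :=
  let v := Nat.land u 0xaaaa
  Nat.land 255 (Nat.shiftRight (Nat.xor v (Nat.shiftRight v 7)) 1)

def foldWord (s : ℕ) : ℕ :=
  let V := Nat.shiftRight s 1
  Nat.land 0xffff (Nat.xor V (Nat.xor (Nat.shiftRight V 16) (Nat.shiftRight V 32)))

/-- The value 14 stands for a state that is not recognised. -/
noncomputable def classOf (s : ℕ) : ℕ :=
  let u := foldWord s
  let i := classIndex u
  sel (Nat.beq u (ringWord i)) (tableClass i) 14

/-- The number `n` at the place of the class `k`. -/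
def place (k n : ℕ) : ℕ := Nat.mul n (Nat.pow 2 (Nat.mul 40 k))

/-- How many functionals are followed up at the level `m`. -/
noncomputable def limit (m : ℕ) : ℕ :=
  sel (Nat.ble m 10) 99 (sel (Nat.ble m 11) 4 (sel (Nat.ble m 12) 2 0))

noncomputable def longer (L : List (ℕ × ℕ)) : ℕ → Bool :=
  List.rec (fun _ => false) (fun _ _ ih n => Nat.rec true (fun n _ => ih n) n) L

/-- The functions that continue the search from a node: level, row, live functionals, older rows. -/
abbrev Search := ℕ → ℕ → List (ℕ × ℕ) → List ℕ → ℕ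

noncomputable def child (rec : ℕ → List (ℕ × ℕ) → ℕ) (F : ℕ) (L : List (ℕ × ℕ)) (G : ℕ) : ℕ :=
  let o := tripleNz G
  let ga := gaps F
  let det := Nat.land ga o
  pullAllK (Nat.lor F det) (diff ga o) o G L [] fun L' => rec G L'

/-- A node with one live functional. -/
noncomputable def single (m C Q F : ℕ) (rows : List ℕ) : ℕ :=
  norm C Q F (Nat.add 50 (Nat.mul 2 m)) fun C' Q' F' w' =>
  let a := locCount (Nat.sub 16 m) C' Q' F' w' 0
  let b := locCount (Nat.sub 16 m) C' Q' F' w' 1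
  ifZero (Nat.land C F)
  (Nat.add (ifZero a 0 (place (classOf (fwd rows F)) a))
   (ifZero b 0
     (let t := Nat.pow 2 (Nat.log2 C)
      ifZero C 0 (ifZero (Nat.land C (Nat.shiftRight t 48))
        (place (classOf (fwd rows
          (Nat.lor F (Nat.lor (Nat.shiftRight t 48) (Nat.lor t (Nat.shiftLeft t 48)))))) b) 0)))) 0

/-- At these levels the row has period `3 * m`, and translation by `3 * m` acts on its four
preimages. If it moves one of them, it pairs them up, and two of the branches suffice. -/
noncomputable def onDyadic (m x y : ℕ) : ℕ :=
  sel (Nat.beq m 1) x (sel (Nat.beq m 2) x (sel (Nat.beq m 4) x (sel (Nat.beq m 8) x y)))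

noncomputable def branch (rec : Search) (m F : ℕ) (L : List (ℕ × ℕ)) (rows : List ℕ) (G₀ b : ℕ) :
    ℕ :=
  child (fun G L' => rec (Nat.succ m) G L' (F :: rows)) F L
    (Nat.land (Nat.xor G₀ b) (mask (Nat.add 52 (Nat.mul 2 m))))

/-- The part `i < 4` of the search below a node. If the node needs no search, then its value is
counted in the part `i = 0`, provided that `z = 0`. -/
noncomputable def part (i z : ℕ) (rec : Search) : Search := fun m F L rows =>
  List.rec (ifZero (Nat.add i z) (place (classOf (fwd rows F)) (Nat.pow 4 (Nat.sub 16 m))) 0)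
    (fun e t _ => List.rec (ifZero (Nat.add i z) (single m e.1 e.2 F rows) 0)
      (fun _ _ _ => sel (longer L (limit m)) 0
        (let G₀ := Nat.land (unstep F) (mask (Nat.add 52 (Nat.mul 2 m)))
         sel (isPre F (Nat.add 50 (Nat.mul 2 m)) G₀)
          (onDyadic m
            (let d := Nat.land 3 (Nat.xor G₀ (Nat.shiftRight G₀ (Nat.mul 3 m)))
             ifZero d 0 (ifZero i (Nat.mul 2 (branch rec m F L rows G₀ 0))
               (sel (Nat.beq i 1) (Nat.mul 2 (branch rec m F L rows G₀
                 (kernelCode (sel (Nat.beq d 1) 1 0)))) 0)))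
            (branch rec m F L rows G₀ (ifZero i 0 (kernelCode (Nat.sub i 1))))) 0)) t) L

/-- The search in its four parts. -/
noncomputable def allParts (rec : Search) : Search := fun m F L rows =>
  Nat.add (Nat.add (part 0 0 rec m F L rows) (part 1 0 rec m F L rows))
    (Nat.add (part 2 0 rec m F L rows) (part 3 0 rec m F L rows))

noncomputable def search (fuel : ℕ) : Search :=
  Nat.rec (fun _ _ _ _ => 0) (fun _ ih m F L rows => allParts ih m F L rows) fuel

noncomputable def initial : List (ℕ × ℕ) :=
  List.rec [] (fun i _ ih => (Nat.shiftLeft 1 (Nat.succ i), 0) :: ih) (List.range 48)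

noncomputable def root (s : Search) : ℕ :=
  child (fun G L => s 1 G L []) 0 initial (Nat.land (kernelCode 0) (mask 52))

/-! ### Binary numbers as functionals on rows -/

theorem testBit_nxor (a b i : ℕ) : (Nat.xor a b).testBit i = (a.testBit i ^^ b.testBit i) :=
  Nat.testBit_xor a b i

theorem testBit_nland (a b i : ℕ) : (Nat.land a b).testBit i = (a.testBit i && b.testBit i) :=
  Nat.testBit_and a b i

theorem testBit_nlor (a b i : ℕ) : (Nat.lor a b).testBit i = (a.testBit i || b.testBit i) :=
  Nat.testBit_or a b i

theorem testBit_nshiftRight (a k i : ℕ) : (Nat.shiftRight a k).testBit i = a.testBit (k + i) :=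
  Nat.testBit_shiftRight (i := k) (j := i) a

theorem testBit_nshiftLeft (a k i : ℕ) :
    (Nat.shiftLeft a k).testBit i = (decide (k ≤ i) && a.testBit (i - k)) :=
  Nat.testBit_shiftLeft (i := k) (j := i) a

theorem testBit_nshiftLeft_add (a k i : ℕ) : (Nat.shiftLeft a k).testBit (i + k) = a.testBit i := by
  simp

theorem testBit_diff (a b i : ℕ) : (diff a b).testBit i = (a.testBit i && !b.testBit i) := by
  rw [diff, testBit_nxor, testBit_nland]
  cases a.testBit i <;> cases b.testBit i <;> rfl

theorem testBit_mask (w i : ℕ) : (mask w).testBit i = decide (i < w) :=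
  Nat.testBit_two_pow_sub_one w i

theorem testBit_tripleNz (G i : ℕ) : (tripleNz G).testBit i =
    (G.testBit i || (G.testBit (i + 1) || G.testBit (i + 2))) := by
  rw [tripleNz, testBit_nlor, testBit_nlor, testBit_nshiftRight, testBit_nshiftRight,
    add_comm 1, add_comm 2]

theorem testBit_gaps (F i : ℕ) : (gaps F).testBit (i + 1) =
    ((F.testBit i && F.testBit (i + 2)) && !F.testBit (i + 1)) := by
  rw [gaps, testBit_diff, testBit_nland, testBit_nshiftRight, testBit_nshiftLeft_add,
    show 1 + (i + 1) = i + 2 by ring]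

theorem testBit_flanks (F i : ℕ) : (flanks F).testBit (i + 1) =
    (F.testBit i ^^ F.testBit (i + 2)) := by
  rw [flanks, testBit_nxor, testBit_nshiftRight, testBit_nshiftLeft_add,
    show 1 + (i + 1) = i + 2 by ring]

/-- The digit of `C` at the place `i`, as an element of `ZMod 2`. -/
def dig (C i : ℕ) : ZMod 2 := if C.testBit i then 1 else 0

theorem dig_xor (a b i : ℕ) : dig (Nat.xor a b) i = dig a i + dig b i := by
  simp only [dig, testBit_nxor]
  cases a.testBit i <;> cases b.testBit i <;> rfl

theorem dig_land (a b i : ℕ) : dig (Nat.land a b) i = dig a i * dig b i := by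
  simp only [dig, testBit_nland]
  cases a.testBit i <;> cases b.testBit i <;> rfl

theorem dig_diff (a b i : ℕ) : dig (diff a b) i = dig a i * (1 + dig b i) := by
  simp only [dig, testBit_diff]
  cases a.testBit i <;> cases b.testBit i <;> rfl

theorem dig_shiftLeft_add (a k i : ℕ) : dig (Nat.shiftLeft a k) (i + k) = dig a i := by
  simp only [dig, testBit_nshiftLeft_add]

theorem dig_shiftLeft_lt {a k i : ℕ} (h : i < k) : dig (Nat.shiftLeft a k) i = 0 := by
  simp [dig, Nat.not_le.2 h]

theorem dig_eq_zero {C i : ℕ} (h : C.testBit i = false) : dig C i = 0 := by simp [dig, h]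

theorem dig_eq_one {C i : ℕ} (h : C.testBit i = true) : dig C i = 1 := by simp [dig, h]

theorem testBit_eq_false_of_le {C i : ℕ} (h : C ≤ i) : C.testBit i = false :=
  Nat.testBit_lt_two_pow (h.trans_lt Nat.lt_two_pow_self)

/-- The value at `h` of the linear functional with code `C`. -/
def ev (C : ℕ) (h : ℕ → ZMod 2) : ZMod 2 := ∑ i ∈ Finset.range C, dig C i * h i

theorem ev_eq_sum {C n : ℕ} (hn : ∀ i, n ≤ i → C.testBit i = false) (h : ℕ → ZMod 2) :
    ev C h = ∑ i ∈ Finset.range n, dig C i * h i := by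
  have key : ∀ m, (∀ i, m ≤ i → C.testBit i = false) →
      ∑ i ∈ Finset.range m, dig C i * h i = ∑ i ∈ Finset.range (max m (max n C)), dig C i * h i := by
    intro m hm
    refine Finset.sum_subset (fun i hi => ?_) fun i _ hi => ?_
    · rw [Finset.mem_range] at hi ⊢; omega
    · rw [Finset.mem_range, not_lt] at hi
      rw [dig_eq_zero (hm i hi), zero_mul]
  rw [ev, key C fun i => testBit_eq_false_of_le, key n hn]
  congr 2; omega

theorem ev_zero (h : ℕ → ZMod 2) : ev 0 h = 0 := rfl

theorem ev_xor (a b : ℕ) (h : ℕ → ZMod 2) : ev (Nat.xor a b) h = ev a h + ev b h := by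
  have ha : ∀ i, max a b ≤ i → a.testBit i = false := fun i hi => testBit_eq_false_of_le (by omega)
  have hb : ∀ i, max a b ≤ i → b.testBit i = false := fun i hi => testBit_eq_false_of_le (by omega)
  rw [ev_eq_sum ha, ev_eq_sum hb, ev_eq_sum (n := max a b), ← Finset.sum_add_distrib]
  · exact Finset.sum_congr rfl fun i _ => by rw [dig_xor, add_mul]
  · intro i hi; rw [testBit_nxor, ha i hi, hb i hi]; rfl

theorem ev_congr {C : ℕ} {h h' : ℕ → ZMod 2} (e : ∀ i, C.testBit i = true → h i = h' i) :
    ev C h = ev C h' := by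
  refine Finset.sum_congr rfl fun i _ => ?_
  rw [dig]
  split_ifs with hi
  · rw [e i hi]
  · rw [zero_mul, zero_mul]

theorem ev_land (C A : ℕ) (h : ℕ → ZMod 2) :
    ev (Nat.land C A) h = ev C fun i => dig A i * h i := by
  rw [ev_eq_sum (n := C), ev]
  · exact Finset.sum_congr rfl fun i _ => by rw [dig_land, mul_assoc]
  · intro i hi; rw [testBit_nland, testBit_eq_false_of_le hi]; rfl

theorem ev_diff (C A : ℕ) (h : ℕ → ZMod 2) :
    ev (diff C A) h = ev C fun i => (1 + dig A i) * h i := by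
  rw [ev_eq_sum (n := C), ev]
  · exact Finset.sum_congr rfl fun i _ => by rw [dig_diff, mul_assoc]
  · intro i hi; rw [testBit_diff, testBit_eq_false_of_le hi]; rfl

theorem ev_shiftLeft (C k : ℕ) (h : ℕ → ZMod 2) :
    ev (Nat.shiftLeft C k) h = ev C fun i => h (i + k) := by
  rw [ev_eq_sum (n := k + C), ev, Finset.sum_range_add, Finset.sum_eq_zero, zero_add]
  · refine Finset.sum_congr rfl fun i _ => ?_
    rw [add_comm k i, dig_shiftLeft_add]
  · intro i hi
    rw [dig_shiftLeft_lt (Finset.mem_range.1 hi), zero_mul]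
  · intro i hi
    rw [testBit_nshiftLeft, testBit_eq_false_of_le (show C ≤ i - k by omega), Bool.and_false]

theorem ev_add (C : ℕ) (h h' : ℕ → ZMod 2) : ev C (fun i => h i + h' i) = ev C h + ev C h' := by
  simp only [ev, mul_add, Finset.sum_add_distrib]

theorem ev_eq_zero {C : ℕ} {h : ℕ → ZMod 2} (e : ∀ i, C.testBit i = true → h i = 0) :
    ev C h = 0 := by
  rw [ev_congr e]; simp [ev]

theorem ev_two_pow (n : ℕ) (h : ℕ → ZMod 2) : ev (2 ^ n) h = h n := by
  rw [ev, Finset.sum_eq_single_of_mem n (Finset.mem_range.2 Nat.lt_two_pow_self)]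
  · simp [dig, Nat.testBit_two_pow_self]
  · intro i _ hi
    rw [dig_eq_zero (by rw [Nat.testBit_two_pow]; simpa using hi.symm), zero_mul]

theorem sum_dig_fold (n x : ℕ) : ∑ i ∈ Finset.range (n + n), dig x i =
    ∑ i ∈ Finset.range n, dig (Nat.xor x (Nat.shiftRight x n)) i := by
  rw [Finset.sum_range_add, ← Finset.sum_add_distrib]
  refine Finset.sum_congr rfl fun i _ => ?_
  rw [dig_xor]
  simp only [dig, testBit_nshiftRight]

theorem parity_table : ∀ y < 256, ((Nat.land 1 (Nat.shiftRight parityTable y) : ℕ) : ZMod 2) =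
      ∑ i ∈ Finset.range 8, dig y i := by
  decide +kernel

theorem parity_eq {x : ℕ} (hx : ∀ i, 128 ≤ i → x.testBit i = false) :
    (parity x : ZMod 2) = ev x fun _ => 1 := by
  rw [ev_eq_sum hx]
  simp only [mul_one]
  rw [sum_dig_fold 64, sum_dig_fold 32, sum_dig_fold 16, sum_dig_fold 8]
  simp only [parity]
  generalize Nat.xor (Nat.xor (Nat.xor (Nat.xor x (Nat.shiftRight x 64)) _) _) _ = y
  have h255 : Nat.land 255 y < 256 := Nat.lt_of_le_of_lt Nat.and_le_left (by norm_num)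
  rw [parity_table _ h255]
  refine Finset.sum_congr rfl fun i hi => ?_
  rw [dig_land, dig_eq_one, one_mul]
  exact (Nat.testBit_two_pow_sub_one 8 i).trans (by simpa using hi)

theorem parity_lt (x : ℕ) : parity x < 2 := by
  rw [parity]
  exact Nat.lt_of_le_of_lt Nat.and_le_left (by norm_num)

/-! ### Pulling functionals back through one step -/

/-- The first `w` digits of `F` are the values of `f` on `[p, p + w)`. -/
def Win (F w : ℕ) (p : ℤ) (f : ℤ → ZMod 2) : Prop := ∀ i < w, dig F i = f (p + i)

/-- The margin of one cell keeps the neighbours of every cell involved inside the coded window. -/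
def ValidC (C w : ℕ) : Prop := ∀ i, C.testBit i = true → 1 ≤ i ∧ i + 1 < w

/-- Products arise only from a `101` above a `000`, and this forces the row of the `000` to read
`10001` there. The next pull-back relies on this. -/
def ValidQ (Q w : ℕ) (p : ℤ) (f : ℤ → ZMod 2) : Prop := ∀ i, Q.testBit i = true →
  2 ≤ i ∧ i + 2 < w ∧ f (p + i - 2) = 1 ∧ f (p + i - 1) = 0 ∧ f (p + i) = 0 ∧ f (p + i + 1) = 0 ∧
    f (p + i + 2) = 1

def triple (s : ℤ → ZMod 2) (y : ℤ) : ZMod 2 := s (y - 1) * s y * s (y + 1)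

/-- The value at `s` of the functional `(C, Q)` at the place `p`. -/
def val (C Q : ℕ) (p : ℤ) (s : ℤ → ZMod 2) : ZMod 2 :=
  ev C (fun i => s (p + i)) + ev Q (fun i => triple s (p + i))

theorem val_shiftLeft (C Q k : ℕ) (p : ℤ) (s : ℤ → ZMod 2) :
    val (Nat.shiftLeft C k) (Nat.shiftLeft Q k) p s = val C Q (p + k) s := by
  have e : ∀ i : ℕ, p + ((i + k : ℕ) : ℤ) = p + k + i := fun i => by push_cast; ring
  simp only [val, ev_shiftLeft, e]

theorem Win.translate {F w : ℕ} {p c : ℤ} {f : ℤ → ZMod 2} (h : Win F w p f)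
    (hf : ∀ x, f (x + c) = f x) : Win F w (p + c) f := fun i hi => by
  rw [h i hi, ← hf, add_right_comm]

theorem ValidQ.translate {Q w : ℕ} {p c : ℤ} {f : ℤ → ZMod 2} (h : ValidQ Q w p f)
    (hf : ∀ x, f (x + c) = f x) : ValidQ Q w (p + c) f := fun i hi => by
  have e : ∀ d, f (p + c + i + d) = f (p + i + d) := fun d => by
    rw [← hf (p + i + d)]; congr 1; ring
  obtain ⟨h1, h2, h3, h4, h5, h6, h7⟩ := h i hi
  have e0 := e 0
  rw [add_zero, add_zero] at e0
  refine ⟨h1, h2, ?_, ?_, e0.trans h5, (e 1).trans h6, (e 2).trans h7⟩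
  · rw [sub_eq_add_neg, e, ← sub_eq_add_neg, h3]
  · rw [sub_eq_add_neg, e, ← sub_eq_add_neg, h4]

theorem dig_lor (a b i : ℕ) : dig (Nat.lor a b) i = dig a i + dig b i + dig a i * dig b i := by
  simp only [dig, testBit_nlor]
  cases a.testBit i <;> cases b.testBit i <;> rfl

theorem dig_tripleNz (G i : ℕ) :
    dig (tripleNz G) i = 1 + (1 + dig G i) * (1 + dig G (i + 1)) * (1 + dig G (i + 2)) := by
  simp only [dig, testBit_tripleNz]
  cases G.testBit i <;> cases G.testBit (i + 1) <;> cases G.testBit (i + 2) <;> rfl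

theorem dig_gaps (F i : ℕ) :
    dig (gaps F) (i + 1) = dig F i * dig F (i + 2) * (1 + dig F (i + 1)) := by
  simp only [dig, testBit_gaps]
  cases F.testBit i <;> cases F.testBit (i + 1) <;> cases F.testBit (i + 2) <;> rfl

theorem dig_flanks (F i : ℕ) : dig (flanks F) (i + 1) = dig F i + dig F (i + 2) := by
  simp only [dig, testBit_flanks]
  cases F.testBit i <;> cases F.testBit (i + 2) <;> rfl

/-- A new cell is 1 wherever the new first level is. In the middle of a `101` above a nonzero
triple, exactly two of the `g`s, hence two of the `s`s, are 1, and the outcome is `s + s = 0` for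
the third. Elsewhere the occupied cells with `g = 1` are even in number and cancel, and a product
remains only for a `101` above `000`. -/
theorem occ_cell : ∀ fm fp g0 g1 g2 s0 s1 s2 : ZMod 2,
    (g0 = 1 → s0 = 1) → (g1 = 1 → s1 = 1) → (g2 = 1 → s2 = 1) →
    (if g0 + g1 + g2 = 1 then 1 else fm + fp + s0 + s1 + s2 + fm * fp * s0 * s1 * s2) =
    (g0 + g1 + g2) + (1 + ((g0 + g1 + g2) +
      fm * fp * (1 + (g0 + g1 + g2)) * (1 + (1 + g0) * (1 + g1) * (1 + g2)) +
      (g0 + g1 + g2) * (fm * fp * (1 + (g0 + g1 + g2)) * (1 + (1 + g0) * (1 + g1) * (1 + g2))))) *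
      (fm + fp + (((1 + g0) * s0 + ((1 + g1) * s1 + (1 + g2) * s2)) +
        fm * fp * (1 + (g0 + g1 + g2)) * (1 + (1 + (1 + g0) * (1 + g1) * (1 + g2))) *
          (s0 * s1 * s2))) := by
  decide +kernel

/-- The code of the cells where the new occupied state is determined. -/
def fixedCells (F G : ℕ) : ℕ := Nat.lor F (Nat.land (gaps F) (tripleNz G))

/-- The code of the cells where the new occupied state is not linear. -/
def nonlinearCells (F G : ℕ) : ℕ := diff (gaps F) (tripleNz G)

def pullC (F G C : ℕ) : ℕ := diff (spread (diff C (fixedCells F G))) G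

def pullQ (F G C : ℕ) : ℕ :=
  Nat.shiftLeft (Nat.land (diff C (fixedCells F G)) (nonlinearCells F G)) 1

def pullConst (F G C : ℕ) : ℕ :=
  parity (Nat.xor (Nat.land C F) (Nat.land (diff C (fixedCells F G)) (flanks F)))

theorem ev_spread (a : ℕ) (h : ℕ → ZMod 2) :
    ev (spread a) h = ev a fun i => h i + (h (i + 1) + h (i + 2)) := by
  rw [spread, ev_xor, ev_xor, ev_shiftLeft, ev_shiftLeft, ev_add, ev_add]

section step

variable {F G w : ℕ} {p : ℤ} {f g s : ℤ → ZMod 2}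

theorem ev_occStep (hF : Win F w p f) (hG : Win G (w + 2) (p - 1) g) (hfg : addStep g = f)
    (hs : Dominates s g) {C : ℕ} (hC : ValidC C w) :
    ev C (fun i => occStep f s (p + i)) =
      ev C (fun i => dig F i) + ev (diff C (fixedCells F G)) (fun i => dig (flanks F) i) +
        val (pullC F G C) (pullQ F G C) (p - 1) s := by
  rw [val, pullC, pullQ, ev_diff _ G, ev_spread, ev_shiftLeft, ev_land, ← ev_add, add_assoc,
    ← ev_add, ev_diff, ← ev_add]
  refine ev_congr fun i hi => ?_
  obtain ⟨h1, h2⟩ := hC i hi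
  obtain ⟨j, rfl⟩ : ∃ j, i = j + 1 := ⟨i - 1, by omega⟩
  have eg0 := hG (j + 1) (by omega)
  have eg1 := hG (j + 1 + 1) (by omega)
  have eg2 := hG (j + 1 + 2) (by omega)
  have ef0 := hF j (by omega)
  have ef1 := hF (j + 1) (by omega)
  have ef2 := hF (j + 2) (by omega)
  have c0 : p - 1 + ((j + 1 : ℕ) : ℤ) = p + (j + 1 : ℕ) - 1 := by ring
  have c1 : p - 1 + ((j + 1 + 1 : ℕ) : ℤ) = p + (j + 1 : ℕ) := by push_cast; ring
  have c2 : p - 1 + ((j + 1 + 2 : ℕ) : ℤ) = p + (j + 1 : ℕ) + 1 := by push_cast; ring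
  have d0 : p + (j : ℤ) = p + (j + 1 : ℕ) - 1 := by push_cast; ring
  have d2 : p + ((j + 2 : ℕ) : ℤ) = p + (j + 1 : ℕ) + 1 := by push_cast; ring
  rw [c0] at eg0; rw [c1] at eg1; rw [c2] at eg2; rw [d0] at ef0; rw [d2] at ef2
  simp only [fixedCells, nonlinearCells, dig_lor, dig_land, dig_diff, dig_gaps, dig_flanks,
    dig_tripleNz, c0, c1, c2, eg0, eg1, eg2, ef0, ef1, ef2, triple, occStep]
  have key : f (p + (j + 1 : ℕ)) =
      g (p + (j + 1 : ℕ) - 1) + g (p + (j + 1 : ℕ)) + g (p + (j + 1 : ℕ) + 1) := by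
    rw [← hfg]; rfl
  rw [key]
  exact occ_cell _ _ _ _ _ _ _ _ (hs _) (hs _) (hs _)

set_option synthInstance.maxSize 1000 in
set_option synthInstance.maxHeartbeats 200000 in
theorem triple_cell : ∀ g2 g3 g4 s1 s2 s3 s4 s5 : ZMod 2, g2 + g3 + g4 = 0 →
    ¬ (g2 = 0 ∧ g3 = 0 ∧ g4 = 0) → (g4 = 1 → s1 = 1) → (g2 = 1 → s2 = 1) → (g3 = 1 → s3 = 1) →
    (g4 = 1 → s4 = 1) → (g2 = 1 → s5 = 1) →
    (1 + s1 + s2 + s3) * (s2 + s3 + s4) * (1 + s3 + s4 + s5) = 0 := by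
  decide +kernel

/-- Two of the three cells `g (y - 1)`, `g y`, `g (y + 1)` are 1, and the zeros of `f` copy the
outer ones to `y + 2` and `y - 2`. In each of the three cases the domination by `s` makes the new
cell at `y` the complement of one of its new neighbours. -/
theorem triple_occStep (hfg : addStep g = f) (hs : Dominates s g) {y : ℤ} (hm2 : f (y - 2) = 1)
    (hm1 : f (y - 1) = 0) (h0 : f y = 0) (hp1 : f (y + 1) = 0) (hp2 : f (y + 2) = 1)
    (hg : ¬ (g (y - 1) = 0 ∧ g y = 0 ∧ g (y + 1) = 0)) : triple (occStep f s) y = 0 := by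
  have e : ∀ x, f x = g (x - 1) + g x + g (x + 1) := fun x => by rw [← hfg]; rfl
  have q0 := e y
  have q1 := e (y - 1)
  have q2 := e (y + 1)
  rw [h0] at q0
  rw [hm1, show y - 1 - 1 = y - 2 by ring, show y - 1 + 1 = y by ring] at q1
  rw [hp1, show y + 1 - 1 = y by ring, show y + 1 + 1 = y + 2 by ring] at q2
  have k1 : g (y - 2) = g (y + 1) := by
    linear_combination q0 - q1
  have k2 : g (y + 2) = g (y - 1) := by
    linear_combination q0 - q2
  simp only [triple, occStep, hm1, h0, hp1, show y - 1 - 1 = y - 2 by ring,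
    show y - 1 + 1 = y by ring, show y + 1 - 1 = y by ring, show y + 1 + 1 = y + 2 by ring, hm2, hp2]
  simp only [zero_ne_one, if_false, zero_mul, mul_zero, add_zero, zero_add]
  exact triple_cell (g (y - 1)) (g y) (g (y + 1)) _ _ _ _ _ q0.symm hg
    (fun h => hs _ (k1.trans h)) (hs _) (hs _) (hs _) (fun h => hs _ (k2.trans h))

theorem ev_triple_occStep (hG : Win G (w + 2) (p - 1) g) (hfg : addStep g = f)
    (hs : Dominates s g) {Q : ℕ} (hQ : ValidQ Q w p f) {i : ℕ} (hi : Q.testBit i = true)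
    (hb : (tripleNz G).testBit i = true) : triple (occStep f s) (p + i) = 0 := by
  obtain ⟨h1, h2, h3, h4, h5, h6, h7⟩ := hQ i hi
  refine triple_occStep hfg hs h3 h4 h5 h6 h7 ?_
  have eg0 := hG i (by omega)
  have eg1 := hG (i + 1) (by omega)
  have eg2 := hG (i + 2) (by omega)
  rw [show p - 1 + (i : ℤ) = p + i - 1 by ring] at eg0
  rw [show p - 1 + ((i + 1 : ℕ) : ℤ) = p + i by push_cast; ring] at eg1
  rw [show p - 1 + ((i + 2 : ℕ) : ℤ) = p + i + 1 by push_cast; ring] at eg2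
  rintro ⟨z0, z1, z2⟩
  have := dig_tripleNz G i
  rw [eg0, eg1, eg2, z0, z1, z2, dig_eq_one hb] at this
  exact absurd this (by decide)

theorem val_occStep (hF : Win F w p f) (hG : Win G (w + 2) (p - 1) g) (hfg : addStep g = f)
    (hs : Dominates s g) (hw : w ≤ 128) {C Q : ℕ} (hC : ValidC C w) (hQ : ValidQ Q w p f)
    (hb : diff Q (tripleNz G) = 0) : val C Q p (occStep f s) =
      (pullConst F G C : ZMod 2) + val (pullC F G C) (pullQ F G C) (p - 1) s := by
  have hQ0 : ev Q (fun i => triple (occStep f s) (p + i)) = 0 := by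
    refine ev_eq_zero fun i hi => ev_triple_occStep hG hfg hs hQ hi ?_
    have := testBit_diff Q (tripleNz G) i
    rw [hb, hi, Nat.zero_testBit, Bool.true_and] at this
    simpa using this
  rw [val, hQ0, add_zero, ev_occStep hF hG hfg hs hC, pullConst, parity_eq, ev_xor, ev_land,
    ev_land]
  · simp only [mul_one]
  · intro i hi
    have : C.testBit i = false := by
      by_contra h
      have := (hC i (by simpa using h)).2
      omega
    rw [testBit_nxor, testBit_nland, testBit_nland, testBit_diff, this]; rfl

theorem validC_pullC {C : ℕ} (hC : ValidC C w) : ValidC (pullC F G C) (w + 2) := by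
  intro i hi
  rw [pullC, testBit_diff, Bool.and_eq_true, spread, testBit_nxor, testBit_nxor] at hi
  by_contra hcon
  have z : ∀ j, (j = i ∨ j + 1 = i ∨ j + 2 = i) →
      (diff C (fixedCells F G)).testBit j = false := by
    intro j hj
    rw [testBit_diff]
    by_contra h
    have := hC j (by
      revert h; cases C.testBit j <;> simp)
    omega
  have h1 : (Nat.shiftLeft (diff C (fixedCells F G)) 1).testBit i = false := by
    rw [testBit_nshiftLeft]
    rcases Nat.lt_or_ge i 1 with h | h
    · simp [Nat.not_le.2 h]
    · rw [z (i - 1) (by omega), Bool.and_false]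
  have h2 : (Nat.shiftLeft (diff C (fixedCells F G)) 2).testBit i = false := by
    rw [testBit_nshiftLeft]
    rcases Nat.lt_or_ge i 2 with h | h
    · simp [Nat.not_le.2 h]
    · rw [z (i - 2) (by omega), Bool.and_false]
  rw [z i (by omega), h1, h2] at hi
  exact absurd hi.1 (by decide)

theorem validQ_pullQ (hF : Win F w p f) (hG : Win G (w + 2) (p - 1) g) (hfg : addStep g = f)
    {C : ℕ} (hC : ValidC C w) : ValidQ (pullQ F G C) (w + 2) (p - 1) g := by
  intro i hi
  rw [pullQ, testBit_nshiftLeft, Bool.and_eq_true, decide_eq_true_eq, testBit_nland,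
    Bool.and_eq_true] at hi
  obtain ⟨j, rfl⟩ : ∃ j, i = j + 1 := ⟨i - 1, by omega⟩
  rw [Nat.add_sub_cancel, testBit_diff, nonlinearCells, testBit_diff] at hi
  obtain ⟨-, hCj, hN⟩ := hi
  rw [Bool.and_eq_true] at hCj hN
  obtain ⟨h1, h2⟩ := hC j hCj.1
  obtain ⟨k, rfl⟩ : ∃ k, j = k + 1 := ⟨j - 1, by omega⟩
  rw [testBit_gaps, testBit_tripleNz] at hN
  simp only [Bool.and_eq_true, Bool.not_eq_true', Bool.or_eq_false_iff] at hN
  obtain ⟨⟨⟨f0, f2⟩, f1⟩, g0, g1, g2⟩ := hN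
  have e : ∀ x, f x = g (x - 1) + g x + g (x + 1) := fun x => by rw [← hfg]; rfl
  have eg0 := hG (k + 1) (by omega)
  have eg1 := hG (k + 1 + 1) (by omega)
  have eg2 := hG (k + 1 + 2) (by omega)
  have ef0 := hF k (by omega)
  have ef2 := hF (k + 2) (by omega)
  rw [dig_eq_zero g0] at eg0
  rw [dig_eq_zero g1] at eg1
  rw [dig_eq_zero g2] at eg2
  rw [dig_eq_one f0, e] at ef0
  rw [dig_eq_one f2, e] at ef2
  push_cast at *
  rw [show p + (k : ℤ) = p - 1 + (k + 1) by ring] at ef0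
  rw [show p + ((k : ℤ) + 2) + 1 = p - 1 + (k + 1 + 1) + 2 by ring,
    show p + ((k : ℤ) + 2) - 1 = p - 1 + (k + 1 + 1) by ring,
    show p + ((k : ℤ) + 2) = p - 1 + (k + 1 + 2) by ring, ← eg1, ← eg2] at ef2
  rw [show p - 1 + ((k : ℤ) + 1) + 1 = p - 1 + (k + 1 + 1) by ring, ← eg0, ← eg1] at ef0
  refine ⟨by omega, by omega, ?_, ?_, eg1.symm, ?_, ?_⟩
  · rw [show p - 1 + ((k : ℤ) + 1 + 1) - 2 = p - 1 + (k + 1) - 1 by ring]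
    simpa using ef0.symm
  · rw [show p - 1 + ((k : ℤ) + 1 + 1) - 1 = p - 1 + (k + 1) by ring]; exact eg0.symm
  · rw [show p - 1 + ((k : ℤ) + 1 + 1) + 1 = p - 1 + (k + 1 + 2) by ring]; exact eg2.symm
  · simpa using ef2.symm

end step

/-! ### Soundness of the count for one functional -/

theorem force_eq (n : ℕ) (f : ℕ → ℕ) : force n f = f n := by cases n <;> rfl

theorem ifZero_eq (c x y : ℕ) : ifZero c x y = if c = 0 then x else y := by
  cases c <;> rfl

theorem sel_false (x y : ℕ) : sel false x y = y := rfl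

theorem sel_true (x y : ℕ) : sel true x y = x := rfl

theorem isPre_rec {F w G : ℕ} (h : isPre F w G = true) (i : ℕ) (hi : i < w) :
    dig G i + dig G (i + 1) + dig G (i + 2) = dig F i := by
  have h' := congrArg (fun x => dig x i) (Nat.eq_of_beq_eq_true h)
  simp only [dig_land, dig_xor] at h'
  rw [dig_eq_one (C := mask w) (by rw [testBit_mask]; simpa using hi), mul_one, mul_one] at h'
  rw [← h']
  simp only [dig, testBit_nshiftRight, add_comm 1, add_comm 2, add_assoc]

theorem win_pre {F w G : ℕ} {p : ℤ} {f : ℤ → ZMod 2} (hF : Win F w p f)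
    (h : ∀ i < w, dig G i + dig G (i + 1) + dig G (i + 2) = dig F i) :
    Win G (w + 2) (p - 1) (pre f (p - 1) (dig G 0) (dig G 1)) := by
  intro i
  induction i using Nat.strong_induction_on with
  | _ i ih =>
    intro hi
    match i with
    | 0 => rw [Nat.cast_zero, add_zero, pre_apply_self]
    | 1 => rw [Nat.cast_one, pre_apply_succ]
    | i + 2 =>
      have e0 := ih i (by omega) (by omega)
      have e1 := ih (i + 1) (by omega) (by omega)
      have e2 := h i (by omega)
      have e3 := congrFun (addStep_pre f (p - 1) (dig G 0) (dig G 1)) (p + i)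
      rw [addStep, ← hF i (by omega), show p + (i : ℤ) - 1 = p - 1 + i by ring, ← e0,
        show p + (i : ℤ) = p - 1 + (i + 1 : ℕ) by push_cast; ring, ← e1,
        show p - 1 + ((i + 1 : ℕ) : ℤ) + 1 = p - 1 + (i + 2 : ℕ) by push_cast; ring, ← e2] at e3
      exact (add_left_cancel e3).symm

/-- The code of the row that is mapped to a row with code `F` and differs from a fixed such row
by `b`. -/
def preCode (F w b : ℕ) : ℕ :=
  Nat.land (Nat.xor (Nat.land (unstep F) (mask w)) b) (mask w)

theorem kernelCode_rec : ∀ b < 3, ∀ i < 120, dig (kernelCode b) i + dig (kernelCode b) (i + 1) +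
    dig (kernelCode b) (i + 2) = 0 := by
  decide +kernel

theorem dig_land_mask {x w i : ℕ} (hi : i < w) : dig (Nat.land x (mask w)) i = dig x i := by
  rw [dig_land, dig_eq_one (C := mask w) (by rw [testBit_mask]; simpa using hi), mul_one]

theorem win_preCode {F w b : ℕ} {p : ℤ} {f : ℤ → ZMod 2} (hF : Win F w p f)
    (h : isPre F w (Nat.land (unstep F) (mask (w + 2))) = true)
    (hb : ∀ i < w, dig b i + dig b (i + 1) + dig b (i + 2) = 0) :
    Win (preCode F (w + 2) b) (w + 2) (p - 1)
      (pre f (p - 1) (dig (unstep F) 0 + dig b 0) (dig (unstep F) 1 + dig b 1)) := by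
  have hd : ∀ i, i < w + 2 → dig (preCode F (w + 2) b) i = dig (unstep F) i + dig b i :=
    fun i hi => by rw [preCode, dig_land_mask hi, dig_xor, dig_land_mask hi]
  rw [← hd 0 (by omega), ← hd 1 (by omega)]
  refine win_pre hF fun i hi => ?_
  have := isPre_rec h i hi
  rw [dig_land_mask (by omega), dig_land_mask (by omega), dig_land_mask (by omega)] at this
  rw [hd _ (by omega), hd _ (by omega), hd _ (by omega)]
  linear_combination this + hb i hi

/-- The four rows that are mapped to `f`, with their codes. -/
theorem exists_preimages {F w : ℕ} {p : ℤ} {f : ℤ → ZMod 2} (hF : Win F w p f) (hw : w ≤ 120)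
    (h : isPre F w (Nat.land (unstep F) (mask (w + 2))) = true) :
    ∃ g : ℕ → ℤ → ZMod 2, (∀ i, addStep (g i) = f) ∧
      Win (preCode F (w + 2) 0) (w + 2) (p - 1) (g 0) ∧
      (∀ b < 3, Win (preCode F (w + 2) (kernelCode b)) (w + 2) (p - 1) (g (b + 1))) ∧
      ∀ P k, cnt P (k + 1) f = cnt P k (g 0) + cnt P k (g 1) + (cnt P k (g 2) + cnt P k (g 3)) := by
  have hk := fun b hb i hi => kernelCode_rec b hb i (lt_of_lt_of_le hi hw)
  have d00 : dig (kernelCode 0) 0 = 1 := by decide +kernel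
  have d01 : dig (kernelCode 0) 1 = 0 := by decide +kernel
  have d10 : dig (kernelCode 1) 0 = 0 := by decide +kernel
  have d11 : dig (kernelCode 1) 1 = 1 := by decide +kernel
  have d20 : dig (kernelCode 2) 0 = 1 := by decide +kernel
  have d21 : dig (kernelCode 2) 1 = 1 := by decide +kernel
  have w0 := win_preCode (b := 0) hF h (fun i _ => by simp [dig])
  have w1 := win_preCode hF h (hk 0 (by norm_num))
  have w2 := win_preCode hF h (hk 1 (by norm_num))
  have w3 := win_preCode hF h (hk 2 (by norm_num))
  rw [d00, d01, add_zero] at w1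
  rw [d10, d11, add_zero] at w2
  rw [d20, d21] at w3
  have z : ∀ i, dig 0 i = 0 := fun i => by simp [dig]
  rw [z, z, add_zero, add_zero] at w0
  generalize dig (unstep F) 0 = x0 at w0 w1 w2 w3
  generalize dig (unstep F) 1 = x1 at w0 w1 w2 w3
  refine ⟨fun i => match i with
    | 0 => pre f (p - 1) x0 x1
    | 1 => pre f (p - 1) (x0 + 1) x1
    | 2 => pre f (p - 1) x0 (x1 + 1)
    | _ + 3 => pre f (p - 1) (x0 + 1) (x1 + 1), fun i => ?_, w0, fun b hb => ?_, fun P k => ?_⟩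
  · match i with
    | 0 => exact addStep_pre _ _ _ _
    | 1 => exact addStep_pre _ _ _ _
    | 2 => exact addStep_pre _ _ _ _
    | _ + 3 => exact addStep_pre _ _ _ _
  · match b with
    | 0 => exact w1
    | 1 => exact w2
    | 2 => exact w3
    | _ + 3 => omega
  · rw [cnt_succ' P k f (p - 1)]
    have o : (1 : ZMod 2) + 1 = 0 := rfl
    rcases zmod_two_cases x0 with rfl | rfl <;> rcases zmod_two_cases x1 with rfl | rfl <;>
      simp only [zero_add, o] <;> ring

theorem shiftRight_land_win {F w sh w' : ℕ} {p : ℤ} {f : ℤ → ZMod 2} (hF : Win F w p f)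
    (hw : w' + sh ≤ w) :
    Win (Nat.land (Nat.shiftRight F sh) (mask w')) w' (p + sh) f := by
  intro i hi
  rw [dig_land_mask hi, add_assoc, ← Nat.cast_add, ← hF (sh + i) (by omega)]
  simp only [dig, testBit_nshiftRight]

theorem le_log2_of_testBit {n i : ℕ} (h : n.testBit i = true) : i ≤ Nat.log2 n := by
  by_contra hlt
  rw [Nat.testBit_lt_two_pow (lt_of_lt_of_le Nat.lt_log2_self
    (Nat.pow_le_pow_right (by norm_num) (by omega)))] at h
  exact absurd h (by decide)

theorem norm_spec {C Q F w : ℕ} {p : ℤ} {f : ℤ → ZMod 2} (hF : Win F w p f)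
    (hQ : ValidQ Q w p f) (k : ℕ → ℕ → ℕ → ℕ → ℕ) :
    norm C Q F w k = 0 ∨ ∃ (sh C' Q' F' w' : ℕ), norm C Q F w k = k C' Q' F' w' ∧
      C = Nat.shiftLeft C' sh ∧ Q = Nat.shiftLeft Q' sh ∧ w' ≤ w ∧ Win F' w' (p + sh) f ∧
      ValidC C' w' ∧ ValidQ Q' w' (p + sh) f := by
  simp only [norm, force_eq]
  generalize Nat.sub (Nat.log2 (lowBit _)) 1 = sh
  generalize hC' : Nat.shiftRight C sh = C'
  generalize hQ' : Nat.shiftRight Q sh = Q'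
  generalize hw' : Nat.add 2 (Nat.log2 (Nat.lor C' (Nat.shiftLeft Q' 1))) = w'
  rw [normCheck]
  rcases h1 : Nat.beq (Nat.shiftLeft C' sh) C with _ | _
  · exact Or.inl rfl
  rcases h2 : Nat.beq (Nat.shiftLeft Q' sh) Q with _ | _
  · exact Or.inl rfl
  rcases h3 : Nat.ble (Nat.add w' sh) w with _ | _
  · exact Or.inl rfl
  simp only [sel_true, ifZero_eq]
  by_cases h4 : Nat.land C' 1 = 0
  swap
  · exact Or.inl (if_neg h4)
  by_cases h5 : Nat.land Q' 3 = 0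
  swap
  · rw [if_pos h4]; exact Or.inl (if_neg h5)
  rw [if_pos h4, if_pos h5]
  replace h1 := (Nat.eq_of_beq_eq_true h1).symm
  replace h2 := (Nat.eq_of_beq_eq_true h2).symm
  replace h3 : w' + sh ≤ w := Nat.le_of_ble_eq_true h3
  refine Or.inr ⟨sh, C', Q', _, w', rfl, h1, h2, by omega, shiftRight_land_win hF h3, ?_, ?_⟩
  · intro i hi
    have hb : i ≤ _ := le_log2_of_testBit
      (n := Nat.lor C' (Nat.shiftLeft Q' 1)) (by rw [testBit_nlor, hi]; rfl)
    have hw2 : w' = 2 + Nat.log2 (Nat.lor C' (Nat.shiftLeft Q' 1)) := hw'.symm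
    refine ⟨?_, by omega⟩
    by_contra h0
    have := testBit_nland C' 1 i
    rw [h4, hi, show i = 0 by omega] at this
    exact absurd this (by decide)
  · intro i hi
    have hb : i + 1 ≤ _ := le_log2_of_testBit
      (n := Nat.lor C' (Nat.shiftLeft Q' 1)) (by
        rw [testBit_nlor, testBit_nshiftLeft_add, hi, Bool.or_true])
    have hw2 : w' = 2 + Nat.log2 (Nat.lor C' (Nat.shiftLeft Q' 1)) := hw'.symm
    have hv := hQ (i + sh) (by rw [h2, testBit_nshiftLeft_add]; exact hi)
    rw [show p + ((i + sh : ℕ) : ℤ) = p + sh + i by push_cast; ring] at hv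
    refine ⟨?_, by omega, hv.2.2⟩
    by_contra h0
    have := testBit_nland Q' 3 i
    rw [h5, hi] at this
    have hi2 : i = 0 ∨ i = 1 := by omega
    rcases hi2 with rfl | rfl <;> exact absurd this (by decide)

/-- The functional `(C, Q)` at `p` has the value `σ` on all states `k` steps after `g`. -/
def ConstVal (k C Q : ℕ) (p : ℤ) (σ : ZMod 2) (g : ℤ → ZMod 2) : Prop :=
  ∀ s, Dominates s g → val C Q p (occAfter k g s) = σ

theorem cast_xor : ∀ a < 2, ∀ b < 2, ((Nat.xor a b : ℕ) : ZMod 2) = (a : ZMod 2) + b := by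
  decide

theorem locBranch_le {rec : ℕ → ℕ → ℕ → ℕ → ℕ → ℕ} {k C Q F w sg G : ℕ} {p : ℤ}
    {f g : ℤ → ZMod 2} (hF : Win F w p f) (hG : Win G (w + 2) (p - 1) g) (hfg : addStep g = f)
    (hw : w ≤ 128) (hC : ValidC C w) (hQ : ValidQ Q w p f) (hsg : sg < 2)
    (hrec : ∀ C' Q' sg', ValidC C' (w + 2) → ValidQ Q' (w + 2) (p - 1) g → sg' < 2 →
      rec C' Q' G (w + 2) sg' ≤ cnt (ConstVal k C' Q' (p - 1) sg') k g) :
    locBranch rec C Q F w sg G ≤ cnt (ConstVal (k + 1) C Q p sg) k g := by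
  have e : locBranch rec C Q F w sg G = ifZero (diff Q (tripleNz G))
      (rec (pullC F G C) (pullQ F G C) G (w + 2) (Nat.xor sg (pullConst F G C))) 0 := rfl
  rw [e, ifZero_eq]
  split_ifs with hb
  · refine (hrec _ _ _ (validC_pullC hC) (validQ_pullQ hF hG hfg hC) ?_).trans (cnt_mono ?_)
    · exact Nat.xor_lt_two_pow (n := 1) hsg (parity_lt _)
    · intro u hu hP s hs
      have hd := dominates_occAfter hs k
      rw [hu] at hd
      have hf : addStep^[k + 1] u = f := by rw [Function.iterate_succ_apply', hu, hfg]
      rw [occAfter, hf, val_occStep hF hG hfg hd hw hC hQ hb, hP s hs,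
        cast_xor _ hsg (pullConst F G C) (parity_lt _)]
      generalize (pullConst F G C : ZMod 2) = x
      linear_combination x * two_eq_zero_zmod
  · exact Nat.zero_le _

/-- Each step back widens the window by at most two cells; the bound 120 keeps it within the range
where `kernelCode` is correct. -/
theorem locCount_le (k : ℕ) {C Q F w sg : ℕ} {p : ℤ} {f : ℤ → ZMod 2} (hF : Win F w p f)
    (hw : w + 2 * k ≤ 120) (hC : ValidC C w) (hQ : ValidQ Q w p f) (hsg : sg < 2) :
    locCount k C Q F w sg ≤ cnt (ConstVal k C Q p sg) k f := by
  induction k generalizing C Q F w sg p f with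
  | zero => exact Nat.zero_le _
  | succ k ih =>
    have e : locCount (k + 1) C Q F w sg =
      sel (isPre F w (Nat.land (unstep F) (mask (w + 2))))
        (let br := fun b => locBranch (fun C' Q' G w' sg' =>
          ifZero (Nat.lor C' Q') (ifZero sg' (Nat.pow 4 k) 0)
            (norm C' Q' G w' fun C Q F w => ifZero sg' (locCount k C Q F w 0)
              (locCount k C Q F w 1))) C Q F w sg (preCode F (w + 2) b)
        br 0 + br (kernelCode 0) + (br (kernelCode 1) + br (kernelCode 2))) 0 := rfl
    rw [e]
    rcases hpre : isPre F w (Nat.land (unstep F) (mask (w + 2))) with _ | _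
    · exact Nat.zero_le _
    obtain ⟨g, hg, w0, wb, hcnt⟩ := exists_preimages hF (by omega) hpre
    rw [sel_true, hcnt]
    have hbr : ∀ G g, Win G (w + 2) (p - 1) g → addStep g = f → locBranch (fun C' Q' G w' sg' =>
          ifZero (Nat.lor C' Q') (ifZero sg' (Nat.pow 4 k) 0)
            (norm C' Q' G w' fun C Q F w => ifZero sg' (locCount k C Q F w 0)
              (locCount k C Q F w 1))) C Q F w sg G ≤ cnt (ConstVal (k + 1) C Q p sg) k g := by
      intro G g hG hgf
      refine locBranch_le hF hG hgf (by omega) hC hQ hsg fun C' Q' sg' hC' hQ' hsg' => ?_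
      rw [ifZero_eq]
      split_ifs with hz
      · rw [ifZero_eq]
        split_ifs with hs0
        · rw [cnt_of_forall]
          · exact le_rfl
          · intro u _ s _
            obtain ⟨rfl, rfl⟩ : C' = 0 ∧ Q' = 0 := Nat.or_eq_zero_iff.1 hz
            rw [hs0, val, ev_zero, ev_zero]; rfl
        · exact Nat.zero_le _
      · rcases norm_spec (C := C') hG hQ' (fun C Q F w => ifZero sg' (locCount k C Q F w 0)
          (locCount k C Q F w 1)) with h0 | ⟨sh, C'', Q'', F'', w'', h0, hc, hq, hw'', hF'', hC'', hQ''⟩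
        · rw [h0]; exact Nat.zero_le _
        · have hv : ∀ s, val C' Q' (p - 1) s = val C'' Q'' (p - 1 + sh) s := fun s => by
            rw [hc, hq, val_shiftLeft]
          have hcv : ConstVal k C' Q' (p - 1) sg' = ConstVal k C'' Q'' (p - 1 + sh) sg' := by
            funext u; simp only [ConstVal, hv]
          rw [h0, hcv, ifZero_eq]
          have hs2 : sg' = 0 ∨ sg' = 1 := by omega
          rcases hs2 with rfl | rfl
          · exact ih hF'' (by omega) hC'' hQ'' (by norm_num)
          · exact ih hF'' (by omega) hC'' hQ'' (by norm_num)
    exact add_le_add (add_le_add (hbr _ _ w0 (hg 0)) (hbr _ _ (wb 0 (by norm_num)) (hg 1)))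
      (add_le_add (hbr _ _ (wb 1 (by norm_num)) (hg 2)) (hbr _ _ (wb 2 (by norm_num)) (hg 3)))

/-! ### The ethers -/

/-- The initial rows of the ethers, as words on the ring of length `16`. The first thirteen are
those of the table; the last one is the reflection of the one with the index `8`. -/
def etherWord (k : ℕ) : ℕ := List.getD
  [0x0, 0xaaaa, 0x8888, 0x8080, 0xa0a0, 0x8000, 0xa000, 0x8800, 0xa200, 0xaa00, 0xa880, 0xaa80, 0xa820, 0x8a00] k 0

def etherSlice (k s : ℕ) : ℕ := ringStep^[s] (etherWord k)

/-- The ethers that occur in the table. -/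
def ether (k : ℕ) : ℤ → ℤ → State := fun x t =>
  if (etherSlice k (t % 8).toNat).testBit (x % 16).toNat then 2 else 0

theorem ether_add_eight (k : ℕ) (x t : ℤ) : ether k x (t + 8) = ether k x t := by
  simp only [ether, Int.add_emod_right]

theorem ether_add_sixteen (k : ℕ) (x t : ℤ) : ether k (x + 16) t = ether k x t := by
  simp only [ether, Int.add_emod_right]

theorem ether_ne_one (k : ℕ) (x t : ℤ) : ether k x t ≠ 1 := by
  rw [ether]; split_ifs <;> decide

theorem isEther_ether (k : ℕ) : IsEther (ether k) :=
  ⟨ether_ne_one k, ⟨16, by norm_num, ether_add_sixteen k⟩, ⟨8, by norm_num, ether_add_eight k⟩⟩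

/-- The reduction modulo 8 is possible because on a ring of 16 cells `addStep^[8]` adds the two
equal cells at distance 8 and is thus the identity. -/
theorem dig_etherSlice_succ : ∀ k < 14, ∀ s < 8, ∀ x < 16,
    dig (etherSlice k ((s + 1) % 8)) x = dig (etherSlice k s) ((x + 15) % 16) +
      dig (etherSlice k s) x + dig (etherSlice k s) ((x + 1) % 16) := by
  decide +kernel

theorem eq_ite_of_bits {a : State} {c : Prop} [Decidable c] (h1 : bit1 a = 0)
    (h2 : bit12 a = if c then 1 else 0) : a = if c then 2 else 0 := by
  split_ifs at h2 ⊢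
  · revert a; decide +kernel
  · revert a; decide +kernel

theorem level_ether (k : ℕ) (t : ℤ) : level (fun x => ether k x t) = 0 := by
  funext x
  simp only [level, ether]
  split_ifs <;> rfl

theorem occupied_ether (k : ℕ) (t x : ℤ) : occupied (fun x => ether k x t) x =
    dig (etherSlice k (t % 8).toNat) (x % 16).toNat := by
  simp only [occupied, ether, dig]
  split_ifs <;> rfl

theorem isHistory_ether {k : ℕ} (hk : k < 14) : IsHistory (ether k) := by
  intro t
  funext x
  refine eq_of_level_of_occupied (ξ := fun x => ether k x (t + 1)) ?_ ?_
  · rw [level_ether, level_step, level_ether, addStep_zero]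
  · rw [occupied_step, level_ether, addStep_zero, occStep_zero, addStep, occupied_ether,
      occupied_ether, occupied_ether, occupied_ether,
      show ((t + 1) % 8).toNat = ((t % 8).toNat + 1) % 8 by omega,
      dig_etherSlice_succ k hk _ (by omega) _ (by omega),
      show ((x - 1) % 16).toNat = ((x % 16).toNat + 15) % 16 by omega,
      show ((x + 1) % 16).toNat = ((x % 16).toNat + 1) % 16 by omega]

/-! ### Recognition of the ether from the final state. -/

/-- Rotation of the ring of length `16`. -/
def rotate (a v : ℕ) : ℕ := Nat.lor (Nat.shiftRight v a) (Nat.land 0xffff (Nat.shiftLeft v (16 - a)))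

theorem testBit_two_pow_16 {y : ℕ} (hy : y < 16) : Nat.testBit 0xffff y = true :=
  (Nat.testBit_two_pow_sub_one 16 y).trans (by simpa using hy)

theorem testBit_rotate {a v x : ℕ} (hv : v < 2 ^ 16) (ha : a < 16) (hx : x < 16) :
    (rotate a v).testBit x = v.testBit ((x + a) % 16) := by
  rw [rotate, testBit_nlor, testBit_nland, testBit_two_pow_16 hx, Bool.true_and,
    testBit_nshiftRight, testBit_nshiftLeft]
  rcases Nat.lt_or_ge (x + a) 16 with h | h
  · rw [decide_eq_false (by omega), Bool.false_and, Bool.or_false, Nat.mod_eq_of_lt h, add_comm]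
  · rw [decide_eq_true (by omega), Bool.true_and, Nat.testBit_lt_two_pow
      (hv.trans_le (Nat.pow_le_pow_right (by norm_num) (by omega))), Bool.false_or]
    congr 1; omega

theorem etherSlice_lt : ∀ k < 14, ∀ s < 8, etherSlice k s < 2 ^ 16 := by
  decide +kernel

theorem ringWord_eq_rotate : ∀ i < 256, tableClass i < 14 → ∃ s < 8, ∃ a < 16,
    ringWord i = rotate a (etherSlice (tableClass i) s) := by
  decide +kernel

theorem addStep_iterate_16 (f : ℤ → ZMod 2) (x : ℤ) :
    addStep^[16] f x = f (x - 16) + f x + f (x + 16) := by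
  rw [show (16 : ℕ) = 2 ^ 4 by norm_num, addStep_iterate_two_pow]
  norm_num

theorem periodic_48 {m : ℕ} (hm : m ≤ 16) {f : ℤ → ZMod 2} (hf : addStep^[m] f = 0) (x : ℤ) :
    f (x + 48) = f x := by
  have h := addStep_iterate_eq_zero_of_le hm hf
  rw [show (16 : ℕ) = 2 ^ 4 by norm_num] at h
  simpa using periodic_of_addStep_iterate_eq_zero h x

theorem classIndex_lt (u : ℕ) : classIndex u < 256 :=
  Nat.lt_of_le_of_lt Nat.and_le_left (by norm_num)

/-- The translations by `-16`, `0`, `16` are all multiples of 16 modulo 48, so the image has period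
16. -/
theorem addStep_iterate_16_of_periodic {b : ℤ → ZMod 2} (hper : ∀ x, b (x + 48) = b x) (x : ℤ) :
    addStep^[16] b x = b (x % 16) + b (x % 16 + 16) + b (x % 16 + 32) := by
  have hp : ∀ x, addStep^[16] b (x + 16) = addStep^[16] b x := by
    intro x
    rw [addStep_iterate_16, addStep_iterate_16, show x + 16 - 16 = x by ring,
      show x + 16 + 16 = x - 16 + 48 by ring, hper]
    ring
  have hx : addStep^[16] b x = addStep^[16] b (x % 16 + 16) := by
    rw [hp]
    conv_lhs => rw [← Int.emod_add_mul_ediv x 16, mul_comm]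
    exact Function.Periodic.int_mul (f := addStep^[16] b) (c := 16) hp _ _
  rw [hx, addStep_iterate_16, show x % 16 + 16 - 16 = x % 16 by ring,
    show x % 16 + 16 + 16 = x % 16 + 32 by ring]

theorem dig_foldWord {N : ℕ} {b : ℤ → ZMod 2} (hN : ∀ i : ℕ, i < 48 → dig N (i + 1) = b i) {y : ℕ}
    (hy : y < 16) : dig (foldWord N) y = b y + b (y + 16) + b (y + 32) := by
  have e : ∀ k i, dig (Nat.shiftRight k i) y = dig k (i + y) := fun k i => by
    simp only [dig, testBit_nshiftRight]
  have e0 := hN y (by omega)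
  have e1 := hN (y + 16) (by omega)
  have e2 := hN (y + 32) (by omega)
  push_cast at e1 e2
  have f0 : dig (Nat.shiftRight N 1) y = b y := by rw [e, add_comm 1 y, e0]
  have f1 : dig (Nat.shiftRight (Nat.shiftRight N 1) 16) y = b (y + 16) := by
    rw [e, ← e1]; simp only [dig, testBit_nshiftRight]; congr 3; ring
  have f2 : dig (Nat.shiftRight (Nat.shiftRight N 1) 32) y = b (y + 32) := by
    rw [e, ← e2]; simp only [dig, testBit_nshiftRight]; congr 3; ring
  have g : foldWord N = Nat.land 0xffff (Nat.xor (Nat.shiftRight N 1)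
    (Nat.xor (Nat.shiftRight (Nat.shiftRight N 1) 16) (Nat.shiftRight (Nat.shiftRight N 1) 32))) := rfl
  rw [g, dig_land, dig_eq_one (testBit_two_pow_16 hy), one_mul, dig_xor, dig_xor, f0, f1, f2,
    add_assoc]

/-- If the state after `m` steps is always the one coded by `N`, then the class of `N` is the
ether. -/
theorem goodFor_classOf {m N : ℕ} (hm : m ≤ 16) {f b : ℤ → ZMod 2} (hf : addStep^[m] f = 0)
    (hb : ∀ s, Dominates s f → occAfter m f s = b)
    (hN : ∀ i : ℕ, 1 ≤ i → i < 49 → dig N i = b (i - 1)) (hc : classOf N < 14) :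
    GoodFor (ether (classOf N)) m f := by
  -- `b` is in particular what becomes of the state `s = f`, which has period 48.
  have hper : ∀ x, b (x + 48) = b x := by
    have h1 : shift 48 f = f := funext fun x => periodic_48 hm hf x
    have h2 := occAfter_shift m 48 f f
    rw [h1, hb f (dominates_self f)] at h2
    exact fun x => (congrFun h2 x).symm
  have hu : ∀ x, addStep^[16] b x = dig (foldWord N) (x % 16).toNat := fun x => by
    rw [addStep_iterate_16_of_periodic hper,
      dig_foldWord (b := b) (fun i hi => (hN (i + 1) (by omega) (by omega)).trans (by
        rw [Nat.cast_succ, add_sub_cancel_right])) (by omega), Int.toNat_of_nonneg (by omega)]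
  simp only [classOf] at hc ⊢
  rcases he : Nat.beq (foldWord N) (ringWord (classIndex (foldWord N))) with _ | _
  · rw [he, sel_false] at hc; exact absurd hc (by norm_num)
  rw [he] at hc
  rw [sel_true] at hc ⊢
  have hi := classIndex_lt (foldWord N)
  obtain ⟨s, hs, a, ha, hsa⟩ := ringWord_eq_rotate _ hi hc
  rw [← Nat.eq_of_beq_eq_true he] at hsa
  intro ξ hξ
  refine ⟨a, s, fun x => ?_⟩
  rw [evolve_add]
  have hl : level (evolve ξ m) = 0 := by rw [level_evolve, hξ, hf]
  have ho : occupied (evolve ξ m) = b := by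
    rw [occupied_evolve, hξ]; exact hb _ (hξ ▸ dominates_occupied ξ)
  rw [ether]
  refine eq_ite_of_bits ?_ ?_
  · have := congrFun (level_evolve (evolve ξ m) 16) x
    rwa [hl, addStep_iterate_zero] at this
  · have := congrFun (occupied_evolve (evolve ξ m) 16) x
    rw [hl, ho, occAfter_zero, hu, hsa, dig, testBit_rotate (etherSlice_lt _ hc s hs) ha (by omega)] at this
    refine this.trans ?_
    rw [show ((s : ℤ) % 8).toNat = s by omega,
      show ((x + a) % 16).toNat = ((x % 16).toNat + a) % 16 by omega]

/-! ### Forward evolution of codes -/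

/-- `rows` codes the rows that come after `f`, up to the last one before the zero row, which `f`
reaches in `m` steps. -/
def RowsOK : ℕ → (ℤ → ZMod 2) → List ℕ → Prop
  | m, f, [] => m = 1 ∧ addStep f = 0
  | m, f, l :: rows => ∃ m' : ℕ, m = m' + 1 ∧ Win l (50 + 2 * m') (-(m' + 1)) (addStep f) ∧
      RowsOK m' (addStep f) rows

theorem fwd_cell : ∀ l0 l1 l2 s0 s1 s2 : Bool,
    (if (l1 || (((l0 ^^ l2) ^^ (s0 ^^ (s1 ^^ s2))) ^^ ((l0 && l2) && (s0 && (s1 && s2)))))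
      then (1 : ZMod 2) else 0) =
    if (if l1 then (1 : ZMod 2) else 0) = 1 then 1 else
      (if l0 then 1 else 0) + (if l2 then 1 else 0) + (if s0 then 1 else 0) +
        (if s1 then 1 else 0) + (if s2 then 1 else 0) +
        (if l0 then 1 else 0) * (if l2 then 1 else 0) * (if s0 then 1 else 0) *
          (if s1 then 1 else 0) * (if s2 then 1 else 0) := by
  decide

theorem dig_fwdStep {l s m : ℕ} {p : ℤ} {f σ : ℤ → ZMod 2} (hl : Win l (50 + 2 * m) (p + 1) f)
    (hs : ∀ i : ℕ, 1 ≤ i → i < 51 + 2 * m → dig s i = σ (p + i)) {i : ℕ} (h1 : 1 ≤ i)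
    (h2 : i < 49 + 2 * m) : dig (fwdStep l s) i = occStep f σ (p + 1 + i) := by
  obtain ⟨j, rfl⟩ : ∃ j, i = j + 1 := ⟨i - 1, by omega⟩
  have el0 := hl j (by omega)
  have el1 := hl (j + 1) (by omega)
  have el2 := hl (j + 2) (by omega)
  have es0 := hs (j + 1) (by omega) (by omega)
  have es1 := hs (j + 2) (by omega) (by omega)
  have es2 := hs (j + 3) (by omega) (by omega)
  rw [occStep, show p + 1 + ((j + 1 : ℕ) : ℤ) - 1 = p + 1 + j by push_cast; ring,
    show p + 1 + ((j + 1 : ℕ) : ℤ) + 1 = p + 1 + (j + 2 : ℕ) by push_cast; ring, ← el0, ← el1, ← el2,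
    show p + 1 + (j : ℤ) = p + (j + 1 : ℕ) by push_cast; ring, ← es0,
    show p + 1 + ((j + 1 : ℕ) : ℤ) = p + (j + 2 : ℕ) by push_cast; ring, ← es1,
    show p + 1 + ((j + 2 : ℕ) : ℤ) = p + (j + 3 : ℕ) by push_cast; ring, ← es2]
  simp only [dig, fwdStep, testBit_nlor, testBit_nxor, testBit_nland, testBit_nshiftRight,
    testBit_nshiftLeft_add]
  rw [show 1 + (j + 1) = j + 2 by ring, show 2 + (j + 1) = j + 3 by ring]
  exact fwd_cell _ _ _ _ _ _

/-- A step needs both neighbours, so the coded interval loses one cell at each end. The initial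
margin of `m` cells leaves a full period of 48 cells. -/
theorem dig_fwd (rows : List ℕ) {m s : ℕ} {f σ : ℤ → ZMod 2} (hr : RowsOK m f rows)
    (hs : ∀ i : ℕ, 1 ≤ i → i < 49 + 2 * m → dig s i = σ (-(m + 1) + i)) {i : ℕ} (h1 : 1 ≤ i)
    (h2 : i < 49) : dig (fwd rows s) i = occAfter m f σ (i - 1) := by
  induction rows generalizing m s f σ with
  | nil =>
    obtain ⟨rfl, hf⟩ := hr
    have : Win 0 (50 + 2 * 0) (-2 + 1) (addStep f) := fun i _ => by rw [hf]; simp [dig]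
    refine (dig_fwdStep (m := 0) this hs h1 h2).trans ?_
    rw [occAfter_succ']
    change occStep _ σ _ = occStep _ σ _
    congr 1
  | cons l rows ih =>
    obtain ⟨m, rfl, hl, hr⟩ := hr
    refine (ih (s := fwdStep l s) hr (σ := occStep (addStep f) σ) fun i h1 h2 => ?_).trans ?_
    · push_cast at hs
      rw [show -((m : ℤ) + 1) = -(m + 1 + 1) + 1 by ring] at hl ⊢
      exact dig_fwdStep hl (fun i h1 h2 => hs i h1 (by omega)) h1 h2
    · rw [occAfter_succ']

/-! ### Lists of functionals -/

/-- Two functionals agree up to a translation by `48`. -/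
def SameMod (e e' : ℕ × ℕ) : Prop :=
  e = e' ∨ e = (Nat.shiftLeft e'.1 48, Nat.shiftLeft e'.2 48) ∨
    e' = (Nat.shiftLeft e.1 48, Nat.shiftLeft e.2 48)

def Covers (L : List (ℕ × ℕ)) (e : ℕ × ℕ) : Prop := e = (0, 0) ∨ ∃ e' ∈ L, SameMod e e'

theorem Covers.mono {L L' : List (ℕ × ℕ)} {e : ℕ × ℕ} (h : Covers L e) (hL : L ⊆ L') :
    Covers L' e := h.imp_right fun ⟨e', h1, h2⟩ => ⟨e', hL h1, h2⟩

theorem ifSame_spec (c q c' q' : ℕ) : (SameMod (c, q) (c', q') ∧ ∀ x y, ifSame c q c' q' x y = x) ∨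
    ∀ x y, ifSame c q c' q' x y = y := by
  simp only [ifSame]
  rcases h1 : Nat.beq c c' with _ | _ <;> simp only [sel_false, sel_true]
  · rcases h2 : Nat.beq c (Nat.shiftLeft c' 48) with _ | _ <;> simp only [sel_false, sel_true]
    · rcases h3 : Nat.beq c' (Nat.shiftLeft c 48) with _ | _ <;> simp only [sel_false, sel_true]
      · exact Or.inr fun _ _ => trivial
      · rcases h4 : Nat.beq q' (Nat.shiftLeft q 48) with _ | _ <;> simp only [sel_false, sel_true]
        · exact Or.inr fun _ _ => trivial
        · exact Or.inl ⟨Or.inr (Or.inr (Prod.ext (Nat.eq_of_beq_eq_true h3)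
            (Nat.eq_of_beq_eq_true h4))), fun _ _ => trivial⟩
    · rcases h4 : Nat.beq q (Nat.shiftLeft q' 48) with _ | _ <;> simp only [sel_false, sel_true]
      · exact Or.inr fun _ _ => trivial
      · exact Or.inl ⟨Or.inr (Or.inl (Prod.ext (Nat.eq_of_beq_eq_true h2)
          (Nat.eq_of_beq_eq_true h4))), fun _ _ => trivial⟩
  · rcases h4 : Nat.beq q q' with _ | _ <;> simp only [sel_false, sel_true]
    · exact Or.inr fun _ _ => trivial
    · exact Or.inl ⟨Or.inl (Prod.ext (Nat.eq_of_beq_eq_true h1)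
        (Nat.eq_of_beq_eq_true h4)), fun _ _ => trivial⟩

theorem ifMem_spec (c q : ℕ) (L : List (ℕ × ℕ)) :
    ((∃ e ∈ L, SameMod (c, q) e) ∧ ∀ x y, ifMem c q L x y = x) ∨ ∀ x y, ifMem c q L x y = y := by
  induction L with
  | nil => exact Or.inr fun _ _ => rfl
  | cons e L ih =>
    have hs : ∀ x y, ifMem c q (e :: L) x y = ifSame c q e.1 e.2 x (ifMem c q L x y) :=
      fun _ _ => rfl
    simp only [hs]
    rcases ifSame_spec c q e.1 e.2 with ⟨h, h'⟩ | h
    · exact Or.inl ⟨⟨e, List.mem_cons_self, h⟩, fun x y => h' _ _⟩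
    · simp only [h]
      exact ih.imp_left fun ⟨⟨e', h1, h2⟩, h3⟩ => ⟨⟨e', List.mem_cons_of_mem _ h1, h2⟩, h3⟩

theorem insertK_spec (c q : ℕ) (acc : List (ℕ × ℕ)) : ∃ L, (∀ k, insertK c q acc k = k L) ∧
    acc ⊆ L ∧ Covers L (c, q) ∧ ∀ e ∈ L, e ∈ acc ∨ e = (c, q) := by
  simp only [insertK, ifZero_eq]
  by_cases h0 : Nat.lor c q = 0
  · obtain ⟨rfl, rfl⟩ : c = 0 ∧ q = 0 := Nat.or_eq_zero_iff.1 h0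
    exact ⟨acc, fun _ => if_pos h0, fun _ h => h, Or.inl rfl, fun e he => Or.inl he⟩
  · rcases ifMem_spec c q acc with ⟨h1, h2⟩ | h
    · exact ⟨acc, fun k => (if_neg h0).trans (h2 _ _), fun _ h => h, Or.inr h1,
        fun e he => Or.inl he⟩
    · exact ⟨(c, q) :: acc, fun k => (if_neg h0).trans (h _ _), List.subset_cons_self _ _,
        Or.inr ⟨_, List.mem_cons_self, Or.inl rfl⟩, fun e he => (List.mem_cons.1 he).symm⟩

/-- The functional that corresponds to `C`, one step earlier. -/
def pull (F G C : ℕ) : ℕ × ℕ := (pullC F G C, pullQ F G C)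

theorem pullK_spec (F G C : ℕ) (acc : List (ℕ × ℕ)) :
    ∃ L, (∀ k, pullK (fixedCells F G) (nonlinearCells F G) G C acc k = k L) ∧
      acc ⊆ L ∧ Covers L (pull F G C) ∧ ∀ e ∈ L, e ∈ acc ∨ e = pull F G C :=
  insertK_spec _ _ acc

theorem pullBitsK_spec (F G fuel b : ℕ) (acc : List (ℕ × ℕ)) :
    (∀ k, pullBitsK (fixedCells F G) (nonlinearCells F G) G fuel b acc k = 0) ∨
    ∃ L, (∀ k, pullBitsK (fixedCells F G) (nonlinearCells F G) G fuel b acc k = k L) ∧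
      acc ⊆ L ∧ (∀ i, b.testBit i = true → Covers L (pull F G (2 ^ i))) ∧
      ∀ e ∈ L, e ∈ acc ∨ ∃ i, b.testBit i = true ∧ e = pull F G (2 ^ i) := by
  induction fuel generalizing b acc with
  | zero => exact Or.inl fun _ => rfl
  | succ fuel ih =>
    have hs : ∀ k, pullBitsK (fixedCells F G) (nonlinearCells F G) G (fuel + 1) b acc k =
      ifZero b (k acc) (pullK (fixedCells F G) (nonlinearCells F G) G (2 ^ Nat.log2 b) acc
        fun acc => pullBitsK (fixedCells F G) (nonlinearCells F G) G fuel
          (Nat.xor b (2 ^ Nat.log2 b)) acc k) := fun _ => rfl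
    simp only [hs, ifZero_eq]
    by_cases hb : b = 0
    · refine Or.inr ⟨acc, fun _ => if_pos hb, fun _ h => h, fun i hi => ?_, fun e he => Or.inl he⟩
      rw [hb, Nat.zero_testBit] at hi; exact absurd hi (by decide)
    obtain ⟨L, h1, h2, h3, h4⟩ := pullK_spec F G (2 ^ Nat.log2 b) acc
    have hlog := Nat.testBit_log2 hb
    simp only [if_neg hb, h1]
    refine (ih (Nat.xor b (2 ^ Nat.log2 b)) L).imp_right fun ⟨L', g1, g2, g3, g4⟩ =>
      ⟨L', g1, List.Subset.trans h2 g2, fun i hi => ?_, fun e he => ?_⟩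
    · by_cases hi' : Nat.log2 b = i
      · rw [← hi']; exact h3.mono g2
      · refine g3 i ?_
        rw [testBit_nxor, hi, Nat.testBit_two_pow, decide_eq_false hi']; rfl
    · rcases g4 e he with h | ⟨i, hi, rfl⟩
      · exact (h4 e h).imp_right fun h => ⟨_, hlog, h⟩
      · refine Or.inr ⟨i, ?_, rfl⟩
        rw [testBit_nxor, Nat.testBit_two_pow] at hi
        by_cases hi' : Nat.log2 b = i
        · rw [← hi']; exact hlog
        · rwa [decide_eq_false hi', Bool.xor_false] at hi

/-- The nonlinear cells of `e` that meet a zero triple of `G`, and their neighbours. -/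
def badCells (G : ℕ) (e : ℕ × ℕ) : ℕ :=
  let b := diff e.2 (tripleNz G)
  Nat.lor b (Nat.lor (Nat.shiftLeft b 1) (Nat.shiftRight b 1))

theorem pullAllK_spec (F G : ℕ) (L acc : List (ℕ × ℕ)) :
    (∀ k, pullAllK (fixedCells F G) (nonlinearCells F G) (tripleNz G) G L acc k = 0) ∨
    ∃ L', (∀ k, pullAllK (fixedCells F G) (nonlinearCells F G) (tripleNz G) G L acc k = k L') ∧
      acc ⊆ L' ∧ (∀ e ∈ L, Covers L' (pull F G e.1) ∧
        ∀ i, (badCells G e).testBit i = true → Covers L' (pull F G (2 ^ i))) ∧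
      ∀ e' ∈ L', e' ∈ acc ∨ ∃ e ∈ L, e' = pull F G e.1 ∨
        ∃ i, (badCells G e).testBit i = true ∧ e' = pull F G (2 ^ i) := by
  induction L generalizing acc with
  | nil =>
    exact Or.inr ⟨acc, fun _ => rfl, fun _ h => h, fun e he => absurd he List.not_mem_nil,
      fun e he => Or.inl he⟩
  | cons e L ih =>
    have hs : ∀ k, pullAllK (fixedCells F G) (nonlinearCells F G) (tripleNz G) G (e :: L) acc k =
      pullK (fixedCells F G) (nonlinearCells F G) G e.1 acc fun acc =>
        ifZero (diff e.2 (tripleNz G))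
          (pullAllK (fixedCells F G) (nonlinearCells F G) (tripleNz G) G L acc k)
          (pullBitsK (fixedCells F G) (nonlinearCells F G) G 200 (badCells G e) acc fun acc =>
            pullAllK (fixedCells F G) (nonlinearCells F G) (tripleNz G) G L acc k) := fun _ => rfl
    obtain ⟨L₁, h1, h2, h3, h4⟩ := pullK_spec F G e.1 acc
    simp only [hs, h1, ifZero_eq]
    have main : ∀ L₂ : List (ℕ × ℕ), L₁ ⊆ L₂ →
        (∀ i, (badCells G e).testBit i = true → Covers L₂ (pull F G (2 ^ i))) →
        (∀ e' ∈ L₂, e' ∈ L₁ ∨ ∃ i, (badCells G e).testBit i = true ∧ e' = pull F G (2 ^ i)) →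
        (∀ k, pullAllK (fixedCells F G) (nonlinearCells F G) (tripleNz G) G L L₂ k = 0) ∨
        ∃ L', (∀ k, pullAllK (fixedCells F G) (nonlinearCells F G) (tripleNz G) G L L₂ k = k L') ∧
          acc ⊆ L' ∧ (∀ e' ∈ e :: L, Covers L' (pull F G e'.1) ∧
            ∀ i, (badCells G e').testBit i = true → Covers L' (pull F G (2 ^ i))) ∧
          ∀ e' ∈ L', e' ∈ acc ∨ ∃ e'' ∈ e :: L, e' = pull F G e''.1 ∨
            ∃ i, (badCells G e'').testBit i = true ∧ e' = pull F G (2 ^ i) := by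
      intro L₂ k1 k2 k3
      refine (ih L₂).imp_right fun ⟨L', g1, g2, g3, g4⟩ =>
        ⟨L', g1, List.Subset.trans (List.Subset.trans h2 k1) g2, fun e' he' => ?_, fun e' he' => ?_⟩
      · rcases List.mem_cons.1 he' with rfl | he'
        · exact ⟨h3.mono (List.Subset.trans k1 g2), fun i hi => (k2 i hi).mono g2⟩
        · exact g3 e' he'
      · rcases g4 e' he' with h | ⟨e'', h, h'⟩
        · rcases k3 e' h with h | h
          · exact (h4 e' h).imp_right fun h => ⟨e, List.mem_cons_self, Or.inl h⟩
          · exact Or.inr ⟨e, List.mem_cons_self, Or.inr h⟩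
        · exact Or.inr ⟨e'', List.mem_cons_of_mem _ h, h'⟩
    by_cases hb : diff e.2 (tripleNz G) = 0
    · simp only [if_pos hb]
      refine main L₁ (fun _ h => h) (fun i hi => ?_) fun _ h => Or.inl h
      rw [badCells, hb] at hi
      simp at hi
    · simp only [if_neg hb]
      rcases pullBitsK_spec F G 200 (badCells G e) L₁ with h | ⟨L₂, k1, k2, k3, k4⟩
      · exact Or.inl fun _ => h _
      · simp only [k1]
        exact main L₂ k2 k3 k4

/-! ### Functionals determine the state -/

/-- The functionals of `L` at `p`, and their translates by multiples of `48`, agree. -/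
def Agree (L : List (ℕ × ℕ)) (p : ℤ) (s s' : ℤ → ZMod 2) : Prop :=
  ∀ e ∈ L, ∀ j : ℤ, val e.1 e.2 (p + 48 * j) s = val e.1 e.2 (p + 48 * j) s'

theorem Agree.of_covers {L : List (ℕ × ℕ)} {p : ℤ} {s s' : ℤ → ZMod 2} (h : Agree L p s s')
    {e : ℕ × ℕ} (he : Covers L e) (j : ℤ) :
    val e.1 e.2 (p + 48 * j) s = val e.1 e.2 (p + 48 * j) s' := by
  rcases he with rfl | ⟨e', he', rfl | rfl | rfl⟩
  · rfl
  · exact h e he' j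
  · have := h e' he' (j + 1)
    rw [show p + 48 * (j + 1) = p + 48 * j + (48 : ℕ) by push_cast; ring] at this
    simp only [val_shiftLeft]
    exact this
  · have := h _ he' (j - 1)
    simp only [val_shiftLeft] at this
    rwa [show p + 48 * (j - 1) + (48 : ℕ) = p + 48 * j by push_cast; ring] at this

theorem validC_two_pow {i w : ℕ} (h1 : 1 ≤ i) (h2 : i + 1 < w) : ValidC (2 ^ i) w := by
  intro j hj
  rw [Nat.testBit_two_pow, decide_eq_true_eq] at hj
  exact hj ▸ ⟨h1, h2⟩

theorem agree_occStep {F G w : ℕ} {p : ℤ} {f g s s' : ℤ → ZMod 2} {L L' : List (ℕ × ℕ)}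
    (hF : Win F w p f) (hG : Win G (w + 2) (p - 1) g) (hfg : addStep g = f)
    (hf : ∀ x, f (x + 48) = f x) (hg : ∀ x, g (x + 48) = g x)
    (hL : ∀ e ∈ L, ValidC e.1 w ∧ ValidQ e.2 w p f)
    (hL' : ∀ e ∈ L, Covers L' (pull F G e.1) ∧
      ∀ i, (badCells G e).testBit i = true → Covers L' (pull F G (2 ^ i)))
    (hs : Dominates s g) (hs' : Dominates s' g) (h : Agree L' (p - 1) s s') :
    Agree L p (occStep f s) (occStep f s') := by
  intro e he j
  have pf : ∀ x, f (x + 48 * j) = f x := fun x => by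
    rw [mul_comm]; exact Function.Periodic.int_mul (f := f) (c := 48) hf j x
  have pg : ∀ x, g (x + 48 * j) = g x := fun x => by
    rw [mul_comm]; exact Function.Periodic.int_mul (f := g) (c := 48) hg j x
  have hF' := hF.translate pf
  have hG' := hG.translate pg
  rw [show p - 1 + 48 * j = p + 48 * j - 1 by ring] at hG'
  have hQ := (hL e he).2.translate pf
  have h' : ∀ C, Covers L' (pull F G C) → val (pullC F G C) (pullQ F G C) (p + 48 * j - 1) s =
      val (pullC F G C) (pullQ F G C) (p + 48 * j - 1) s' := fun C hC => by
    have := h.of_covers hC j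
    rwa [show p - 1 + 48 * j = p + 48 * j - 1 by ring] at this
  have hlin : ∀ C, ValidC C w → Covers L' (pull F G C) →
      ev C (fun i => occStep f s (p + 48 * j + i)) =
        ev C (fun i => occStep f s' (p + 48 * j + i)) := fun C hC hcov => by
    rw [ev_occStep hF' hG' hfg hs hC, ev_occStep hF' hG' hfg hs' hC, h' C hcov]
  obtain ⟨hcov, hbad⟩ := hL' e he
  rw [val, val, hlin _ (hL e he).1 hcov]
  congr 1
  refine ev_congr fun i hi => ?_
  -- Either both products vanish, or their three cells are determined by functionals that were added
  -- to `L'`.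
  by_cases hnz : (tripleNz G).testBit i = true
  · rw [ev_triple_occStep hG' hfg hs hQ hi hnz, ev_triple_occStep hG' hfg hs' hQ hi hnz]
  · have hb : (diff e.2 (tripleNz G)).testBit i = true := by
      rw [testBit_diff, hi]; simpa using hnz
    obtain ⟨h1, h2, -⟩ := hQ i hi
    obtain ⟨n, rfl⟩ : ∃ n, i = n + 1 := ⟨i - 1, by omega⟩
    have cell : ∀ m : ℕ, 1 ≤ m → m + 1 < w → (badCells G e).testBit m = true →
        occStep f s (p + 48 * j + m) = occStep f s' (p + 48 * j + m) := fun m k1 k2 k3 => by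
      have := hlin (2 ^ m) (validC_two_pow k1 k2) (hbad m k3)
      rwa [ev_two_pow, ev_two_pow] at this
    have c0 := cell n (by omega) (by omega) (by
      rw [badCells, testBit_nlor, testBit_nlor, testBit_nshiftRight, add_comm 1, hb]; simp)
    have c1 := cell (n + 1) (by omega) (by omega) (by
      rw [badCells, testBit_nlor, hb]; rfl)
    have c2 := cell (n + 2) (by omega) (by omega) (by
      rw [badCells, testBit_nlor, testBit_nlor, testBit_nshiftLeft_add, hb]; simp)
    rw [triple, triple, c1, show p + 48 * j + ((n + 1 : ℕ) : ℤ) - 1 = p + 48 * j + n by push_cast; ring,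
      show p + 48 * j + ((n + 1 : ℕ) : ℤ) + 1 = p + 48 * j + (n + 2 : ℕ) by push_cast; ring, c0, c2]

/-- The functionals `L` of the row `f` with code `F` determine the state `m` steps later. -/
structure SearchState (m F : ℕ) (L : List (ℕ × ℕ)) (f : ℤ → ZMod 2) : Prop where
  eq_zero : addStep^[m] f = 0
  win : Win F (50 + 2 * m) (-(m + 1)) f
  valid : ∀ e ∈ L, ValidC e.1 (50 + 2 * m) ∧ ValidQ e.2 (50 + 2 * m) (-(m + 1)) f
  determines : ∀ s s', Dominates s f → Dominates s' f → Agree L (-(m + 1)) s s' →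
    occAfter m f s = occAfter m f s'

theorem child_spec {m F G : ℕ} {L : List (ℕ × ℕ)} {f g : ℤ → ZMod 2} (h : SearchState m F L f)
    (hm : m < 16) (hfg : addStep g = f) (hG : Win G (50 + 2 * m + 2) (-(m + 1) - 1) g) :
    (∀ rec, child rec F L G = 0) ∨
      ∃ L', (∀ rec, child rec F L G = rec G L') ∧ SearchState (m + 1) G L' g := by
  have e : ∀ rec, child rec F L G = pullAllK (fixedCells F G) (nonlinearCells F G) (tripleNz G) G L []
    fun L' => rec G L' := fun _ => rfl
  simp only [e]
  refine (pullAllK_spec F G L []).imp (fun h _ => h _) fun ⟨L', h1, _, h3, h4⟩ =>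
    ⟨L', fun _ => h1 _, ?_⟩
  have hg0 : addStep^[m + 1] g = 0 := by rw [Function.iterate_succ_apply, hfg]; exact h.eq_zero
  have hp : -((m : ℤ) + 1) - 1 = -((m + 1 : ℕ) + 1) := by push_cast; ring
  have hpull : ∀ C, ValidC C (50 + 2 * m) → ValidC (pull F G C).1 (50 + 2 * (m + 1)) ∧
      ValidQ (pull F G C).2 (50 + 2 * (m + 1)) (-((m + 1 : ℕ) + 1)) g := fun C hC =>
    ⟨validC_pullC hC, hp ▸ validQ_pullQ h.win hG hfg hC⟩
  refine ⟨hg0, hp ▸ hG, fun e' he' => ?_, fun s s' hs hs' hag => ?_⟩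
  · rcases h4 e' he' with h' | ⟨e, he, rfl | ⟨i, hi, rfl⟩⟩
    · exact absurd h' List.not_mem_nil
    · exact hpull _ (h.valid e he).1
    · refine hpull _ ?_
      have hq := (h.valid e he).2
      rw [badCells, testBit_nlor, testBit_nlor, testBit_nshiftRight, testBit_nshiftLeft,
        testBit_diff, testBit_diff, testBit_diff] at hi
      simp only [Bool.or_eq_true, Bool.and_eq_true, decide_eq_true_eq] at hi
      rcases hi with hi | hi | hi
      · have := hq i hi.1; exact validC_two_pow (by omega) (by omega)
      · have := hq _ hi.2.1; exact validC_two_pow (by omega) (by omega)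
      · have := hq _ hi.1; exact validC_two_pow (by omega) (by omega)
  · rw [occAfter_succ', occAfter_succ', hfg]
    exact h.determines _ _ (dominates_occStep f s) (dominates_occStep f s')
      (agree_occStep h.win hG hfg (periodic_48 hm.le h.eq_zero) (periodic_48 hm hg0) h.valid h3
        hs hs' (hp ▸ hag))

/-! ### Counting the ancestors that lead to the ethers -/

def GoodClass (W : Finset ℕ) (m : ℕ) (f : ℤ → ZMod 2) : Prop := ∃ k ∈ W, GoodFor (ether k) m f

theorem GoodClass.shift {W : Finset ℕ} {m : ℕ} (c : ℤ) (f : ℤ → ZMod 2) (h : GoodClass W m f) :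
    GoodClass W m (shift c f) := by
  obtain ⟨k, hk, h⟩ := h
  exact ⟨k, hk, h.shift c⟩

/-- The number of good ancestors of `f`, summed over the number of steps that are left if `f`
appears in the level `m + j`. -/
noncomputable def goodCount (W : Finset ℕ) (m : ℕ) (f : ℤ → ZMod 2) : ℕ :=
  ∑ j ∈ Finset.range 17, cnt (GoodClass W 32) (32 - m - j) f

/-- This is `(4 ^ 17 - 1) / 3`. -/
def weight : ℕ := 5726623061

theorem weight_eq : ∑ j ∈ Finset.range 17, 4 ^ (16 - j) = weight := by decide +kernel

theorem goodCount_shift (W : Finset ℕ) (m : ℕ) (c : ℤ) (f : ℤ → ZMod 2) :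
    goodCount W m (shift c f) = goodCount W m f :=
  Finset.sum_congr rfl fun _ _ => cnt_shift GoodClass.shift c _ _

/-- All ancestors of a good row are good, and a row has `4 ^ (16 - j)` of them `16 - j` steps back.
Such an ancestor leads to the ether `j` steps earlier than required, which does no harm, because the
ether persists. -/
theorem weight_mul_cnt_le {W : Finset ℕ} (hW : W ⊆ Finset.range 14) {m : ℕ} (hm : m ≤ 16)
    {f : ℤ → ZMod 2} {X : (ℤ → ZMod 2) → Prop}
    (h : ∀ u, addStep^[16 - m] u = f → X u → GoodClass W 16 u) :
    weight * cnt X (16 - m) f ≤ goodCount W m f := by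
  rw [← weight_eq, Finset.sum_mul, goodCount]
  refine Finset.sum_le_sum fun j hj => ?_
  have hj' : j < 17 := Finset.mem_range.1 hj
  rw [mul_comm, show 32 - m - j = (16 - m) + (16 - j) by omega]
  refine cnt_mul_le fun u hu hX g hg => ?_
  obtain ⟨k, hk, hgood⟩ := h u hu hX
  exact ⟨k, hk, (hgood.of_iterate hg).mono (isHistory_ether (Finset.mem_range.1 (hW hk))) (by omega)⟩

theorem goodCount_succ {m : ℕ} (hm : m ≤ 15) {f : ℤ → ZMod 2} {g : ℕ → ℤ → ZMod 2}
    (hg : ∀ P k, cnt P (k + 1) f = cnt P k (g 0) + cnt P k (g 1) + (cnt P k (g 2) + cnt P k (g 3)))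
    (W : Finset ℕ) : goodCount W m f = goodCount W (m + 1) (g 0) + goodCount W (m + 1) (g 1) +
      (goodCount W (m + 1) (g 2) + goodCount W (m + 1) (g 3)) := by
  simp only [goodCount, ← Finset.sum_add_distrib]
  refine Finset.sum_congr rfl fun j hj => ?_
  have hj' : j < 17 := Finset.mem_range.1 hj
  rw [show 32 - m - j = 32 - (m + 1) - j + 1 by omega, hg]

/-- The digits of `N` to the base `2 ^ 40` are lower bounds for the numbers of ancestors that lead
to the ethers. -/
def Cert (m : ℕ) (f : ℤ → ZMod 2) (N : ℕ) : Prop :=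
  ∃ d : ℕ → ℕ, N = ∑ k ∈ Finset.range 16, place k (d k) ∧
    ∀ W ⊆ Finset.range 14, weight * ∑ k ∈ W, d k ≤ goodCount W m f

theorem place_add (k a b : ℕ) : place k (a + b) = place k a + place k b := Nat.add_mul _ _ _

theorem place_zero (k : ℕ) : place k 0 = 0 := Nat.zero_mul _

theorem cert_zero (m : ℕ) (f : ℤ → ZMod 2) : Cert m f 0 :=
  ⟨0, by simp [place_zero], fun W _ => by simp⟩

theorem sum_place_single {c : ℕ} (hc : c < 16) (a : ℕ) :
    ∑ k ∈ Finset.range 16, place k (Pi.single (M := fun _ => ℕ) c a k) = place c a := by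
  rw [Finset.sum_eq_single c]
  · rw [Pi.single_eq_same]
  · intro k _ hk; rw [Pi.single_eq_of_ne hk, place_zero]
  · intro h; exact absurd (Finset.mem_range.2 hc) h

/-- The conditions must exclude each other, since the counts are added, also when `c₀ = c₁`. -/
theorem cert_two {m c₀ c₁ a b : ℕ} (hm : m ≤ 16) (hc₀ : c₀ < 16) (hc₁ : c₁ < 16)
    {f : ℤ → ZMod 2} {X₀ X₁ : (ℤ → ZMod 2) → Prop}
    (hX : ∀ u, addStep^[16 - m] u = f → X₀ u → ¬ X₁ u)
    (ha : a ≤ cnt X₀ (16 - m) f) (hb : b ≤ cnt X₁ (16 - m) f)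
    (h₀ : c₀ < 14 → ∀ u, addStep^[16 - m] u = f → X₀ u → GoodFor (ether c₀) 16 u)
    (h₁ : c₁ < 14 → ∀ u, addStep^[16 - m] u = f → X₁ u → GoodFor (ether c₁) 16 u) :
    Cert m f (place c₀ a + place c₁ b) := by
  classical
  refine ⟨Pi.single c₀ a + Pi.single c₁ b, ?_, fun W hW => ?_⟩
  · simp only [Pi.add_apply, place_add, Finset.sum_add_distrib, sum_place_single hc₀,
      sum_place_single hc₁]
  · have hlt : ∀ c ∈ W, c < 14 := fun c hc => Finset.mem_range.1 (hW hc)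
    have key := weight_mul_cnt_le hW hm (f := f)
      (X := fun u => (c₀ ∈ W ∧ X₀ u) ∨ (c₁ ∈ W ∧ X₁ u)) (by
        rintro u hu (⟨hc, h⟩ | ⟨hc, h⟩)
        · exact ⟨c₀, hc, h₀ (hlt _ hc) u hu h⟩
        · exact ⟨c₁, hc, h₁ (hlt _ hc) u hu h⟩)
    rw [cnt_or fun u hu h h' => hX u hu h.2 h'.2] at key
    refine le_trans (Nat.mul_le_mul_left _ ?_) key
    simp only [Pi.add_apply, Finset.sum_add_distrib]
    have hs : ∀ c a : ℕ, ∑ k ∈ W, Pi.single (M := fun _ => ℕ) c a k = if c ∈ W then a else 0 :=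
      fun c a => Finset.sum_pi_single' c a W
    rw [hs, hs]
    refine add_le_add ?_ ?_
    · split_ifs with hc
      · exact ha.trans (cnt_mono fun u _ h => ⟨hc, h⟩)
      · exact Nat.zero_le _
    · split_ifs with hc
      · exact hb.trans (cnt_mono fun u _ h => ⟨hc, h⟩)
      · exact Nat.zero_le _

theorem cert_four {m : ℕ} {f : ℤ → ZMod 2} {g : ℕ → ℤ → ZMod 2} {N : ℕ → ℕ}
    (h : ∀ W, goodCount W m f = goodCount W (m + 1) (g 0) + goodCount W (m + 1) (g 1) +
      (goodCount W (m + 1) (g 2) + goodCount W (m + 1) (g 3)))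
    (hN : ∀ i < 4, Cert (m + 1) (g i) (N i)) : Cert m f (N 0 + N 1 + (N 2 + N 3)) := by
  obtain ⟨d0, e0, k0⟩ := hN 0 (by norm_num)
  obtain ⟨d1, e1, k1⟩ := hN 1 (by norm_num)
  obtain ⟨d2, e2, k2⟩ := hN 2 (by norm_num)
  obtain ⟨d3, e3, k3⟩ := hN 3 (by norm_num)
  refine ⟨fun k => d0 k + d1 k + (d2 k + d3 k), ?_, fun W hW => ?_⟩
  · simp only [place_add, Finset.sum_add_distrib, ← e0, ← e1, ← e2, ← e3]
  · rw [h W]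
    simp only [Finset.sum_add_distrib, Nat.mul_add]
    exact add_le_add (add_le_add (k0 W hW) (k1 W hW)) (add_le_add (k2 W hW) (k3 W hW))

theorem classOf_lt (s : ℕ) : classOf s < 16 := by
  simp only [classOf]
  rcases Nat.beq _ _ with _ | _
  · rw [sel_false]; norm_num
  · rw [sel_true]; exact Nat.lt_of_le_of_lt Nat.and_le_left (by norm_num)

/-! ### Nodes with at most one live functional -/

theorem occAfter_add (k m : ℕ) (u s : ℤ → ZMod 2) :
    occAfter (k + m) u s = occAfter m (addStep^[k] u) (occAfter k u s) := by
  induction m with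
  | zero => rfl
  | succ m ih =>
    rw [← add_assoc, occAfter, ih, occAfter, ← Function.iterate_add_apply,
      show m + 1 + k = k + m + 1 by ring]

/-- If all states that are reached at `f` lead to the same state as `r`, then the class of the
latter is the ether of `u`. -/
theorem goodFor_of_reference {m N : ℕ} (hm : m ≤ 16) {f u r : ℤ → ZMod 2} {rows : List ℕ}
    (hf : addStep^[m] f = 0) (hr : RowsOK m f rows) (hu : addStep^[16 - m] u = f)
    (hN : ∀ i : ℕ, 1 ≤ i → i < 49 + 2 * m → dig N i = r (-(m + 1) + i))
    (h : ∀ s, Dominates s u → occAfter m f (occAfter (16 - m) u s) = occAfter m f r)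
    (hc : classOf (fwd rows N) < 14) : GoodFor (ether (classOf (fwd rows N))) 16 u := by
  have e : 16 = 16 - m + m := by omega
  refine goodFor_classOf le_rfl (b := occAfter m f r) ?_ (fun s hs => ?_)
    (fun i h1 h2 => dig_fwd rows hr hN h1 h2) hc
  · rw [e, add_comm, Function.iterate_add_apply, hu, hf]
  · rw [e, occAfter_add, hu, h s hs]

theorem val_shift (C Q : ℕ) (p c : ℤ) (s : ℤ → ZMod 2) : val C Q p (shift c s) = val C Q (p + c) s := by
  have e1 : ∀ i : ℕ, p + c + (i : ℤ) = p + i + c := fun i => by ring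
  have e2 : ∀ i : ℕ, p + i + c - 1 = p + i - 1 + c := fun i => by ring
  have e3 : ∀ i : ℕ, p + i + c + 1 = p + i + 1 + c := fun i => by ring
  simp only [val, triple, shift, e1, e2, e3]

theorem ConstVal.translate {k C Q : ℕ} {p c : ℤ} {σ : ZMod 2} {u : ℤ → ZMod 2}
    (h : ConstVal k C Q p σ u) (hu : shift c u = u) : ConstVal k C Q (p + c) σ u := by
  intro s hs
  have := h (shift c s) (hu ▸ hs.shift c)
  rw [← val_shift, ← occAfter_shift, hu, this]

section reference

variable {m C Q F : ℕ} {p : ℤ} {f : ℤ → ZMod 2}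

theorem val_self {w : ℕ} (hF : Win F w p f) (hC : ValidC C w) (hQ : ValidQ Q w p f)
    (hCF : Nat.land C F = 0) : val C Q p f = 0 := by
  rw [val, ev_eq_zero, ev_eq_zero, add_zero]
  · intro i hi
    obtain ⟨-, -, -, -, h, -⟩ := hQ i hi
    rw [triple, h, mul_zero, zero_mul]
  · intro i hi
    rw [← hF i (by have := (hC i hi).2; omega)]
    refine dig_eq_zero ?_
    have := testBit_nland C F i
    rwa [hCF, hi, Bool.true_and, Nat.zero_testBit, eq_comm] at this

/-- `f` with the additional occupied cells `≡ y` modulo `48`. -/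
def occupy (y : ℤ) (f : ℤ → ZMod 2) : ℤ → ZMod 2 := fun x => if (x - y) % 48 = 0 then 1 else f x

theorem dominates_occupy (y : ℤ) (f : ℤ → ZMod 2) : Dominates (occupy y f) f := fun x hx => by
  rw [occupy]; split_ifs <;> [rfl; exact hx]

/-- The linear part sees only the highest cell of `C`: the others miss `F` and, by `ht`, are not 48
cells below it. The products vanish, because added cells are 48 apart and cannot fill three adjacent
zeros of `f`. -/
theorem val_occupy {w : ℕ} (hw : w ≤ 90) (hF : Win F w p f) (hC : ValidC C w) (hQ : ValidQ Q w p f)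
    (hCF : Nat.land C F = 0) (hC0 : C ≠ 0)
    (ht : Nat.land C (Nat.shiftRight (2 ^ Nat.log2 C) 48) = 0) :
    val C Q p (occupy (p + Nat.log2 C) f) = 1 := by
  have hl := Nat.testBit_log2 hC0
  have hlw := (hC _ hl).2
  have hQ0 : ev Q (fun i => triple (occupy (p + Nat.log2 C) f) (p + i)) = 0 := by
    refine ev_eq_zero fun i hi => ?_
    obtain ⟨-, -, -, h1, h2, h3, -⟩ := hQ i hi
    simp only [triple, occupy, h1, h2, h3]
    split_ifs <;> first | omega | simp
  have hC1 : ∀ i, C.testBit i = true →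
      occupy (p + Nat.log2 C) f (p + i) = if i = Nat.log2 C then 1 else 0 := by
    intro i hi
    have hle := le_log2_of_testBit hi
    rw [occupy]
    by_cases h : i = Nat.log2 C
    · rw [if_pos h, if_pos (by omega)]
    · have h48 : i + 48 ≠ Nat.log2 C := fun h48 => by
        have := testBit_nland C (Nat.shiftRight (2 ^ Nat.log2 C) 48) i
        rw [ht, hi, Nat.zero_testBit, testBit_nshiftRight, Nat.testBit_two_pow,
          decide_eq_true (by omega)] at this
        exact absurd this (by decide)
      rw [if_neg h, if_neg (by omega), ← hF i (by omega)]
      refine dig_eq_zero ?_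
      have := testBit_nland C F i
      rwa [hCF, hi, Bool.true_and, Nat.zero_testBit, eq_comm] at this
  rw [val, hQ0, add_zero, ev_congr hC1]
  have h2 : ev C (fun i => if i = Nat.log2 C then (1 : ZMod 2) else 0) =
      ev (Nat.land C (2 ^ Nat.log2 C)) (fun _ => 1) := by
    rw [ev_land]
    refine ev_congr fun i _ => ?_
    rw [dig, Nat.testBit_two_pow, mul_one]
    by_cases h : i = Nat.log2 C
    · simp [h]
    · rw [if_neg h, decide_eq_false (fun h' => h h'.symm)]; rfl
  rw [h2]
  have h3 : Nat.land C (2 ^ Nat.log2 C) = 2 ^ Nat.log2 C := by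
    refine Nat.eq_of_testBit_eq fun i => ?_
    rw [testBit_nland, Nat.testBit_two_pow]
    by_cases h : Nat.log2 C = i
    · rw [← h, hl]; simp
    · simp [h]
  rw [h3, ev_two_pow]

theorem dig_occupy {l w : ℕ} (hw : w ≤ 90) (hl : l < w) (hF : Win F w p f) {i : ℕ} (hi : i < w) :
    dig (Nat.lor F (Nat.lor (Nat.shiftRight (2 ^ l) 48) (Nat.lor (2 ^ l) (Nat.shiftLeft (2 ^ l) 48))))
      i = occupy (p + l) f (p + i) := by
  rw [dig_lor, hF i hi, occupy]
  have e : dig (Nat.lor (Nat.shiftRight (2 ^ l) 48) (Nat.lor (2 ^ l) (Nat.shiftLeft (2 ^ l) 48))) i =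
      if (p + i - (p + l)) % 48 = 0 then 1 else 0 := by
    rw [dig, testBit_nlor, testBit_nlor, testBit_nshiftRight, testBit_nshiftLeft]
    simp only [Nat.testBit_two_pow, Bool.or_eq_true, Bool.and_eq_true, decide_eq_true_eq]
    congr 1
    exact propext ⟨fun h => by omega, fun h => by omega⟩
  rw [e]
  split_ifs
  · generalize f _ = x; revert x; decide
  · simp

end reference

section nodes

variable {m F : ℕ} {f : ℤ → ZMod 2} {rows : List ℕ}

theorem cert_leaf (hm : m ≤ 16) (h : SearchState m F [] f) (hr : RowsOK m f rows) :
    Cert m f (place (classOf (fwd rows F)) (4 ^ (16 - m))) := by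
  have := cert_two (b := 0) (f := f) (X₀ := fun _ => True) (X₁ := fun _ => False) hm
    (classOf_lt (fwd rows F)) (classOf_lt 0) (fun _ _ _ h => h)
    (cnt_of_forall fun _ _ => trivial).ge (Nat.zero_le _)
    (fun hc u hu _ => goodFor_of_reference hm h.eq_zero hr hu
      (fun i h1 h2 => h.win i (by omega)) (fun s hs => h.determines _ _ (by
        have := dominates_occAfter hs (16 - m)
        rwa [hu] at this) (dominates_self f) fun e he => absurd he List.not_mem_nil) hc)
    (fun _ _ _ h => h.elim)
  rwa [place_zero, add_zero] at this

/-- If the surviving functional is constant, its value determines the final state, which can then be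
computed from any reference state with that value: `f` itself for the value 0, and `occupy _ f` for
the value 1. Translates of the functional by multiples of 48 take the same value, since the ancestor
has period 48. -/
theorem cert_single {C Q : ℕ} (hm : m ≤ 16) (h : SearchState m F [(C, Q)] f) (hr : RowsOK m f rows) :
    Cert m f (single m C Q F rows) := by
  obtain ⟨hC, hQ⟩ := h.valid _ (List.mem_singleton.2 rfl)
  have hper := periodic_48 hm h.eq_zero
  have hper' : ∀ (j : ℤ) x, f (x + 48 * j) = f x := fun j x => by
    rw [mul_comm]; exact Function.Periodic.int_mul (f := f) (c := 48) hper j x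
  have main : ∀ (σ : ZMod 2) (r : ℤ → ZMod 2) (N : ℕ), Dominates r f →
      (∀ j : ℤ, val C Q (-(m + 1) + 48 * j) r = σ) →
      (∀ i : ℕ, 1 ≤ i → i < 49 + 2 * m → dig N i = r (-(m + 1) + i)) →
      classOf (fwd rows N) < 14 → ∀ u, addStep^[16 - m] u = f →
      ConstVal (16 - m) C Q (-(m + 1)) σ u → GoodFor (ether (classOf (fwd rows N))) 16 u := by
    intro σ r N hrf hval hN hc u hu hX
    have hd : ∀ s, Dominates s u → Dominates (occAfter (16 - m) u s) f := fun s hs => by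
      have := dominates_occAfter hs (16 - m)
      rwa [hu] at this
    refine goodFor_of_reference hm h.eq_zero hr hu hN
      (fun s hs => h.determines _ _ (hd s hs) hrf fun e he j => ?_) hc
    rw [List.mem_singleton.1 he, hval]
    refine hX.translate ?_ s hs
    have hu0 : addStep^[16] u = 0 := by
      rw [show 16 = m + (16 - m) by omega, Function.iterate_add_apply, hu, h.eq_zero]
    funext x
    rw [shift_apply, mul_comm]
    exact Function.Periodic.int_mul (f := u) (c := 48) (periodic_48 le_rfl hu0) j x
  have hs : single m C Q F rows = norm C Q F (50 + 2 * m) fun C' Q' F' w' =>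
    ifZero (Nat.land C F)
      (ifZero (locCount (16 - m) C' Q' F' w' 0) 0
          (place (classOf (fwd rows F)) (locCount (16 - m) C' Q' F' w' 0)) +
        ifZero (locCount (16 - m) C' Q' F' w' 1) 0
          (ifZero C 0 (ifZero (Nat.land C (Nat.shiftRight (2 ^ Nat.log2 C) 48))
            (place (classOf (fwd rows (Nat.lor F (Nat.lor (Nat.shiftRight (2 ^ Nat.log2 C) 48)
              (Nat.lor (2 ^ Nat.log2 C) (Nat.shiftLeft (2 ^ Nat.log2 C) 48))))))
              (locCount (16 - m) C' Q' F' w' 1)) 0))) 0 := rfl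
  rw [hs]
  clear hs
  have hz : ∀ c a, ifZero a 0 (place c a) = place c a := fun c a => by
    rw [ifZero_eq]; split_ifs with h
    · rw [h, place_zero]
    · rfl
  rcases norm_spec (C := C) (Q := Q) h.win hQ _ with e | ⟨sh, C', Q', F', w', e, hc, hq, hw', hF', hC', hQ'⟩
  · rw [e]; exact cert_zero m f
  rw [e]
  clear e
  have hcv : ∀ σ, ConstVal (16 - m) C' Q' (-(m + 1) + sh) σ = ConstVal (16 - m) C Q (-(m + 1)) σ := by
    intro σ; funext u; simp only [ConstVal, hc, hq, val_shiftLeft]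
  have la := locCount_le (16 - m) (sg := 0) hF' (by omega) hC' hQ' (by norm_num)
  have lb := locCount_le (16 - m) (sg := 1) hF' (by omega) hC' hQ' (by norm_num)
  rw [hcv, Nat.cast_zero] at la
  rw [hcv, Nat.cast_one] at lb
  generalize locCount (16 - m) C' Q' F' w' 0 = a at la
  generalize locCount (16 - m) C' Q' F' w' 1 = b at lb
  by_cases hCF : Nat.land C F = 0
  swap
  · rw [ifZero_eq, if_neg hCF]; exact cert_zero m f
  rw [ifZero_eq, if_pos hCF, hz]
  have hdisj : ∀ u, addStep^[16 - m] u = f → ConstVal (16 - m) C Q (-(m + 1)) 0 u →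
      ¬ ConstVal (16 - m) C Q (-(m + 1)) 1 u := fun u _ h0 h1 =>
    absurd ((h0 u (dominates_self u)).symm.trans (h1 u (dominates_self u))) (by decide)
  have h₀ := main 0 f F (dominates_self f)
    (fun j => val_self (h.win.translate (hper' j)) hC (hQ.translate (hper' j)) hCF)
    fun i h1 h2 => h.win i (by omega)
  by_cases hyp : C ≠ 0 ∧ Nat.land C (Nat.shiftRight (2 ^ Nat.log2 C) 48) = 0
  · obtain ⟨hC0, ht⟩ := hyp
    rw [ifZero_eq C, if_neg hC0, ifZero_eq (Nat.land _ _), if_pos ht, hz]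
    have hl : Nat.log2 C + 1 < 50 + 2 * m := (hC _ (Nat.testBit_log2 hC0)).2
    refine cert_two hm (classOf_lt _) (classOf_lt _) hdisj la lb h₀
      (main 1 (occupy (-(m + 1) + Nat.log2 C) f) _ (dominates_occupy _ f) (fun j => ?_) ?_)
    · have := val_occupy (by omega) (h.win.translate (hper' j)) hC (hQ.translate (hper' j)) hCF hC0 ht
      rw [← this]
      congr 1
      funext x
      simp only [occupy]
      congr 1
      exact propext ⟨fun h => by omega, fun h => by omega⟩
    · exact fun i h1 h2 => dig_occupy (by omega) (by omega) h.win (by omega)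
  · have hz0 : ∀ x, ifZero b 0 (ifZero C 0
        (ifZero (Nat.land C (Nat.shiftRight (2 ^ Nat.log2 C) 48)) x 0)) = place 14 0 := fun x => by
      rw [place_zero, ifZero_eq, ifZero_eq, ifZero_eq]
      split_ifs with h1 h2 h3 <;> first | rfl | exact absurd ⟨h2, h3⟩ hyp
    rw [hz0]
    exact cert_two hm (classOf_lt _) (by norm_num) hdisj la (Nat.zero_le _) h₀
      fun hc => absurd hc (by norm_num)

end nodes

/-! ### Soundness of the search -/

def sum4 (f : ℕ → ℕ) : ℕ := f 0 + f 1 + (f 2 + f 3)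

/-- The values of `rec` are certificates at the nodes with level at most `16 - n`. -/
def Sound (n : ℕ) (rec : Search) : Prop := ∀ (m F : ℕ) (L : List (ℕ × ℕ)) (rows : List ℕ)
  (f : ℤ → ZMod 2), 1 ≤ m → m + n ≤ 16 → SearchState m F L f → RowsOK m f rows →
    Cert m f (rec m F L rows)

/-- The value at a node with at least two live functionals, in terms of those of the branches. -/
noncomputable def branchPart (m F : ℕ) (L : List (ℕ × ℕ)) (i : ℕ) (br : ℕ → ℕ → ℕ) : ℕ :=
  sel (longer L (limit m)) 0
    (let G₀ := Nat.land (unstep F) (mask (52 + 2 * m))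
     sel (isPre F (50 + 2 * m) G₀)
      (onDyadic m
        (let d := Nat.land 3 (Nat.xor G₀ (Nat.shiftRight G₀ (3 * m)))
         ifZero d 0 (ifZero i (2 * br G₀ 0)
           (sel (Nat.beq i 1) (2 * br G₀ (kernelCode (sel (Nat.beq d 1) 1 0))) 0)))
        (br G₀ (ifZero i 0 (kernelCode (i - 1))))) 0)

theorem part_nil (i z : ℕ) (rec : Search) (m F : ℕ) (rows : List ℕ) : part i z rec m F [] rows =
    ifZero (i + z) (place (classOf (fwd rows F)) (4 ^ (16 - m))) 0 := rfl

theorem part_single (i z : ℕ) (rec : Search) (m F : ℕ) (e : ℕ × ℕ) (rows : List ℕ) :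
    part i z rec m F [e] rows = ifZero (i + z) (single m e.1 e.2 F rows) 0 := rfl

theorem part_cons_cons (i z : ℕ) (rec : Search) (m F : ℕ) (e e' : ℕ × ℕ) (L : List (ℕ × ℕ))
    (rows : List ℕ) : part i z rec m F (e :: e' :: L) rows =
      branchPart m F (e :: e' :: L) i (branch rec m F (e :: e' :: L) rows) := rfl

theorem allParts_eq (rec : Search) : allParts rec = fun m F L rows =>
    sum4 fun i => part i 0 rec m F L rows := rfl

theorem cert_branch {n m F b : ℕ} {L : List (ℕ × ℕ)} {rows : List ℕ} {f g : ℤ → ZMod 2}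
    {rec : Search} (hrec : Sound n rec) (hmn : m + 1 + n ≤ 16) (h : SearchState m F L f)
    (hr : RowsOK m f rows) (hg : addStep g = f)
    (hG : Win (preCode F (50 + 2 * m + 2) b) (50 + 2 * m + 2) (-(m + 1) - 1) g) :
    Cert (m + 1) g (branch rec m F L rows (Nat.land (unstep F) (mask (52 + 2 * m))) b) := by
  have e : branch rec m F L rows (Nat.land (unstep F) (mask (52 + 2 * m))) b =
      child (fun G L' => rec (m + 1) G L' (F :: rows)) F L (preCode F (50 + 2 * m + 2) b) := by
    rw [preCode, show 50 + 2 * m + 2 = 52 + 2 * m by omega]; rfl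
  rw [e]
  rcases child_spec h (by omega) hg hG with h0 | ⟨L', h1, h2⟩
  · rw [h0]; exact cert_zero _ _
  · rw [h1]
    exact hrec _ _ _ _ _ (by omega) (by omega) h2 ⟨m, rfl, by rw [hg]; exact h.win, by rwa [hg]⟩

theorem onDyadic_eq (m x y : ℕ) :
    onDyadic m x y = if m = 1 ∨ m = 2 ∨ m = 4 ∨ m = 8 then x else y := by
  have e : ∀ (b c x y : ℕ), sel (Nat.beq b c) x y = if b = c then x else y := fun b c x y => by
    rcases h : Nat.beq b c with _ | _
    · rw [if_neg (Nat.ne_of_beq_eq_false h)]; rfl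
    · rw [if_pos (Nat.eq_of_beq_eq_true h)]; rfl
  simp only [onDyadic, e]
  split_ifs <;> first | rfl | omega

theorem kernelCode_periodic : ∀ m ∈ ({1, 2, 4, 8} : Finset ℕ), ∀ b < 3, ∀ i < 2,
    dig (kernelCode b) (i + 3 * m) = dig (kernelCode b) i := by
  decide +kernel

theorem dig_kernelCode : ∀ b < 3, dig (kernelCode b) 0 = (if b = 1 then 0 else 1) ∧
    dig (kernelCode b) 1 = if b = 0 then 0 else 1 := by
  decide +kernel

theorem periodic_of_dyadic {m : ℕ} (hm : m = 1 ∨ m = 2 ∨ m = 4 ∨ m = 8) {f : ℤ → ZMod 2}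
    (hf : addStep^[m] f = 0) : shift (3 * m) f = f := by
  obtain ⟨e, rfl⟩ : ∃ e, m = 2 ^ e := by
    rcases hm with rfl | rfl | rfl | rfl
    exacts [⟨0, rfl⟩, ⟨1, rfl⟩, ⟨2, rfl⟩, ⟨3, rfl⟩]
  funext x
  rw [shift_apply]; push_cast
  exact periodic_of_addStep_iterate_eq_zero hf x

/-- At a row with the period `3 m`, the translation by `3 m` permutes the preimages. -/
theorem shift_preimage {m F b c : ℕ} (hm : m = 1 ∨ m = 2 ∨ m = 4 ∨ m = 8) {f g h : ℤ → ZMod 2}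
    {p : ℤ} (hf : addStep^[m] f = 0) (hg : addStep g = f) (hh : addStep h = f)
    (hG : Win (preCode F (50 + 2 * m + 2) b) (50 + 2 * m + 2) p g)
    (hH : Win (preCode F (50 + 2 * m + 2) c) (50 + 2 * m + 2) p h)
    (hbc : ∀ i < 2, dig (unstep F) (i + 3 * m) + dig b (i + 3 * m) = dig (unstep F) i + dig c i) :
    shift (3 * m) g = h := by
  have hd : ∀ b i, i < 50 + 2 * m + 2 →
      dig (preCode F (50 + 2 * m + 2) b) i = dig (unstep F) i + dig b i :=
    fun b i hi => by rw [preCode, dig_land_mask hi, dig_xor, dig_land_mask hi]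
  have key : ∀ i : ℕ, i < 2 → g (p + i + 3 * m) = h (p + i) := fun i hi => by
    have e1 := hG (i + 3 * m) (by omega)
    have e2 := hH i (by omega)
    rw [hd _ _ (by omega)] at e1 e2
    rw [← e2, ← hbc i hi, e1]
    push_cast; congr 1; ring
  refine eq_of_addStep_eq (q := p) ?_ ?_ ?_
  · rw [addStep_shift, hg, hh, periodic_of_dyadic hm hf]
  · simpa [shift] using key 0 (by norm_num)
  · simpa [shift] using key 1 (by norm_num)

theorem land_three_xor (G k : ℕ) {d : ℕ} (hd : Nat.land 3 (Nat.xor G (Nat.shiftRight G k)) = d) :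
    d < 4 ∧ ∀ i < 2, dig G i + dig G (i + k) = dig d i := by
  subst hd
  refine ⟨Nat.lt_of_le_of_lt Nat.and_le_left (by norm_num), fun i hi => ?_⟩
  have h3 : dig 3 i = 1 := by interval_cases i <;> rfl
  rw [dig_land, h3, one_mul, dig_xor]
  congr 1
  simp only [dig, testBit_nshiftRight, add_comm]

theorem cert_two_mul {m : ℕ} {f g h : ℤ → ZMod 2} {M N : ℕ}
    (hW : ∀ W, goodCount W m f = 2 * goodCount W (m + 1) g + 2 * goodCount W (m + 1) h)
    (hM : Cert (m + 1) g M) (hN : Cert (m + 1) h N) : Cert m f (2 * M + 2 * N) := by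
  obtain ⟨d, eM, hd⟩ := hM
  obtain ⟨e, eN, he⟩ := hN
  have h2 : ∀ k a, place k (2 * a) = 2 * place k a := fun k a => by
    rw [two_mul, place_add, two_mul]
  refine ⟨fun k => 2 * d k + 2 * e k, ?_, fun W hW' => ?_⟩
  · simp only [eM, eN, place_add, h2, Finset.sum_add_distrib, Finset.mul_sum]
  · rw [hW, Finset.sum_add_distrib, ← Finset.mul_sum, ← Finset.mul_sum]
    have := hd W hW'
    have := he W hW'
    linarith

theorem sound_allParts {n : ℕ} {rec : Search} (hrec : Sound n rec) : Sound (n + 1) (allParts rec) := by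
  intro m F L rows f hm hmn h hr
  rw [allParts_eq]
  rcases L with _ | ⟨e, _ | ⟨e', L⟩⟩
  · exact cert_leaf (by omega) h hr
  · exact cert_single (by omega) h hr
  simp only [part_cons_cons, branchPart]
  generalize hL : e :: e' :: L = L' at h
  rcases longer L' (limit m) with _ | _
  swap
  · exact cert_zero m f
  simp only [sel_false]
  rcases hpre : isPre F (50 + 2 * m) (Nat.land (unstep F) (mask (52 + 2 * m))) with _ | _
  · exact cert_zero m f
  simp only [sel_true, onDyadic_eq]
  obtain ⟨g, hg, w0, wb, hcnt⟩ := exists_preimages h.win (by omega)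
    (by rw [show 50 + 2 * m + 2 = 52 + 2 * m by omega]; exact hpre)
  have hgc := goodCount_succ (m := m) (by omega) hcnt
  have c0 := cert_branch hrec (by omega) h hr (hg 0) w0
  have cb := fun b hb => cert_branch hrec (by omega) h hr (hg _) (wb b hb)
  split_ifs with hdy
  · have hu : ∀ i < 2, ∀ G, G = Nat.land (unstep F) (mask (52 + 2 * m)) →
        dig G i = dig (unstep F) i ∧ dig G (i + 3 * m) = dig (unstep F) (i + 3 * m) :=
      fun i hi G hG => by
        rw [hG]; exact ⟨dig_land_mask (by omega), dig_land_mask (by omega)⟩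
    generalize hd : Nat.land 3 (Nat.xor (Nat.land (unstep F) (mask (52 + 2 * m)))
      (Nat.shiftRight (Nat.land (unstep F) (mask (52 + 2 * m))) (3 * m))) = d
    obtain ⟨hd4, hd2⟩ := land_three_xor _ _ hd
    have hx : ∀ i < 2, dig (unstep F) (i + 3 * m) = dig (unstep F) i + dig d i := fun i hi => by
      obtain ⟨h1, h2⟩ := hu i hi _ rfl
      rw [← h1, ← h2, ← hd2 i hi, ← add_assoc, CharTwo.add_self_eq_zero, zero_add]
    have hk := fun b hb i hi => kernelCode_periodic m (by simpa using hdy) b hb i hi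
    have two : ∀ j, j < 3 → (∀ W, goodCount W m f = 2 * goodCount W (m + 1) (g 0) +
        2 * goodCount W (m + 1) (g (j + 1))) →
        Cert m f (2 * branch rec m F L' rows (Nat.land (unstep F) (mask (52 + 2 * m))) 0 +
          2 * branch rec m F L' rows (Nat.land (unstep F) (mask (52 + 2 * m))) (kernelCode j)) := by
      intro j hj hW
      exact cert_two_mul hW c0 (cb j hj)
    have mv0 : ∀ b, b < 3 → (∀ i < 2, dig (kernelCode b) i = dig d i) → ∀ W,
        goodCount W (m + 1) (g (b + 1)) = goodCount W (m + 1) (g 0) := fun b hb hbd W => by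
      rw [← shift_preimage hdy h.eq_zero (hg 0) (hg (b + 1)) w0 (wb b hb) fun i hi => by
        rw [hx i hi, hbd i hi]; simp [dig], goodCount_shift]
    have mv : ∀ b c, b < 3 → c < 3 → (∀ i < 2, dig (kernelCode c) i = dig d i + dig (kernelCode b) i) →
        ∀ W, goodCount W (m + 1) (g (c + 1)) = goodCount W (m + 1) (g (b + 1)) :=
      fun b c hb hc hbd W => by
        rw [← shift_preimage hdy h.eq_zero (hg (b + 1)) (hg (c + 1)) (wb b hb) (wb c hc)
          fun i hi => by rw [hx i hi, hbd i hi, hk b hb i hi, add_assoc], goodCount_shift]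
    -- `d` codes the values at two adjacent cells of the kernel row by which the translation moves
    -- each preimage. For `d = 0` the program claims nothing. Otherwise `g 0` is paired with the
    -- preimage displaced by `d`, and the other two form the second pair.
    interval_cases d
    · exact cert_zero m f
    · refine two 1 (by norm_num) fun W => ?_
      have a1 := mv0 0 (by norm_num) (by decide +kernel) W
      have a2 := mv 1 2 (by norm_num) (by norm_num) (by decide +kernel) W
      rw [hgc, a1, a2]; ring
    · refine two 0 (by norm_num) fun W => ?_
      have a1 := mv0 1 (by norm_num) (by decide +kernel) W
      have a2 := mv 0 2 (by norm_num) (by norm_num) (by decide +kernel) W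
      rw [hgc, a1, a2]; ring
    · refine two 0 (by norm_num) fun W => ?_
      have a1 := mv0 2 (by norm_num) (by decide +kernel) W
      have a2 := mv 0 1 (by norm_num) (by norm_num) (by decide +kernel) W
      rw [hgc, a1, a2]; ring
  · exact cert_four hgc (N := fun i => branch rec m F L' rows
      (Nat.land (unstep F) (mask (52 + 2 * m))) (ifZero i 0 (kernelCode (i - 1)))) fun i hi => by
      rcases i with _ | i
      · exact c0
      · exact cb i (by omega)

theorem sound_search (n : ℕ) : Sound n (search n) := by
  induction n with
  | zero => exact fun m F L rows f _ _ _ _ => cert_zero m f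
  | succ n ih => exact sound_allParts ih

theorem initial_eq : initial = (List.range 48).map fun i => (2 ^ (i + 1), 0) := by decide +kernel

theorem searchState_zero : SearchState 0 0 initial 0 := by
  have hi : ∀ e ∈ initial, ∃ i < 48, e = (2 ^ (i + 1), 0) := fun e he => by
    rw [initial_eq, List.mem_map] at he
    obtain ⟨i, hi, rfl⟩ := he
    exact ⟨i, List.mem_range.1 hi, rfl⟩
  refine ⟨rfl, fun i _ => by simp [dig], fun e he => ?_, fun s s' _ _ h => funext fun x => ?_⟩
  · obtain ⟨i, hi, rfl⟩ := hi e he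
    exact ⟨validC_two_pow (by omega) (by omega), fun j hj => by
      rw [Nat.zero_testBit] at hj; exact absurd hj (by decide)⟩
  · have := h (2 ^ ((x % 48).toNat + 1), 0) (by
      rw [initial_eq, List.mem_map]
      exact ⟨_, List.mem_range.2 (by omega), rfl⟩) (x / 48)
    simp only [val, ev_two_pow, ev_zero, add_zero] at this
    rwa [show -(((0 : ℕ) : ℤ) + 1) + 48 * (x / 48) + (((x % 48).toNat + 1 : ℕ) : ℤ) = x by
      push_cast; omega] at this

theorem win_root : Win (Nat.land (kernelCode 0) (mask 52)) 52 (-2) (pre 0 (-2) 1 0) := by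
  have h : preCode 0 (50 + 2) (kernelCode 0) = Nat.land (kernelCode 0) (mask 52) := by decide +kernel
  have := win_preCode (F := 0) (w := 50) (b := kernelCode 0) (p := -1) (f := 0)
    (fun i _ => by simp [dig]) (by decide +kernel)
    fun i hi => kernelCode_rec 0 (by norm_num) i (by omega)
  obtain ⟨h0, h1⟩ := dig_kernelCode 0 (by norm_num)
  rw [h, h0, h1, show dig (unstep 0) 0 = 0 by decide +kernel,
    show dig (unstep 0) 1 = 0 by decide +kernel] at this
  exact this

theorem cert_root {n : ℕ} (hn : n ≤ 15) : Cert 1 (pre 0 (-2) 1 0) (root (search n)) := by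
  rw [root]
  rcases child_spec searchState_zero (by norm_num) (addStep_pre 0 (-2) 1 0) win_root with
    h | ⟨L', h, hS⟩
  · rw [h]; exact cert_zero _ _
  · rw [h]
    exact sound_search n _ _ _ _ _ le_rfl (by omega) hS ⟨rfl, addStep_pre 0 (-2) 1 0⟩

/-! ### Splitting the search -/

theorem child_sum4 (r : ℕ → ℕ → List (ℕ × ℕ) → ℕ) (F : ℕ) (L : List (ℕ × ℕ)) (G : ℕ) :
    child (fun G L => sum4 fun i => r i G L) F L G = sum4 fun i => child (r i) F L G := by
  have e : ∀ rec, child rec F L G = pullAllK (fixedCells F G) (nonlinearCells F G) (tripleNz G) G L []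
    fun L' => rec G L' := fun _ => rfl
  simp only [e]
  rcases pullAllK_spec F G L [] with h | ⟨L', h, -⟩
  · simp only [h]; rfl
  · simp only [h]

theorem root_sum4 (r : ℕ → Search) :
    root (fun m F L rows => sum4 fun i => r i m F L rows) = sum4 fun i => root (r i) :=
  child_sum4 _ _ _ _

theorem branch_sum4 (r : ℕ → Search) (m F : ℕ) (L : List (ℕ × ℕ)) (rows : List ℕ) (G b : ℕ) :
    branch (fun m F L rows => sum4 fun i => r i m F L rows) m F L rows G b =
      sum4 fun i => branch (r i) m F L rows G b :=
  child_sum4 _ _ _ _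

theorem two_mul_sum4 (f : ℕ → ℕ) : 2 * sum4 f = sum4 fun i => 2 * f i := by
  simp only [sum4]; ring

theorem branchPart_sum4 (m F : ℕ) (L : List (ℕ × ℕ)) (i : ℕ) (br : ℕ → ℕ → ℕ → ℕ) :
    branchPart m F L i (fun G b => sum4 fun j => br j G b) =
      sum4 fun j => branchPart m F L i (br j) := by
  simp only [branchPart, onDyadic_eq, ifZero_eq]
  rcases longer L (limit m) with _ | _
  swap
  · rfl
  simp only [sel_false]
  rcases isPre F (50 + 2 * m) (Nat.land (unstep F) (mask (52 + 2 * m))) with _ | _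
  · rfl
  simp only [sel_true]
  rcases Nat.beq i 1 with _ | _ <;> simp only [sel_true, sel_false] <;> split_ifs <;>
    first | rfl | exact two_mul_sum4 _

/-- The argument `z` accumulates the indices chosen at deeper levels, so that a node without
branches is counted for only one choice of them. -/
theorem part_sum4 (i z : ℕ) (r : ℕ → Search) :
    part i z (fun m F L rows => sum4 fun j => r j m F L rows) =
      fun m F L rows => sum4 fun j => part i (z + j) (r j) m F L rows := by
  have hz : ∀ x, (sum4 fun j => ifZero (i + (z + j)) x 0) = ifZero (i + z) x 0 := fun x => by
    simp only [ifZero_eq]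
    by_cases h : i + z = 0
    · obtain ⟨rfl, rfl⟩ : i = 0 ∧ z = 0 := by omega
      simp [sum4]
    · have h' : ∀ j, i + (z + j) ≠ 0 := fun j => by omega
      simp only [sum4, if_neg h, if_neg (h' _)]
  funext m F L rows
  rcases L with _ | ⟨e, _ | ⟨e', L⟩⟩
  · simp only [part_nil, hz]
  · simp only [part_single, hz]
  · simp only [part_cons_cons]
    rw [← branchPart_sum4]
    congr 1
    funext G b
    exact branch_sum4 r m F _ rows G b

/-- A part of the search, for one choice of the part at each of the first three levels. -/
noncomputable def chunk (i j k : ℕ) : ℕ := root (part i (j + k) (part j k (part k 0 (search 10))))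

theorem root_search : root (search 13) = sum4 fun i => sum4 fun j => sum4 fun k => chunk i j k := by
  have e : ∀ n, search (n + 1) = fun m F L rows => sum4 fun i => part i 0 (search n) m F L rows :=
    fun _ => rfl
  have e2 : ∀ i, part i 0 (search 12) = fun m F L rows => sum4 fun j => sum4 fun k =>
      part i (j + k) (part j k (part k 0 (search 10))) m F L rows := by
    intro i
    rw [e 11, part_sum4]
    funext m F L rows
    refine congrArg sum4 (funext fun j => ?_)
    rw [zero_add, e 10, part_sum4, part_sum4]
    simp only [zero_add]
  rw [e 12, root_sum4]
  refine congrArg sum4 (funext fun i => ?_)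
  rw [e2, root_sum4]
  exact congrArg sum4 (funext fun j => root_sum4 _)

/-! ### Evaluation of the search by the kernel -/

/-- The parts other than 1 at the first level amount to `2 ^ 29`, half of the `4 ^ 15` ancestors,
all credited to the zero ether. Within part 1, the second-level parts 2 and 3 contribute nothing,
which leaves eight chunks. -/
theorem sum4_of_beq (c : ℕ → ℕ → ℕ → ℕ)
    (h0 : Nat.beq (Nat.add (sum4 fun j => sum4 fun k => c 0 j k)
      (Nat.add (sum4 fun j => sum4 fun k => c 2 j k) (sum4 fun j => sum4 fun k => c 3 j k)))
      (2 ^ 29) = true)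
    (h1 : Nat.beq (Nat.add (sum4 fun k => c 1 2 k) (sum4 fun k => c 1 3 k)) 0 = true)
    (g00 : Nat.beq (c 1 0 0)
      6592072978689662800281846039502069395718994541030582208915834420377141085411135710370031203230857305657647740404022054083987824010869348285381394229656218574618896 = true)
    (g01 : Nat.beq (c 1 0 1)
      7841239003933433200541414180028973574774277914699668337931539082742402679570432 = true)
    (g02 : Nat.beq (c 1 0 2)
      1042076284808897489304946079622966098910868746533391448435493876786829127282288791823856741331149872954164657150264140704387845888747594921915614481007880968339456 = true)
    (g03 : Nat.beq (c 1 0 3)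
      10451626978359283703191777577320635456249214634698619599870841506860844049297189754790695630986432430705968849640271076232151455381428702487476876215444694112403456 = true)
    (g10 : Nat.beq (c 1 1 0)
      2626923500121044267195012714606808817691360375551221213603672967788754883678275262805030048 = true)
    (g11 : Nat.beq (c 1 1 1)
      889348266465240749795337805047177066784468473197264334462999600522682751160733547415800658096313321481129104403025207665945657359877109621015466450824986023971072 = true)
    (g12 : Nat.beq (c 1 1 2)
      7901610040221598839050538874272970423783517860986833914912907803200 = true)
    (g13 : Nat.beq (c 1 1 3)
      7901610040221598839050538874272970423783517860986833914912907803200 = true) :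
    (sum4 fun i => sum4 fun j => sum4 fun k => c i j k) =
      18975124508323084742573907501492848017663546395459857591685169404547497015778271304529269739843714881826341026666649928890216820100142958478197747805781271516410672 := by
  replace h0 := Nat.eq_of_beq_eq_true h0
  replace h1 := Nat.eq_of_beq_eq_true h1
  simp only [sum4, Nat.add_eq] at h0 h1 ⊢
  rw [Nat.eq_of_beq_eq_true g00, Nat.eq_of_beq_eq_true g01, Nat.eq_of_beq_eq_true g02,
    Nat.eq_of_beq_eq_true g03, Nat.eq_of_beq_eq_true g10, Nat.eq_of_beq_eq_true g11,
    Nat.eq_of_beq_eq_true g12, Nat.eq_of_beq_eq_true g13]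
  omega

set_option maxHeartbeats 0 in
set_option maxRecDepth 100000 in
theorem root_search_eq : root (search 13) =
    18975124508323084742573907501492848017663546395459857591685169404547497015778271304529269739843714881826341026666649928890216820100142958478197747805781271516410672 :=
  root_search.trans (sum4_of_beq chunk (by decide +kernel) (by decide +kernel)
    (by decide +kernel) (by decide +kernel) (by decide +kernel) (by decide +kernel)
    (by decide +kernel) (by decide +kernel) (by decide +kernel) (by decide +kernel))

/-! ### Probabilities -/

theorem digit_of_sum {B : ℕ} (hB : 0 < B) (j : ℕ) {n : ℕ} {d : ℕ → ℕ} (hj : j < n)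
    (hd : ∀ i ≤ j, d i < B) : (∑ k ∈ Finset.range n, d k * B ^ k) / B ^ j % B = d j := by
  induction j generalizing n d with
  | zero =>
    obtain ⟨n, rfl⟩ : ∃ n', n = n' + 1 := ⟨n - 1, by omega⟩
    rw [Finset.sum_range_succ', pow_zero, Nat.div_one, mul_one]
    simp only [pow_succ, ← mul_assoc, ← Finset.sum_mul]
    rw [Nat.mul_add_mod_self_right, Nat.mod_eq_of_lt (hd 0 le_rfl)]
  | succ j ih =>
    obtain ⟨n, rfl⟩ : ∃ n', n = n' + 1 := ⟨n - 1, by omega⟩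
    rw [Finset.sum_range_succ', pow_zero, mul_one, pow_succ', ← Nat.div_div_eq_div_mul]
    simp only [pow_succ, ← mul_assoc, ← Finset.sum_mul]
    rw [mul_comm _ B, Nat.mul_add_div hB, Nat.div_eq_of_lt (hd 0 (by omega)), add_zero]
    exact ih (by omega) fun i hi => hd (i + 1) (by omega)

theorem cnt_le (P : (ℤ → ZMod 2) → Prop) (k : ℕ) (f : ℤ → ZMod 2) : cnt P k f ≤ 4 ^ k :=
  (cnt_mono fun _ _ _ => trivial).trans (cnt_of_forall (P := fun _ => True) fun _ _ => trivial).le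

theorem cnt_add_zero {P : (ℤ → ZMod 2) → Prop} (hP : ∀ c g, P g → P (shift c g)) (k n : ℕ) (q : ℤ) :
    cnt P (k + n) 0 = cnt P k 0 + 3 * ∑ i ∈ Finset.range n, cnt P (k + i) (pre 0 q 1 0) := by
  induction n with
  | zero => simp
  | succ n ih =>
    rw [← add_assoc, cnt_succ_zero hP _ q, ih, Finset.sum_range_succ]; ring

/-- The rows are sorted by the time of their death. The last nonzero row is one of the three
translates of `…110110…`; the 17 summands are the deaths after 16 to 32 steps, and earlier deaths
are discarded. -/
theorem three_mul_goodCount_le (W : Finset ℕ) (q : ℤ) :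
    3 * goodCount W 1 (pre 0 q 1 0) ≤ cnt (GoodClass W 32) 32 0 := by
  have h := cnt_add_zero (P := GoodClass W 32) (fun c g => GoodClass.shift c g) 15 17 q
  rw [show (15 + 17 : ℕ) = 32 by norm_num] at h
  rw [h, goodCount, ← Finset.sum_range_reflect]
  refine le_trans (Nat.mul_le_mul_left 3 (Finset.sum_le_sum fun j hj => ?_)) (Nat.le_add_left _ _)
  have hj' := Finset.mem_range.1 hj
  rw [show 32 - 1 - (17 - 1 - j) = 15 + j by omega]

/-- The numbers of ancestors, in units of `weight`, that lead to the ethers. -/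
def counts (k : ℕ) : ℕ := List.getD
  [659682096, 52131520, 40131040, 91921216, 24658368, 23172512, 9191872, 2695744, 5528240, 738848,
    5570016, 14504384, 917376, 5528240] k 0

theorem counts_eq {N : ℕ}
    (hN : N = 18975124508323084742573907501492848017663546395459857591685169404547497015778271304529269739843714881826341026666649928890216820100142958478197747805781271516410672) :
    ∀ k < 14, N / (2 ^ 40) ^ k % 2 ^ 40 = counts k := by
  subst hN
  decide +kernel

theorem counts_le {W : Finset ℕ} (hW : W ⊆ Finset.range 14) :
    3 * (weight * ∑ k ∈ W, counts k) ≤ cnt (GoodClass W 32) 32 0 := by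
  obtain ⟨d, hN, hd⟩ := cert_root (n := 13) (by norm_num)
  -- There are no carries between the packed counts: each is at most the number `4 ^ 15` of
  -- ancestors.
  have hlt : ∀ k < 14, d k < 2 ^ 40 := fun k hk => by
    have h1 := hd {k} (by simpa using hk)
    have h2 : goodCount {k} 1 (pre 0 (-2) 1 0) ≤ weight * 4 ^ 15 := by
      rw [← weight_eq, goodCount, Finset.sum_mul]
      refine Finset.sum_le_sum fun j hj => (cnt_le _ _ _).trans_eq ?_
      have hj' := Finset.mem_range.1 hj
      rw [← pow_add, show 16 - j + 15 = 32 - 1 - j by omega]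
    rw [Finset.sum_singleton] at h1
    exact (Nat.le_of_mul_le_mul_left (h1.trans h2) (by decide)).trans_lt (by norm_num)
  have hp : ∀ k a, place k a = a * (2 ^ 40) ^ k := fun k a => by rw [← pow_mul]; rfl
  have hdc : ∀ k < 14, d k = counts k := fun k hk => by
    rw [← counts_eq root_search_eq k hk, hN]
    simp only [hp]
    exact (digit_of_sum (by norm_num) k (by omega) fun i hi => hlt i (by omega)).symm
  rw [← Finset.sum_congr rfl fun k hk => hdc k (Finset.mem_range.1 (hW hk))]
  exact (Nat.mul_le_mul_left 3 (hd W hW)).trans (three_mul_goodCount_le W (-2))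

theorem liminfProb_ge_of_goodClass {W : Finset ℕ} (hW : W ⊆ Finset.range 14)
    {E : (ℤ → State) → Prop} (hE : ∀ k ∈ W, ∀ ξ, IsReplicatorWith (ether k) ξ → E ξ) :
    ((3 * (weight * ∑ k ∈ W, counts k) / 4 ^ 32 : ℚ) : ℝ) ≤ liminfProb E := by
  refine le_trans ?_ (liminfProb_ge (X := GoodClass W 32) fun L ω h => ?_)
  · have := counts_le hW
    push_cast
    gcongr
    exact_mod_cast this
  · obtain ⟨k, hk, h⟩ := h
    exact hE k hk _ (isReplicatorWith_of_goodFor (isHistory_ether (Finset.mem_range.1 (hW hk)))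
      (isEther_ether k) (ether_add_sixteen k) (ether_add_eight k)
      (fun x hx => level_binarySeed_outside L ω x hx) h)

theorem liminfProb_isReplicator : (0.826 : ℝ) ≤ liminfProb IsReplicator := by
  refine le_trans ?_ (liminfProb_ge_of_goodClass (Finset.Subset.refl _)
    fun k _ ξ h => ⟨ether k, h⟩)
  have : (0.826 : ℚ) ≤ 3 * (weight * ∑ k ∈ Finset.range 14, counts k : ℕ) / 4 ^ 32 := by
    decide +kernel
  have := (Rat.cast_le (K := ℝ)).2 this
  push_cast at this ⊢
  exact this

theorem liminfProb_ether {k : ℕ} (hk : k < 14) :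
    ((3 * (weight * counts k) / 4 ^ 32 : ℚ) : ℝ) ≤ liminfProb (IsReplicatorWith (ether k)) := by
  have := liminfProb_ge_of_goodClass (W := {k}) (E := IsReplicatorWith (ether k)) (by simpa using hk)
    fun i hi ξ h => by rwa [Finset.mem_singleton.1 hi] at h
  rwa [Finset.sum_singleton] at this

/-! ### Equivalent ethers -/

theorem Equivalent.symm {η η' : ℤ → ℤ → State} (h : Equivalent η η') : Equivalent η' η := by
  obtain ⟨a, s, h⟩ := h
  exact ⟨-a, -s, fun x t => by rw [h]; congr 1 <;> ring⟩

theorem Equivalent.trans {η η' η'' : ℤ → ℤ → State} (h : Equivalent η η') (h' : Equivalent η' η'') :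
    Equivalent η η'' := by
  obtain ⟨a, s, h⟩ := h
  obtain ⟨b, u, h'⟩ := h'
  exact ⟨b + a, u + s, fun x t => by rw [h', h]; congr 1 <;> ring⟩

theorem IsEther.of_equivalent {η η' : ℤ → ℤ → State} (hη : IsEther η) (h : Equivalent η η') :
    IsEther η' := by
  obtain ⟨a, s, h⟩ := h
  obtain ⟨h1, ⟨p, hp, h2⟩, q, hq, h3⟩ := hη
  refine ⟨fun x t => h x t ▸ h1 _ _, ⟨p, hp, fun x t => ?_⟩, ⟨q, hq, fun x t => ?_⟩⟩
  · rw [h, h, add_right_comm, h2]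
  · rw [h, h, add_right_comm, h3]

theorem IsReplicatorWith.of_equivalent {η η' : ℤ → ℤ → State} (h : Equivalent η η')
    {ξ : ℤ → State} (hξ : IsReplicatorWith η ξ) : IsReplicatorWith η' ξ := by
  obtain ⟨hE, r, hr⟩ := hξ
  refine ⟨hE.of_equivalent h, r, fun K hK hfin => ?_⟩
  obtain ⟨η'', h1, h2⟩ := hr K hK hfin
  exact ⟨η'', h.symm.trans h1, h2⟩

/-! ### The ethers of the table -/

def cell (k s y : ℕ) : State := if (etherSlice k s).testBit y then 2 else 0

theorem ether_eq_cell (k : ℕ) (x t : ℤ) : ether k x t = cell k (t % 8).toNat (x % 16).toNat := rfl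

theorem forall_ether {P : State → State → Prop} {k l p q : ℕ}
    (h : ∀ s < 8, ∀ y < 16, P (cell k ((s + q) % 8) ((y + p) % 16)) (cell l s y)) (x t : ℤ) :
    P (ether k (x + p) (t + q)) (ether l x t) := by
  have := h (t % 8).toNat (by omega) (x % 16).toNat (by omega)
  rw [ether_eq_cell, ether_eq_cell]
  rwa [show ((t + q) % 8).toNat = ((t % 8).toNat + q) % 8 by omega,
    show ((x + p) % 16).toNat = ((x % 16).toNat + p) % 16 by omega]

theorem exists_ether_ne {k l p q : ℕ}
    (h : ∃ s < 8, ∃ y < 16, cell k ((s + q) % 8) ((y + p) % 16) ≠ cell l s y) :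
    ∃ x t : ℤ, ether k (x + p) (t + q) ≠ ether l x t := by
  obtain ⟨s, hs, y, hy, h⟩ := h
  refine ⟨y, s, ?_⟩
  rw [ether_eq_cell, ether_eq_cell]
  rwa [show (((s : ℤ) + q) % 8).toNat = (s + q) % 8 by omega,
    show (((y : ℤ) + p) % 16).toNat = (y + p) % 16 by omega, show ((s : ℤ) % 8).toNat = s by omega,
    show ((y : ℤ) % 16).toNat = y by omega]

def rowOf (k : ℕ) : Row := table.getD k ⟨[], 0, 0, 0, true, 0⟩

theorem exists_rowOf {row : Row} (h : row ∈ table) : ∃ k < 13, row = rowOf k := by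
  obtain ⟨k, hk, rfl⟩ := List.mem_iff_getElem.1 h
  exact ⟨k, hk, (List.getD_eq_getElem _ _ hk).symm⟩

theorem spatialPeriod_rowOf : ∀ k < 13, (rowOf k).spatialPeriod = (rowOf k).signature.length ∧
    0 < (rowOf k).spatialPeriod ∧ 16 % (rowOf k).spatialPeriod = 0 := by
  decide +kernel

theorem cell_zero_rowOf : ∀ k < 13, ∀ y < 16,
    cell k 0 y = (rowOf k).signature.getD (y % (rowOf k).spatialPeriod) 0 := by
  decide +kernel

theorem ether_zero {k : ℕ} (hk : k < 13) (x : ℤ) :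
    ether k x 0 = periodicWord (rowOf k).signature x := by
  obtain ⟨h1, h2, h3⟩ := spatialPeriod_rowOf k hk
  rw [ether_eq_cell, periodicWord, ← h1, Int.zero_emod, Int.toNat_zero,
    cell_zero_rowOf k hk _ (by omega)]
  congr 1
  zify
  rw [Int.toNat_of_nonneg (Int.emod_nonneg _ (by norm_num)),
    Int.toNat_of_nonneg (Int.emod_nonneg _ (by omega))]
  refine Int.emod_emod_of_dvd _ ?_
  exact_mod_cast Nat.dvd_of_mod_eq_zero h3

theorem isGeneratedBy_ether {k : ℕ} (hk : k < 13) : IsGeneratedBy (ether k) (rowOf k).signature :=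
  ⟨isEther_ether k, isHistory_ether (by omega), ether_zero hk⟩

theorem cell_temporalPeriod : ∀ k < 13, 0 < (rowOf k).temporalPeriod ∧
    (∀ s < 8, ∀ y < 16, cell k ((s + (rowOf k).temporalPeriod) % 8) ((y + 0) % 16) = cell k s y) ∧
    ∀ q < (rowOf k).temporalPeriod, q = 0 ∨
      ∃ s < 8, ∃ y < 16, cell k ((s + q) % 8) ((y + 0) % 16) ≠ cell k s y := by
  decide +kernel

theorem hasTemporalPeriod_ether {k : ℕ} (hk : k < 13) :
    HasTemporalPeriod (ether k) (rowOf k).temporalPeriod := by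
  obtain ⟨h0, h1, h2⟩ := cell_temporalPeriod k hk
  refine ⟨⟨h0, fun x t => ?_⟩, fun q hq => ?_⟩
  · simpa using forall_ether (P := Eq) h1 x t
  · by_contra hlt
    rcases h2 q (not_le.1 hlt) with rfl | h
    · exact absurd hq.1 (lt_irrefl _)
    · obtain ⟨x, t, h⟩ := exists_ether_ne h
      exact h (by simpa using hq.2 x t)

theorem cell_spatialPeriod : ∀ k < 13,
    (∀ s < 8, ∀ y < 16, cell k ((s + 0) % 8) ((y + (rowOf k).spatialPeriod) % 16) = cell k s y) ∧
    ∀ s < 8, ∀ q < (rowOf k).spatialPeriod, q = 0 ∨ ∃ y < 16, cell k s ((y + q) % 16) ≠ cell k s y := by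
  decide +kernel

theorem exists_ether_ne_of_lt {k q : ℕ} (hk : k < 13) (hq0 : 0 < q)
    (hq : q < (rowOf k).spatialPeriod) (t : ℤ) : ∃ x : ℤ, ether k (x + q) t ≠ ether k x t := by
  rcases (cell_spatialPeriod k hk).2 (t % 8).toNat (by omega) q hq with rfl | ⟨y, hy, h⟩
  · exact absurd hq0 (lt_irrefl _)
  · refine ⟨y, ?_⟩
    rw [ether_eq_cell, ether_eq_cell]
    rwa [show (((y : ℤ) + q) % 16).toNat = (y + q) % 16 by omega,
      show ((y : ℤ) % 16).toNat = y by omega]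

theorem hasSpatialPeriod_ether {k : ℕ} (hk : k < 13) :
    HasSpatialPeriod (ether k) (rowOf k).spatialPeriod := by
  refine ⟨⟨(spatialPeriod_rowOf k hk).2.1, fun x t => ?_⟩, fun q hq => ?_⟩
  · simpa using forall_ether (P := Eq) (cell_spatialPeriod k hk).1 x t
  · by_contra hlt
    obtain ⟨x, h⟩ := exists_ether_ne_of_lt hk hq.1 (not_le.1 hlt) 0
    exact h (hq.2 x 0)

theorem card_twos : ∀ k < 13, densityOfTwos (ether k) (rowOf k).spatialPeriod
    (rowOf k).temporalPeriod = (rowOf k).density := by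
  decide +kernel

theorem signature_le_rotation : ∀ k < 13, ∀ s < 8, ∀ b < 16, (rowOf k).signature ≤
    (List.range (rowOf k).spatialPeriod).map fun i => cell k s ((i + b) % 16) := by
  decide +kernel

/-- Every single slice, not only the whole ether, has the spatial period as its least period. So no
slice has a shorter string, and the strings of this length are the rotations of slices compared in
`signature_le_rotation`. -/
theorem isSignature_ether {k : ℕ} (hk : k < 13) : IsSignature (ether k) (rowOf k).signature := by
  obtain ⟨e1, e2, -⟩ := spatialPeriod_rowOf k hk
  refine ⟨⟨fun h => ?_, 0, 0, fun x => by rw [add_zero]; exact ether_zero hk x⟩, ?_⟩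
  · rw [h] at e1; simp at e1; omega
  rintro B ⟨hB, t, a, h⟩
  have hB0 : 0 < B.length := List.length_pos_iff.2 hB
  rw [← e1]
  rcases lt_trichotomy (rowOf k).spatialPeriod B.length with hl | hl | hl
  · exact Or.inl hl
  · refine Or.inr ⟨hl, ?_⟩
    convert signature_le_rotation k hk (t % 8).toNat (by omega) ((-a) % 16).toNat (by omega) using 1
    refine List.ext_getElem (by simpa using hl.symm) fun i h1 h2 => ?_
    have := h (i - a)
    rw [sub_add_cancel, periodicWord, Int.emod_eq_of_lt (by omega) (by exact_mod_cast h1),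
      Int.toNat_natCast, List.getD_eq_getElem _ _ h1, ether_eq_cell] at this
    rw [← this, List.getElem_map, List.getElem_range]
    congr 1
    omega
  · obtain ⟨x, hx⟩ := exists_ether_ne_of_lt hk hB0 hl t
    refine absurd ?_ hx
    rw [h, h, periodicWord, periodicWord, add_right_comm, Int.add_emod_right]

theorem cell_reflect : ∀ k < 13, (rowOf k).symmetric = true →
    ∃ a < 16, ∃ u < 8, ∀ s < 8, ∀ y < 16, cell k s ((16 - y) % 16) =
      cell k ((s + u) % 8) ((y + a) % 16) := by
  decide +kernel

/-- The second half lets the count for `ether 13` serve as the count for the reflection of `ether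
8`. -/
theorem cell_reflect_eight : (∀ a < 16, ∀ u < 8, ∃ s < 8, ∃ y < 16, cell 8 s ((16 - y) % 16) ≠
      cell 8 ((s + u) % 8) ((y + a) % 16)) ∧
    ∃ a < 16, ∃ u < 8, ∀ s < 8, ∀ y < 16, cell 8 s ((16 - y) % 16) =
      cell 13 ((s + u) % 8) ((y + a) % 16) := by
  decide +kernel

theorem equivalent_reflect {k l : ℕ} (h : ∃ a < 16, ∃ u < 8, ∀ s < 8, ∀ y < 16,
    cell k s ((16 - y) % 16) = cell l ((s + u) % 8) ((y + a) % 16)) :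
    Equivalent (ether l) (reflect (ether k)) := by
  obtain ⟨a, -, u, -, h⟩ := h
  refine ⟨a, u, fun x t => ?_⟩
  have := h (t % 8).toNat (by omega) (x % 16).toNat (by omega)
  rw [reflect, ether_eq_cell, ether_eq_cell]
  rwa [show ((t + u) % 8).toNat = ((t % 8).toNat + u) % 8 by omega,
    show ((x + a) % 16).toNat = ((x % 16).toNat + a) % 16 by omega,
    show ((-x) % 16).toNat = (16 - (x % 16).toNat) % 16 by omega]

theorem not_isSymmetric_eight : ¬ IsSymmetric (ether 8) := by
  rintro ⟨a, u, h⟩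
  obtain ⟨s, hs, y, hy, hne⟩ := cell_reflect_eight.1 (a % 16).toNat (by omega) (u % 8).toNat (by omega)
  refine hne ?_
  have := h y s
  rw [reflect, ether_eq_cell, ether_eq_cell] at this
  rwa [show ((s + u) % 8).toNat = (s + (u % 8).toNat) % 8 by omega,
    show ((y + a) % 16).toNat = (y + (a % 16).toNat) % 16 by omega,
    show ((s : ℤ) % 8).toNat = s by omega,
    show ((-(y : ℤ)) % 16).toNat = (16 - y) % 16 by omega] at this

theorem eq_eight_of_not_symmetric : ∀ k < 13, ((rowOf k).symmetric = false ↔ k = 8) := by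
  decide +kernel

theorem isSymmetric_ether_iff {k : ℕ} (hk : k < 13) :
    IsSymmetric (ether k) ↔ (rowOf k).symmetric = true := by
  refine ⟨fun h => ?_, fun h => equivalent_reflect (cell_reflect k hk h)⟩
  by_contra hs
  obtain rfl := (eq_eight_of_not_symmetric k hk).1 (by simpa using hs)
  exact not_isSymmetric_eight h

theorem bound_le : ∀ k < 13, k ≠ 8 →
    (rowOf k).bound ≤ 3 * (weight * counts k) / 4 ^ 32 := by
  decide +kernel

theorem bound_eight_le : (rowOf 8).bound ≤
    3 * (weight * counts 8) / 4 ^ 32 + 3 * (weight * counts 13) / 4 ^ 32 := by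
  decide +kernel

end ExtendedOneOrThree

open ExtendedOneOrThree in
theorem mainTheorem7 :
    (0.826 : ℝ) ≤ liminfProb IsReplicator ∧
    ∀ row ∈ table, ∃ η : ℤ → ℤ → State,
      IsGeneratedBy η row.signature ∧
      IsSignature η row.signature ∧
      HasTemporalPeriod η row.temporalPeriod ∧
      HasSpatialPeriod η row.spatialPeriod ∧
      densityOfTwos η row.spatialPeriod row.temporalPeriod = row.density ∧
      (IsSymmetric η ↔ row.symmetric = true) ∧
      (row.symmetric = true → (row.bound : ℝ) ≤ liminfProb (IsReplicatorWith η)) ∧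
      (row.symmetric = false → (row.bound : ℝ) ≤
        liminfProb (IsReplicatorWith η) + liminfProb (IsReplicatorWith (reflect η))) := by
  refine ⟨liminfProb_isReplicator, fun row hrow => ?_⟩
  obtain ⟨k, hk, rfl⟩ := exists_rowOf hrow
  refine ⟨ether k, isGeneratedBy_ether hk, isSignature_ether hk, hasTemporalPeriod_ether hk,
    hasSpatialPeriod_ether hk, card_twos k hk, isSymmetric_ether_iff hk, fun hs => ?_, fun hs => ?_⟩
  · have h8 : k ≠ 8 := fun h => by
      rw [(eq_eight_of_not_symmetric k hk).2 h] at hs; exact absurd hs (by decide)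
    exact (Rat.cast_le.2 (bound_le k hk h8)).trans (liminfProb_ether (by omega))
  · obtain rfl := (eq_eight_of_not_symmetric k hk).1 hs
    have he : Equivalent (ether 13) (reflect (ether 8)) := equivalent_reflect cell_reflect_eight.2
    have h13 : ((3 * (weight * counts 13) / 4 ^ 32 : ℚ) : ℝ) ≤
        liminfProb (IsReplicatorWith (reflect (ether 8))) := by
      have := liminfProb_ge_of_goodClass (W := {13}) (E := IsReplicatorWith (reflect (ether 8)))
        (by simp) fun i hi ξ h => by
          rw [Finset.mem_singleton.1 hi] at h
          exact h.of_equivalent he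
      rwa [Finset.sum_singleton] at this
    refine (Rat.cast_le.2 bound_eight_le).trans ?_
    rw [Rat.cast_add]
    exact add_le_add (liminfProb_ether (by norm_num)) h13
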